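/- Let $E$ be a field with a valuation $v$ (of arbitrary value group, written additively), with valuation ring $\mathcal O_v$, residue field $Ev$ and value group $vE$. Let $f(t)=\sum_{i=0}^n a_it^i\in E[t]$ be a square-free polynomial of degree $n$, and assume that $\mathrm{char}(Ev)=0$ or $\mathrm{char}(Ev)>n$. Let $F=E(X)[\sqrt{f(X)}]$, where $X$ is transcendental over $E$, be the function field of the curve $Y^2=f(X)$. Two valuations are considered distinct if their valuation rings differ. A valuation $w$ on $F$ extending $v$ is called residually transcendental if $Fw/Ev$ is transcendental; $\Omega_v(F)$ denotes the set of these valuations. For $w\in\Omega_v(F)$, the extension $Fw/Ev$ is called ruled if $Fw=\ell(x)$ for some finite extension $\ell/Ev$ and some $x\in Fw$ (transcendental over $\ell$); $\Omega_v^*(F)$ denotes the set of all $w\in\Omega_v(F)$ for which $Fw/Ev$ is not ruled. For $w\in\Omega_v(F)$ put $S_{f,X}(w)=\{i\in\{0,\dots,n\} : w(a_iX^i)=\min_{0\le j\le n} w(a_jX^j)\}$, and call $w$ covert with respect to $(f,X)$ if $w(f(X))\neq\min_{0\le j\le n} w(a_jX^j)$. Let $S=\{i_0<i_1<\dots<i_k\}\subseteq\{0,\dots,n\}$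 with $k\ge1$ be such that $S=S_{f,X}(w)$ for some $w\in\Omega_v(F)$. Let $d=\gcd(i_1-i_0,\dots,i_k-i_0)$ and let $b\in E^\times$ be such that $w(bX^d)=0$ for all $w\in\Omega_v(F)$ with $S_{f,X}(w)=S$ (such $b$ exists). Let $e_S$ be the order of $v(b)/d$ in $vE^{\mathbb Q}/vE$, where $vE^{\mathbb Q}$ is the divisible hull of $vE$ (it does not depend on the choice of $b$, and it divides $d$). For $c\in E$ with $w(cX^{e_S})=0$ for some (equivalently, every) $w\in\Omega_v(F)$ with $S_{f,X}(w)=S$, put $$p_{S,f,c}(t)=\sum_{j=0}^k\overline{a_{i_j}a_{i_0}^{-1}c^{-n_j}}\;t^{n_j}\in Ev[t],\qquad n_j=\frac{i_j-i_0}{e_S}.$$ Let $\Omega\subseteq\Omega_v(F)$. Assume that for every $w\in\Omega$ such that $S=S_{f,X}(w)$ has at least two elements, and for every $c_S\in E$ with $w(c_SX^{e_S})=0$, the polynomial $p_{S,f,c_S}$ is separable (that is, coprime to its derivative). Then no $w\in\Omega$ that is covert with respect to $(f,X)$ lies in $\Omega_v^*(F)$, and $\Omega\cap\Omega_v^*(F)$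 is finite. -/

import Mathlib

namespace HyperellipticResidue

open Polynomial

variable {E F : Type*} [Field E] [Field F] [Algebra E F]

/-- A valuation on a field is represented by its valuation ring (two valuations are regarded as
distinct iff their valuation rings differ). An extension of `v` to `F` is a valuation on `F`
which restricts to `v` on `E`. -/
structure ValExt (v : ValuationSubring E) (F : Type*) [Field F] [Algebra E F] where
  ring : ValuationSubring F
  restrict_eq : ring.comap (algebraMap E F) = v

/-- The residue field of a valuation. -/
abbrev Res {K : Type*} [Field K] (v : ValuationSubring K) : Type _ :=
  IsLocalRing.ResidueField v

/-- The residue class of an element `x` of the valuation ring (and `0` for the other `x`). -/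
noncomputable def residue {K : Type*} [Field K] (v : ValuationSubring K) (x : K) : Res v :=
  open Classical in if h : x ∈ v then IsLocalRing.residue v ⟨x, h⟩ else 0

namespace ValExt

variable {v : ValuationSubring E}

theorem algebraMap_mem_iff (w : ValExt v F) {x : E} : algebraMap E F x ∈ w.ring ↔ x ∈ v := by
  rw [← ValuationSubring.mem_comap, w.restrict_eq]

/-- The inclusion of valuation rings induced by `E → F`. -/
def ringMap (w : ValExt v F) : v →+* w.ring :=
  (algebraMap E F).restrict v w.ring fun _ hx => w.algebraMap_mem_iff.2 hx

instance (w : ValExt v F) : IsLocalHom w.ringMap where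
  map_nonunit a ha := by
    obtain ⟨b, hb⟩ := isUnit_iff_exists_inv.1 ha
    have hb' : algebraMap E F (a : E) * (b : F) = 1 := congrArg Subtype.val hb
    have ha0 : (a : E) ≠ 0 := by
      intro h
      rw [h, map_zero, zero_mul] at hb'
      exact zero_ne_one hb'
    have hbe : (b : F) = algebraMap E F (a : E)⁻¹ := by
      rw [map_inv₀]
      exact eq_inv_of_mul_eq_one_right hb'
    have hm : (a : E)⁻¹ ∈ v := w.algebraMap_mem_iff.1 (hbe ▸ b.2)
    exact isUnit_iff_exists_inv.2 ⟨⟨_, hm⟩, Subtype.ext (mul_inv_cancel₀ ha0)⟩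

/-- The residue field extension `Fw / Ev`. -/
noncomputable instance (w : ValExt v F) : Algebra (Res v) (Res w.ring) :=
  (IsLocalRing.ResidueField.map w.ringMap).toAlgebra

end ValExt

/-- A field extension `L / K` (a function field in one variable, in the cases of interest) is ruled
if `L = K'(x)` for a finite extension `K' / K` inside `L` and an element `x`
(which is transcendental over `K'`). -/
def IsRuled (K L : Type*) [Field K] [Field L] [Algebra K L] : Prop :=
  ∃ K' : IntermediateField K L, FiniteDimensional K K' ∧
    ∃ x : L, Transcendental K' x ∧ IntermediateField.adjoin K' {x} = ⊤

/-- The set of residually transcendental extensions of `v` to `F`. -/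
def resTrans (v : ValuationSubring E) (F : Type*) [Field F] [Algebra E F] : Set (ValExt v F) :=
  {w | Algebra.Transcendental (Res v) (Res w.ring)}

/-- The set of residually transcendental extensions of `v` to `F` whose residue field extension
is not ruled. -/
def resTransNonRuled (v : ValuationSubring E) (F : Type*) [Field F] [Algebra E F] :
    Set (ValExt v F) :=
  {w | w ∈ resTrans v F ∧ ¬ IsRuled (Res v) (Res w.ring)}

section

variable {v : ValuationSubring E}

/-- The minimum of the values of the terms `a_i X ^ i`, for `0 ≤ i ≤ n`, where `n` is the degree of
`f = ∑ a_i t ^ i`. Values are written multiplicatively in Mathlib, with `w x ≤ 1` for `x` in the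
valuation ring, so that a minimum of additive values becomes a maximum. -/
noncomputable def termValue (w : ValExt v F) (f : E[X]) (X : F) : w.ring.ValueGroup :=
  (Finset.range (f.natDegree + 1)).sup' Finset.nonempty_range_add_one
    fun i => w.ring.valuation (algebraMap E F (f.coeff i) * X ^ i)

/-- The set `S_{f,X}(w)` of the indices at which the minimum of the values of the terms
is attained. -/
noncomputable def minIndices (w : ValExt v F) (f : E[X]) (X : F) : Finset ℕ :=
  open Classical in (Finset.range (f.natDegree + 1)).filter fun i =>
    w.ring.valuation (algebraMap E F (f.coeff i) * X ^ i) = termValue w f X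

/-- `w` is overt with respect to `(f, X)` if the value of `f(X)` is the minimum of the values
of its terms, and covert otherwise. -/
def IsOvert (w : ValExt v F) (f : E[X]) (X : F) : Prop :=
  w.ring.valuation (aeval X f) = termValue w f X

/-- The set of the extensions in `Ω` that are covert with respect to `(f, X)`. -/
def covert (f : E[X]) (X : F) (Ω : Set (ValExt v F)) : Set (ValExt v F) :=
  {w | w ∈ Ω ∧ ¬ IsOvert w f X}

end

/-- The set `Ω_{S,f,X}`. -/
def resTransOf (v : ValuationSubring E) (f : E[X]) (X : F) (S : Finset ℕ) : Set (ValExt v F) :=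
  {w | w ∈ resTrans v F ∧ minIndices w f X = S}

/-- The smallest element `i₀` of `S`. -/
noncomputable def firstIndex (S : Finset ℕ) : ℕ := sInf (S : Set ℕ)

/-- The greatest common divisor `d` of the differences `i - i₀`, for `i` in `S`. -/
noncomputable def gapGcd (S : Finset ℕ) : ℕ := S.gcd fun i => i - firstIndex S

/-- `b` is a nonzero element of `E` such that `b X ^ d` has value zero for all `w` in
`Ω_{S,f,X}`. -/
def IsScale (v : ValuationSubring E) (f : E[X]) (X : F) (S : Finset ℕ) (b : Eˣ) : Prop :=
  ∀ w ∈ resTransOf v f X S, w.ring.valuation (algebraMap E F b * X ^ gapGcd S) = 1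

theorem mem_firstIndex {S : Finset ℕ} (hS : S.Nonempty) : firstIndex S ∈ S :=
  Nat.sInf_mem (s := (S : Set ℕ)) hS

theorem firstIndex_le {S : Finset ℕ} {i : ℕ} (hi : i ∈ S) : firstIndex S ≤ i :=
  Nat.sInf_le (s := (S : Set ℕ)) hi

/-- An element `b` as in `IsScale` exists. -/
theorem exists_isScale (v : ValuationSubring E) {f : E[X]} (hf : f ≠ 0) {X : F} (hX : X ≠ 0)
    {S : Finset ℕ} (hS : S.Nonempty) : ∃ b : Eˣ, IsScale v f X S b := by
  by_cases hne : (resTransOf v f X S).Nonempty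
  swap
  · exact ⟨1, fun w hw => (hne ⟨w, hw⟩).elim⟩
  have key : ∀ i ∈ S, f.coeff i ≠ 0 := by
    obtain ⟨w, -, hw⟩ := hne
    intro i hi h0
    rw [← hw, minIndices, Finset.mem_filter] at hi
    have h1 := hi.2
    rw [h0, map_zero, zero_mul, map_zero] at h1
    have h2 : w.ring.valuation (algebraMap E F (f.coeff f.natDegree) * X ^ f.natDegree)
        ≤ termValue w f X :=
      Finset.le_sup' (fun i => w.ring.valuation (algebraMap E F (f.coeff i) * X ^ i))
        (Finset.self_mem_range_succ _)
    rw [← h1] at h2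
    have h3 := (map_eq_zero _).1 (le_antisymm h2 zero_le)
    rcases mul_eq_zero.1 h3 with h | h
    · exact hf (leadingCoeff_eq_zero.1 ((map_eq_zero _).1 h))
    · exact absurd h (pow_ne_zero _ hX)
  let H : AddSubgroup ℤ :=
    { carrier := {m | ∃ b : Eˣ, ∀ w ∈ resTransOf v f X S,
        w.ring.valuation (algebraMap E F b * X ^ m) = 1}
      zero_mem' := ⟨1, fun w _ => by simp⟩
      add_mem' := by
        rintro m m' ⟨b, hb⟩ ⟨b', hb'⟩
        refine ⟨b * b', fun w hw => ?_⟩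
        rw [zpow_add₀ hX, Units.val_mul, map_mul (algebraMap E F), mul_mul_mul_comm, map_mul, hb w hw, hb' w hw,
          mul_one]
      neg_mem' := by
        rintro m ⟨b, hb⟩
        refine ⟨b⁻¹, fun w hw => ?_⟩
        rw [zpow_neg, Units.val_inv_eq_inv_val, map_inv₀, ← mul_inv, map_inv₀, hb w hw, inv_one] }
  have hH : ∀ i ∈ S, ((i - firstIndex S : ℕ) : ℤ) ∈ H := by
    intro i hi
    have hi0 := mem_firstIndex hS
    refine ⟨Units.mk0 (f.coeff i) (key i hi) * (Units.mk0 _ (key _ hi0))⁻¹, fun w hw => ?_⟩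
    have e1 : i ∈ minIndices w f X := hw.2.symm ▸ hi
    have e2 : firstIndex S ∈ minIndices w f X := by rw [hw.2]; exact hi0
    rw [minIndices, Finset.mem_filter] at e1 e2
    have e3 := e1.2.trans e2.2.symm
    have hc : algebraMap E F (f.coeff (firstIndex S)) ≠ 0 := by
      simpa using key _ hi0
    have e4 : algebraMap E F ((Units.mk0 (f.coeff i) (key i hi) *
        (Units.mk0 _ (key _ hi0))⁻¹ : Eˣ) : E) * X ^ ((i - firstIndex S : ℕ) : ℤ) =
        algebraMap E F (f.coeff i) * X ^ i *
          (algebraMap E F (f.coeff (firstIndex S)) * X ^ firstIndex S)⁻¹ := by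
      rw [zpow_natCast, pow_sub₀ _ hX (firstIndex_le hi)]
      simp only [Units.val_mul, Units.val_inv_eq_inv_val, Units.val_mk0, map_mul, map_inv₀, mul_inv]
      ring
    rw [e4, map_mul, map_inv₀, e3]
    exact mul_inv_cancel₀ ((_root_.map_ne_zero w.ring.valuation).2
      (mul_ne_zero hc (pow_ne_zero _ hX)))
  obtain ⟨g, hg⟩ := Int.subgroup_cyclic H
  have hd : ((gapGcd S : ℕ) : ℤ) ∈ H := by
    rw [hg, AddSubgroup.mem_closure_singleton]
    have : g.natAbs ∣ gapGcd S := Finset.dvd_gcd fun i hi => by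
      have h := hH i hi
      rw [hg, AddSubgroup.mem_closure_singleton] at h
      obtain ⟨k, hk⟩ := h
      exact Int.natCast_dvd_natCast.1 (Int.natAbs_dvd.2 ⟨k, by rw [← hk, smul_eq_mul, mul_comm]⟩)
    obtain ⟨k, hk⟩ := Int.natAbs_dvd.1 (Int.natCast_dvd_natCast.2 this)
    exact ⟨k, by rw [hk, smul_eq_mul, mul_comm]⟩
  obtain ⟨b, hb⟩ := hd
  exact ⟨b, fun w hw => by simpa using hb w hw⟩

/-- A choice of an element `b` as in `IsScale` (it exists by `exists_isScale`). -/
noncomputable def scale (v : ValuationSubring E) (f : E[X]) (X : F) (S : Finset ℕ) : Eˣ :=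
  Classical.epsilon (IsScale v f X S)

theorem isScale_scale (v : ValuationSubring E) {f : E[X]} (hf : f ≠ 0) {X : F} (hX : X ≠ 0)
    {S : Finset ℕ} (hS : S.Nonempty) : IsScale v f X S (scale v f X S) :=
  Classical.epsilon_spec (exists_isScale v hf hX hS)

/-- The value group of `v`, written additively. -/
abbrev ValueGp (v : ValuationSubring E) : Type _ := Additive (v.ValueGroup)ˣ

/-- The value of a nonzero element of `E` in the additively written value group. -/
noncomputable def val (v : ValuationSubring E) (b : Eˣ) : ValueGp v :=
  Additive.ofMul (Units.map (v.valuation : E →* v.ValueGroup) b)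

/-- The order of `v(b) / d` in `vE^ℚ / vE`, where `vE^ℚ` is the divisible hull of the
value group `vE`. -/
noncomputable def orderModValueGp (v : ValuationSubring E) (b : Eˣ) (d : ℕ) : ℕ :=
  addOrderOf (QuotientAddGroup.mk ((d : ℚ)⁻¹ • DivisibleHull.coeAddMonoidHom (ValueGp v) (val v b)) :
    DivisibleHull (ValueGp v) ⧸
      (DivisibleHull.coeAddMonoidHom (ValueGp v)).range)

/-- The integer `e_S`: the order of `v(b) / d` in `vE^ℚ / vE`, where `d` is the gcd of the
differences of elements of `S` and `b` is such that `b X ^ d` has value zero for all `w` in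
`Ω_{S,f,X}`. -/
noncomputable def eS (v : ValuationSubring E) (f : E[X]) (X : F) (S : Finset ℕ) : ℕ :=
  orderModValueGp v (scale v f X S) (gapGcd S)

/-- The residue polynomial `p_{S,f,c}`, the sum over `i ∈ S` of the terms
`res (a_i a_{i₀}⁻¹ c ^ (-n_i)) t ^ n_i`, where `n_i = (i - i₀) / e`, with `e = e_S`. -/
noncomputable def residuePoly (v : ValuationSubring E) (f : E[X]) (S : Finset ℕ) (e : ℕ) (c : E) :
    (Res v)[X] :=
  ∑ i ∈ S, monomial ((i - firstIndex S) / e)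
    (residue v (f.coeff i * (f.coeff (firstIndex S))⁻¹ * (c ^ ((i - firstIndex S) / e))⁻¹))

end HyperellipticResidue

/-! Write |x| for the multiplicative value, K = E(X), and let w have a non-ruled residue field.
Everything rests on a description of w on K.

Over an algebraic closure of F, choose algebraic c, d such that (X - c)/d has transcendental residue
(`exists_isCenter`), then replace c by an a of least degree within distance |d| of X. Let Q be the
minimal polynomial of a evaluated at X. Q-adic expansions describe w on K, with coefficients in E(a)
(`IsMinCenter.exists_frame`), and Kw = ℓ(x) with ℓ the finite residue field of E(a)
(`Frame.resField_eq`). This is the ruled residue theorem. If Fw came from K it would be ruled, so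
F/K is inert and Fw = Kw(θ), with θ the residue of Y/g for some g in K (`resField_eq_top_or_inert`).

Suppose |d| < |X|. Two roots of f nearer to X than 0 is would make the reduction of f(XT)/N (N a
dominant term of f(X)) vanish doubly at T = 1; since e_S is invertible in Ev, p_{S,f,c} would have a
double root (`not_two_roots`), against separability. So at most one root lies at distance |d|, and
f(X) is a monomial or a balanced linear expression in Q up to a factor of residue 1
(`Frame.near_of_countP_le_one`). Then θ is, up to a factor in Kw, a square root of a monomial or of
a linear polynomial in a generator of Kw over ℓ, and Fw is ruled, a contradiction.

Hence |X| ≤ |d|, so 0 is a center and w is monomial in X on K; in particular w is overt. The set S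
has at least two elements, since otherwise f(X) is near a single term and Fw is ruled again. Two
indices i < j in S force |X|^(j-i) = |a_i/a_j|, so S determines w on K
(`mem_ring_iff_of_minIndices_eq`), and an inert extension is determined by its restriction to K
(`ring_eq_of_inert`). Thus w ↦ S is injective into the subsets of {0, ..., n}, which gives
finiteness. -/

namespace HyperellipticResidue

open Polynomial

/-! ### Residues, and the relation of having the same leading term -/

section Residue

variable {K : Type*} [Field K] (A : ValuationSubring K)

theorem residue_of_mem {x : K} (hx : x ∈ A) : residue A x = IsLocalRing.residue A ⟨x, hx⟩ := by
  rw [residue, dif_pos hx]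

theorem residue_of_notMem {x : K} (hx : x ∉ A) : residue A x = 0 := by
  rw [residue, dif_neg hx]

theorem residue_add {x y : K} (hx : x ∈ A) (hy : y ∈ A) :
    residue A (x + y) = residue A x + residue A y := by
  rw [residue_of_mem A hx, residue_of_mem A hy, residue_of_mem A (A.add_mem _ _ hx hy), ← map_add]
  rfl

theorem residue_mul {x y : K} (hx : x ∈ A) (hy : y ∈ A) :
    residue A (x * y) = residue A x * residue A y := by
  rw [residue_of_mem A hx, residue_of_mem A hy, residue_of_mem A (A.mul_mem _ _ hx hy), ← map_mul]
  rfl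

theorem residue_neg (x : K) : residue A (-x) = -residue A x := by
  by_cases hx : x ∈ A
  · rw [residue_of_mem A hx, residue_of_mem A (A.neg_mem _ hx), ← map_neg]
    rfl
  · have h : -x ∉ A := fun h => hx (by simpa using A.neg_mem _ h)
    rw [residue_of_notMem A hx, residue_of_notMem A h, neg_zero]

theorem residue_sub {x y : K} (hx : x ∈ A) (hy : y ∈ A) :
    residue A (x - y) = residue A x - residue A y := by
  rw [sub_eq_add_neg, residue_add A hx (A.neg_mem _ hy), residue_neg, sub_eq_add_neg]

theorem residue_one : residue A 1 = 1 := by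
  rw [residue_of_mem A A.one_mem]
  exact map_one (IsLocalRing.residue A)

theorem residue_zero : residue A 0 = 0 := by
  rw [residue_of_mem A A.zero_mem]
  exact map_zero (IsLocalRing.residue A)

theorem residue_pow {x : K} (hx : x ∈ A) (n : ℕ) : residue A (x ^ n) = residue A x ^ n := by
  induction n with
  | zero => rw [pow_zero, pow_zero, residue_one]
  | succ n ih => rw [pow_succ, pow_succ, residue_mul A (pow_mem hx n) hx, ih]

theorem residue_sum {ι : Type*} (s : Finset ι) (g : ι → K) (hg : ∀ i ∈ s, g i ∈ A) :
    residue A (∑ i ∈ s, g i) = ∑ i ∈ s, residue A (g i) := by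
  classical
  induction s using Finset.induction_on with
  | empty => simp [residue_zero]
  | insert i s hi ih =>
    rw [Finset.sum_insert hi, Finset.sum_insert hi, residue_add A, ih]
    · exact fun j hj => hg j (Finset.mem_insert_of_mem hj)
    · exact hg i (Finset.mem_insert_self i s)
    · exact sum_mem fun j hj => hg j (Finset.mem_insert_of_mem hj)

theorem residue_natCast (n : ℕ) : residue A (n : K) = n := by
  rw [residue_of_mem A (natCast_mem A n)]
  exact map_natCast (IsLocalRing.residue A) n

theorem residue_eq_zero_iff {x : K} (hx : x ∈ A) : residue A x = 0 ↔ A.valuation x < 1 := by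
  rw [residue_of_mem A hx, IsLocalRing.residue_eq_zero_iff, ValuationSubring.valuation_lt_one_iff]

theorem residue_eq_zero_of_lt {x : K} (hx : A.valuation x < 1) : residue A x = 0 :=
  (residue_eq_zero_iff A ((A.valuation_le_one_iff x).1 hx.le)).2 hx

theorem residue_ne_zero_iff {x : K} : residue A x ≠ 0 ↔ A.valuation x = 1 := by
  by_cases hx : x ∈ A
  · rw [Ne, residue_eq_zero_iff A hx, not_lt]
    exact ⟨fun h => le_antisymm ((A.valuation_le_one_iff x).2 hx) h, fun h => h.ge⟩
  · rw [residue_of_notMem A hx]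
    exact ⟨fun h => (h rfl).elim, fun h => (hx ((A.valuation_le_one_iff x).1 h.le)).elim⟩

theorem residue_eq_iff {x y : K} (hx : x ∈ A) (hy : y ∈ A) :
    residue A x = residue A y ↔ A.valuation (x - y) < 1 := by
  rw [← residue_eq_zero_iff A (sub_mem hx hy), residue_sub A hx hy, sub_eq_zero]

theorem mem_of_val_eq_one {x : K} (hx : A.valuation x = 1) : x ∈ A :=
  (A.valuation_le_one_iff x).1 hx.le

theorem ne_zero_of_val_eq_one {x : K} (hx : A.valuation x = 1) : x ≠ 0 := by
  rintro rfl
  simp at hx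

theorem val_inv_eq_one {x : K} (hx : A.valuation x = 1) : A.valuation x⁻¹ = 1 := by
  rw [map_inv₀, hx, inv_one]

theorem residue_inv {x : K} (hx : A.valuation x = 1) : residue A x⁻¹ = (residue A x)⁻¹ := by
  apply eq_inv_of_mul_eq_one_left
  rw [← residue_mul A (mem_of_val_eq_one A (val_inv_eq_one A hx)) (mem_of_val_eq_one A hx),
    inv_mul_cancel₀ (ne_zero_of_val_eq_one A hx), residue_one]

theorem residue_zpow {x : K} (hx : A.valuation x = 1) (n : ℤ) :
    residue A (x ^ n) = residue A x ^ n := by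
  obtain ⟨m, rfl | rfl⟩ := n.eq_nat_or_neg
  · rw [zpow_natCast, zpow_natCast, residue_pow A (mem_of_val_eq_one A hx)]
  · have h : A.valuation (x ^ m) = 1 := by rw [map_pow, hx, one_pow]
    rw [zpow_neg, zpow_neg, zpow_natCast, zpow_natCast, residue_inv A h,
      residue_pow A (mem_of_val_eq_one A hx)]

theorem exists_residue_eq (y : Res A) : ∃ x ∈ A, residue A x = y := by
  obtain ⟨x, rfl⟩ := IsLocalRing.residue_surjective y
  exact ⟨x, x.2, residue_of_mem A x.2⟩

/-- `x` and `y` have the same leading term: their quotient is a unit with residue class `1`. -/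
def Near (x y : K) : Prop := A.valuation (x - y) < A.valuation y

variable {A}

theorem Near.right_ne_zero {x y : K} (h : Near A x y) : y ≠ 0 := by
  rintro rfl
  simp [Near] at h

theorem Near.val_eq {x y : K} (h : Near A x y) : A.valuation x = A.valuation y := by
  have := Valuation.map_add_eq_of_lt_left A.valuation h
  rwa [add_sub_cancel] at this

theorem Near.left_ne_zero {x y : K} (h : Near A x y) : x ≠ 0 := by
  rintro rfl
  have := h.val_eq
  rw [map_zero] at this
  exact h.right_ne_zero ((map_eq_zero _).1 this.symm)

theorem near_iff_div {x y : K} (hy : y ≠ 0) : Near A x y ↔ A.valuation (x / y - 1) < 1 := by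
  have hy' : 0 < A.valuation y := (Valuation.pos_iff _).2 hy
  have h : x - y = (x / y - 1) * y := by field_simp
  rw [Near, h, map_mul]
  exact mul_lt_iff_lt_one_left hy'

theorem near_refl {y : K} (hy : y ≠ 0) : Near A y y := by
  rw [Near, sub_self, map_zero]
  exact (Valuation.pos_iff _).2 hy

theorem Near.symm {x y : K} (h : Near A x y) : Near A y x := by
  rw [Near, h.val_eq, Valuation.map_sub_swap]
  exact h

theorem Near.trans {x y z : K} (h : Near A x y) (h' : Near A y z) : Near A x z := by
  rw [Near, ← sub_add_sub_cancel x y z]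
  exact Valuation.map_add_lt _ (h'.val_eq ▸ h) h'

theorem Near.mul {x y x' y' : K} (h : Near A x y) (h' : Near A x' y') :
    Near A (x * x') (y * y') := by
  have e : x * x' - y * y' = (x - y) * x' + y * (x' - y') := by ring
  have p : 0 < A.valuation y := (Valuation.pos_iff _).2 h.right_ne_zero
  have p' : 0 < A.valuation y' := (Valuation.pos_iff _).2 h'.right_ne_zero
  rw [Near, e, map_mul]
  refine Valuation.map_add_lt _ ?_ ?_
  · rw [map_mul, h'.val_eq]
    exact mul_lt_mul_of_pos_right h p'
  · rw [map_mul]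
    exact mul_lt_mul_of_pos_left h' p

theorem Near.inv {x y : K} (h : Near A x y) : Near A x⁻¹ y⁻¹ := by
  have hx := h.left_ne_zero
  have hy := h.right_ne_zero
  rw [near_iff_div (inv_ne_zero hy)]
  have e : x⁻¹ / y⁻¹ = y / x := by field_simp
  rw [e, ← near_iff_div hx]
  exact h.symm

theorem Near.div {x y x' y' : K} (h : Near A x y) (h' : Near A x' y') :
    Near A (x / x') (y / y') := by
  rw [div_eq_mul_inv, div_eq_mul_inv]
  exact h.mul h'.inv

theorem Near.pow {x y : K} (h : Near A x y) (n : ℕ) : Near A (x ^ n) (y ^ n) := by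
  induction n with
  | zero => simpa using near_refl one_ne_zero
  | succ n ih => rw [pow_succ, pow_succ]; exact ih.mul h

/-- No integrality is needed: near elements have the same value, and outside the valuation ring both
residues take the default value 0. -/
theorem Near.residue_eq {x y : K} (h : Near A x y) : residue A x = residue A y := by
  by_cases hy : y ∈ A
  · have hx : x ∈ A := (A.valuation_le_one_iff x).1 (h.val_eq ▸ (A.valuation_le_one_iff y).2 hy)
    rw [residue_eq_iff A hx hy]
    exact lt_of_lt_of_le h ((A.valuation_le_one_iff y).2 hy)
  · have hx : x ∉ A := fun hx =>
      hy ((A.valuation_le_one_iff y).1 (h.val_eq ▸ (A.valuation_le_one_iff x).2 hx))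
    rw [residue_of_notMem A hx, residue_of_notMem A hy]

/-- The ultrametric step behind all approximations: if x is nearer to a than to c, then a may
replace x in the factor x - c. -/
theorem near_sub_of_lt {c x a : K} (h : A.valuation (x - a) < A.valuation (x - c)) :
    Near A (x - c) (a - c) := by
  refine Near.symm ?_
  have e : a - c - (x - c) = -(x - a) := by ring
  rw [Near, e, Valuation.map_neg]
  exact h

end Residue

/-! ### Residue fields of intermediate fields and of algebraic elements -/

section ResField

variable {E F : Type*} [Field E] [Field F] [Algebra E F] {v : ValuationSubring E} (w : ValExt v F)

theorem algebraMap_residue (c : E) :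
    algebraMap (Res v) (Res w.ring) (residue v c) = residue w.ring (algebraMap E F c) := by
  by_cases hc : c ∈ v
  · rw [residue_of_mem v hc, residue_of_mem w.ring (w.algebraMap_mem_iff.2 hc)]
    rfl
  · have hc' : algebraMap E F c ∉ w.ring := fun h => hc (w.algebraMap_mem_iff.1 h)
    rw [residue_of_notMem v hc, residue_of_notMem w.ring hc', map_zero]

/-- The residue field of an intermediate field. -/
noncomputable def resField (K : IntermediateField E F) :
    IntermediateField (Res v) (Res w.ring) where
  carrier := {y | ∃ x ∈ K, x ∈ w.ring ∧ residue w.ring x = y}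
  mul_mem' := by
    rintro _ _ ⟨x, hx, hx', rfl⟩ ⟨y, hy, hy', rfl⟩
    exact ⟨x * y, mul_mem hx hy, mul_mem hx' hy', residue_mul _ hx' hy'⟩
  add_mem' := by
    rintro _ _ ⟨x, hx, hx', rfl⟩ ⟨y, hy, hy', rfl⟩
    exact ⟨x + y, add_mem hx hy, add_mem hx' hy', residue_add _ hx' hy'⟩
  algebraMap_mem' := by
    intro y
    obtain ⟨c, hc, rfl⟩ := exists_residue_eq v y
    exact ⟨algebraMap E F c, K.algebraMap_mem c, w.algebraMap_mem_iff.2 hc,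
      (algebraMap_residue w c).symm⟩
  inv_mem' := by
    rintro _ ⟨x, hx, hx', rfl⟩
    by_cases h : residue w.ring x = 0
    · rw [h, inv_zero]
      exact ⟨0, K.zero_mem, w.ring.zero_mem, residue_zero _⟩
    · have h1 := (residue_ne_zero_iff w.ring).1 h
      exact ⟨x⁻¹, inv_mem hx, mem_of_val_eq_one _ (val_inv_eq_one _ h1), residue_inv _ h1⟩

theorem residue_mem_resField {K : IntermediateField E F} {x : F} (hx : x ∈ K) :
    residue w.ring x ∈ resField w K := by
  by_cases h : x ∈ w.ring
  · exact ⟨x, hx, h, rfl⟩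
  · rw [residue_of_notMem _ h]
    exact zero_mem _

theorem resField_top : resField w (⊤ : IntermediateField E F) = ⊤ := by
  rw [eq_top_iff]
  intro y _
  obtain ⟨x, hx, rfl⟩ := exists_residue_eq w.ring y
  exact ⟨x, IntermediateField.mem_top, hx, rfl⟩

theorem resField_bot : resField w (⊥ : IntermediateField E F) = ⊥ := by
  rw [eq_bot_iff]
  rintro _ ⟨x, hx, hx', rfl⟩
  obtain ⟨c, rfl⟩ := IntermediateField.mem_bot.1 hx
  rw [← algebraMap_residue]
  exact IntermediateField.algebraMap_mem _ _

/-- A linear relation can be scaled so that its coefficients are integral and one of them is `1`. -/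
theorem exists_scaled_relation {ι : Type*} (s : Finset ι) (c : ι → F) {i₀ : ι} (hi₀ : i₀ ∈ s)
    (hc : c i₀ ≠ 0) (A : ValuationSubring F) :
    ∃ j ∈ s, c j ≠ 0 ∧ ∀ i ∈ s, c i / c j ∈ A := by
  obtain ⟨j, hj, hmax⟩ := s.exists_max_image (fun i => A.valuation (c i)) ⟨i₀, hi₀⟩
  have hcj : c j ≠ 0 := by
    intro h
    have := hmax i₀ hi₀
    rw [h, map_zero, le_zero_iff, map_eq_zero] at this
    exact hc this
  refine ⟨j, hj, hcj, fun i hi => ?_⟩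
  rw [← A.valuation_le_one_iff, map_div₀]
  exact div_le_one_of_le₀ (hmax i hi) zero_le

/-- A relation over `K` between integral elements induces a relation between their residues. -/
theorem exists_residue_relation {K : IntermediateField E F} {ι : Type*} (s : Finset ι) (c x : ι → F)
    (hcK : ∀ i ∈ s, c i ∈ K) {i₀ : ι} (hi₀ : i₀ ∈ s) (hc : c i₀ ≠ 0)
    (hx : ∀ i ∈ s, x i ∈ w.ring) (h : ∑ i ∈ s, c i * x i = 0) :
    ∃ r : ι → resField w K, (∃ j ∈ s, r j ≠ 0) ∧
      ∑ i ∈ s, (r i : Res w.ring) * residue w.ring (x i) = 0 := by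
  classical
  obtain ⟨j, hj, hcj, hint⟩ := exists_scaled_relation s c hi₀ hc w.ring
  refine ⟨fun i => if hi : i ∈ s then
    ⟨residue w.ring (c i / c j), residue_mem_resField w (div_mem (hcK i hi) (hcK j hj))⟩ else 0,
    ⟨j, hj, ?_⟩, ?_⟩
  · intro h0
    have h1 := congrArg Subtype.val h0
    simp only [hj, dif_pos, div_self hcj, residue_one] at h1
    exact one_ne_zero h1
  · have h1 : ∑ i ∈ s, c i / c j * x i = 0 := by
      have : ∑ i ∈ s, c i / c j * x i = (∑ i ∈ s, c i * x i) / c j := by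
        rw [Finset.sum_div]
        exact Finset.sum_congr rfl fun i _ => by ring
      rw [this, h, zero_div]
    have h2 := residue_sum w.ring s (fun i => c i / c j * x i)
      (fun i hi => mul_mem (hint i hi) (hx i hi))
    rw [h1, residue_zero] at h2
    rw [h2]
    refine Finset.sum_congr rfl fun i hi => ?_
    simp only [dif_pos hi, residue_mul _ (hint i hi) (hx i hi)]

/-- An algebraic equation for x, divided by a coefficient of largest value, reduces to a nontrivial
equation for its residue. -/
theorem isAlgebraic_residue {K : IntermediateField E F} {x : F} (hx : IsAlgebraic K x) :
    IsAlgebraic (resField w K) (residue w.ring x) := by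
  by_cases hxA : x ∈ w.ring
  swap
  · rw [residue_of_notMem _ hxA]
    exact isAlgebraic_zero
  obtain ⟨p, hp, hpx⟩ := hx
  rw [aeval_eq_sum_range] at hpx
  obtain ⟨r, ⟨j, hj, hrj⟩, hr⟩ := exists_residue_relation w (K := K) (Finset.range (p.natDegree + 1))
    (fun i => (p.coeff i : F)) (fun i => x ^ i) (fun i _ => (p.coeff i).2)
    (Finset.self_mem_range_succ _) (by simpa using hp) (fun i _ => pow_mem hxA i)
    (by simpa [Algebra.smul_def] using hpx)
  refine ⟨∑ i ∈ Finset.range (p.natDegree + 1), monomial i (r i), ?_, ?_⟩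
  · intro h0
    have := congrArg (fun q => q.coeff j) h0
    simp only [finsetSum_coeff, coeff_monomial, coeff_zero] at this
    rw [Finset.sum_ite_eq' _ j, if_pos hj] at this
    exact hrj this
  · rw [map_sum, ← hr]
    refine Finset.sum_congr rfl fun i _ => ?_
    rw [aeval_monomial, residue_pow _ hxA]
    rfl

theorem isAlgebraic_residue_of_isAlgebraic {x : F} (hx : IsAlgebraic E x) :
    IsAlgebraic (Res v) (residue w.ring x) := by
  have h1 : IsAlgebraic (⊥ : IntermediateField E F) x := hx.extendScalars
    (FaithfulSMul.algebraMap_injective E _)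
  have h2 := isAlgebraic_residue w h1
  rw [resField_bot] at h2
  have : Algebra.IsAlgebraic (Res v) (⊥ : IntermediateField (Res v) (Res w.ring)) :=
    Algebra.IsAlgebraic.of_finite _ _
  exact h2.restrictScalars (Res v)

theorem algebra_isAlgebraic_resField (K : IntermediateField E F) [Algebra.IsAlgebraic E K] :
    Algebra.IsAlgebraic (Res v) (resField w K) := by
  constructor
  rintro ⟨_, x, hx, hx', rfl⟩
  rw [← isAlgebraic_algebraMap_iff (FaithfulSMul.algebraMap_injective _ (Res w.ring))]
  refine isAlgebraic_residue_of_isAlgebraic w ?_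
  exact (isAlgebraic_algebraMap_iff (FaithfulSMul.algebraMap_injective K F)).2
    (Algebra.IsAlgebraic.isAlgebraic (R := E) (⟨x, hx⟩ : K))

/-- Lifts of more than [K : E] residues are linearly dependent over E, and the scaled dependence
reduces to one over Ev. -/
theorem finiteDimensional_resField (K : IntermediateField E F) [FiniteDimensional E K] :
    FiniteDimensional (Res v) (resField w K) := by
  classical
  rw [FiniteDimensional, ← Module.rank_lt_aleph0_iff]
  refine lt_of_le_of_lt (rank_le (n := Module.finrank E K) ?_) Cardinal.natCast_lt_aleph0
  intro s hs
  by_contra! hlt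
  have hlift : ∀ y : resField w K, ∃ x : K, (x : F) ∈ w.ring ∧ residue w.ring (x : F) = y := by
    rintro ⟨_, x, hx, hx', rfl⟩
    exact ⟨⟨x, hx⟩, hx', rfl⟩
  choose l hl hl' using hlift
  have hdep : ¬ LinearIndependent E (fun i : s => l i) := by
    intro h
    have := h.fintype_card_le_finrank
    rw [Fintype.card_coe] at this
    omega
  rw [Fintype.not_linearIndependent_iff] at hdep
  obtain ⟨g, hg, i₀, hi₀⟩ := hdep
  have hsum : ∑ i : s, algebraMap E F (g i) * (l i : F) = 0 := by
    have := congrArg (algebraMap K F) hg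
    rw [map_sum, map_zero] at this
    rw [← this]
    refine Finset.sum_congr rfl fun i _ => ?_
    rw [Algebra.smul_def, map_mul]
    rfl
  obtain ⟨r, ⟨j, -, hj⟩, hr⟩ := exists_residue_relation w (K := ⊥) Finset.univ
    (fun i : s => algebraMap E F (g i)) (fun i => (l i : F))
    (fun i _ => IntermediateField.algebraMap_mem _ _) (Finset.mem_univ i₀)
    (by simpa using hi₀) (fun i _ => hl i) hsum
  have hr' : ∀ i, ∃ c : Res v, algebraMap (Res v) (Res w.ring) c = (r i : Res w.ring) := by
    intro i
    exact IntermediateField.mem_bot.1 ((resField_bot w).le (r i).2)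
  choose c hc using hr'
  rw [Fintype.linearIndependent_iff] at hs
  have hc0 := hs c (by
    apply Subtype.val_injective
    rw [AddSubmonoidClass.coe_finsetSum, ZeroMemClass.coe_zero, ← hr]
    refine Finset.sum_congr rfl fun i _ => ?_
    rw [← hc, hl']
    exact Algebra.smul_def _ _) j
  apply hj
  apply Subtype.val_injective
  rw [← hc, hc0, map_zero]
  rfl

/-- The values of algebraic elements are torsion modulo the value group of the base field. -/
theorem exists_val_pow_eq {x : F} (hx : IsAlgebraic E x) (hx0 : x ≠ 0) :
    ∃ N : ℕ, 0 < N ∧ ∃ c : E, c ≠ 0 ∧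
      w.ring.valuation (x ^ N) = w.ring.valuation (algebraMap E F c) := by
  classical
  obtain ⟨p, hp, hpx⟩ := hx
  rw [aeval_eq_sum_range] at hpx
  set s := p.support
  have hsum : ∑ i ∈ s, algebraMap E F (p.coeff i) * x ^ i = 0 := by
    rw [← hpx, Finset.sum_subset (supp_subset_range_natDegree_succ (p := p))]
    · exact Finset.sum_congr rfl fun i _ => (Algebra.smul_def _ _).symm
    · intro i _ hi
      rw [notMem_support_iff.1 hi, map_zero, zero_mul]
  obtain ⟨j, hj, hmax⟩ := s.exists_max_image
    (fun i => w.ring.valuation (algebraMap E F (p.coeff i) * x ^ i)) (nonempty_support_iff.2 hp)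
  have hne : ∀ i ∈ s, p.coeff i ≠ 0 := fun i hi => mem_support_iff.1 hi
  have hpos : 0 < w.ring.valuation (algebraMap E F (p.coeff j) * x ^ j) :=
    (Valuation.pos_iff _).2 (mul_ne_zero (by simpa using hne j hj) (pow_ne_zero _ hx0))
  -- The terms sum to zero, so the largest value among them occurs at least twice.
  have : ∃ i ∈ s, i ≠ j ∧ w.ring.valuation (algebraMap E F (p.coeff i) * x ^ i) =
      w.ring.valuation (algebraMap E F (p.coeff j) * x ^ j) := by
    by_contra! hcon
    rw [← Finset.add_sum_erase _ _ hj] at hsum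
    have hlt : w.ring.valuation (∑ i ∈ s.erase j, algebraMap E F (p.coeff i) * x ^ i) <
        w.ring.valuation (algebraMap E F (p.coeff j) * x ^ j) :=
      Valuation.map_sum_lt _ hpos.ne' fun i hi => lt_of_le_of_ne
        (hmax i (Finset.mem_of_mem_erase hi))
        (hcon i (Finset.mem_of_mem_erase hi) (Finset.ne_of_mem_erase hi))
    rw [add_comm, add_eq_zero_iff_eq_neg] at hsum
    rw [hsum, Valuation.map_neg] at hlt
    exact lt_irrefl _ hlt
  obtain ⟨i, hi, hij, heq⟩ := this
  have key : ∀ i j : ℕ, i < j → p.coeff i ≠ 0 → p.coeff j ≠ 0 →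
      w.ring.valuation (algebraMap E F (p.coeff i) * x ^ i) =
      w.ring.valuation (algebraMap E F (p.coeff j) * x ^ j) → ∃ N : ℕ, 0 < N ∧ ∃ c : E, c ≠ 0 ∧
      w.ring.valuation (x ^ N) = w.ring.valuation (algebraMap E F c) := by
    intro i j hij hi hj heq
    refine ⟨j - i, by omega, p.coeff i / p.coeff j, div_ne_zero hi hj, ?_⟩
    have hi' : algebraMap E F (p.coeff i) ≠ 0 := by simpa using hi
    have hj' : algebraMap E F (p.coeff j) ≠ 0 := by simpa using hj
    have e1 : x ^ (j - i) = (algebraMap E F (p.coeff j) * x ^ j) /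
        (algebraMap E F (p.coeff i) * x ^ i) * algebraMap E F (p.coeff i / p.coeff j) := by
      rw [pow_sub₀ _ hx0 hij.le, map_div₀]
      field_simp
    rw [e1, map_mul, map_div₀ w.ring.valuation, heq, div_self, one_mul]
    exact (Valuation.ne_zero_iff _).2 (mul_ne_zero hj' (pow_ne_zero _ hx0))
  rcases lt_or_gt_of_ne hij with h | h
  · exact key i j h (hne i hi) (hne j hj) heq
  · exact key j i h (hne j hj) (hne i hi) heq.symm

/-- Lift the minimal polynomial of θ to a monic polynomial over v. It splits over F with integral
roots, and since it reduces to a polynomial vanishing at θ, one of the roots has residue θ. -/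
theorem exists_algebraic_residue_eq [IsAlgClosed F] {θ : Res w.ring} (hθ : IsAlgebraic (Res v) θ) :
    ∃ c : F, IsAlgebraic E c ∧ c ∈ w.ring ∧ residue w.ring c = θ := by
  have hmonic := minpoly.monic hθ.isIntegral
  have hlift : minpoly (Res v) θ ∈ Polynomial.lifts (IsLocalRing.residue v) := by
    rw [Polynomial.mem_lifts]
    exact Polynomial.map_surjective _ IsLocalRing.residue_surjective _
  obtain ⟨P, hP, hdeg, hPm⟩ := lifts_and_natDegree_eq_and_monic hlift hmonic
  set PE : E[X] := P.map v.subtype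
  have hsplit := IsAlgClosed.splits (PE.map (algebraMap E F))
  have hPEm : (PE.map (algebraMap E F)).Monic := (hPm.map _).map _
  set R := (PE.map (algebraMap E F)).roots
  have hfac : PE.map (algebraMap E F) = (R.map fun a => Polynomial.X - C a).prod :=
    hsplit.eq_prod_roots_of_monic hPEm
  have hRalg : ∀ c ∈ R, IsAlgebraic E c := by
    intro c hc
    refine ⟨PE, (hPm.map _).ne_zero, ?_⟩
    have := (mem_roots'.1 hc).2
    rwa [IsRoot, eval_map_algebraMap] at this
  have hRint : ∀ c ∈ R, c ∈ w.ring := by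
    intro c hc
    have h1 : IsIntegral w.ring c := by
      refine ⟨P.map w.ringMap, hPm.map _, ?_⟩
      have := (mem_roots'.1 hc).2
      rw [IsRoot, eval_map, eval₂_map] at this
      rw [eval₂_map]
      exact this
    obtain ⟨y, hy⟩ := IsIntegrallyClosed.isIntegral_iff.1 h1
    rw [← hy]
    exact y.2
  obtain ⟨t, ht, rfl⟩ := exists_residue_eq w.ring θ
  have hprod : ∀ S : Multiset F, (∀ c ∈ S, c ∈ w.ring) →
      (S.map fun c => t - c).prod ∈ w.ring ∧ residue w.ring (S.map fun c => t - c).prod =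
        (S.map fun c => residue w.ring t - residue w.ring c).prod := by
    intro S
    induction S using Multiset.induction_on with
    | empty => intro _; simp [residue_one]
    | cons c S ih =>
      intro hS
      obtain ⟨h1, h2⟩ := ih fun c hc => hS c (Multiset.mem_cons_of_mem hc)
      have hc := sub_mem ht (hS c (Multiset.mem_cons_self c S))
      rw [Multiset.map_cons, Multiset.prod_cons, Multiset.map_cons, Multiset.prod_cons,
        residue_mul _ hc h1, h2, residue_sub _ ht (hS c (Multiset.mem_cons_self c S))]
      exact ⟨mul_mem hc h1, rfl⟩
  have heval : (R.map fun c => t - c).prod = eval₂ w.ring.subtype t (P.map w.ringMap) := by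
    have h1 : (PE.map (algebraMap E F)).eval t = (R.map fun c => t - c).prod := by
      rw [hfac, eval_multiset_prod, Multiset.map_map]
      simp
    rw [← h1, eval_map, eval₂_map, eval₂_map]
    rfl
  have hres : residue w.ring (R.map fun c => t - c).prod = 0 := by
    have h1 : eval₂ w.ring.subtype t (P.map w.ringMap) =
        ((P.map w.ringMap).eval ⟨t, ht⟩ : w.ring) := by
      rw [← eval₂_id, ← Subring.subtype_apply]
      exact (hom_eval₂ (P.map w.ringMap) (RingHom.id _) w.ring.subtype ⟨t, ht⟩).symm
    rw [heval, h1, residue_of_mem _ (Subtype.prop _)]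
    change IsLocalRing.residue w.ring ((P.map w.ringMap).eval ⟨t, ht⟩) = 0
    rw [eval_map, hom_eval₂]
    have h2 := minpoly.aeval (Res v) (residue w.ring t)
    rw [← hP, aeval_def, eval₂_map, residue_of_mem _ ht] at h2
    exact h2
  rw [(hprod R hRint).2, Multiset.prod_eq_zero_iff, Multiset.mem_map] at hres
  obtain ⟨c, hc, hc'⟩ := hres
  exact ⟨c, hRalg c hc, hRint c hc, (sub_eq_zero.1 hc').symm⟩

end ResField

end HyperellipticResidue

namespace HyperellipticResidue

open Polynomial

/-! ### Ruled extensions as composita with a finite extension -/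

section Ruled

variable {k κ κ' : Type*} [Field k] [Field κ] [Algebra k κ] [Field κ'] [Algebra k κ']

/-- Phrasing ruledness by composita over k keeps all later computations in one lattice of
intermediate fields, with no change of base. -/
theorem isRuled_of_eq_top (ℓ : IntermediateField k κ) [FiniteDimensional k ℓ] {x : κ}
    (hx : Transcendental k x) (h : ℓ ⊔ IntermediateField.adjoin k {x} = ⊤) : IsRuled k κ := by
  refine ⟨ℓ, inferInstance, x, ?_, ?_⟩
  · have : Algebra.IsAlgebraic k ℓ := Algebra.IsAlgebraic.of_finite _ _
    exact hx.extendScalars ℓ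
  · rw [eq_top_iff]
    intro y _
    have h1 : ℓ ⊔ IntermediateField.adjoin k {x} ≤
        (IntermediateField.adjoin ℓ {x}).restrictScalars k := by
      refine sup_le (fun z hz => ?_) ?_
      · exact (IntermediateField.adjoin ℓ {x}).algebraMap_mem ⟨z, hz⟩
      · rw [IntermediateField.adjoin_simple_le_iff]
        exact IntermediateField.mem_adjoin_simple_self ℓ x
    exact h1 (h ▸ IntermediateField.mem_top)

theorem IsRuled.of_algEquiv (e : κ ≃ₐ[k] κ') (h : IsRuled k κ) : IsRuled k κ' := by
  obtain ⟨ℓ, hℓ, x, hx, htop⟩ := h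
  let e' := ℓ.equivMap (e : κ →ₐ[k] κ')
  have : FiniteDimensional k (ℓ.map (e : κ →ₐ[k] κ')) := Module.Finite.equiv e'.toLinearEquiv
  have hxk : Transcendental k x := hx.restrictScalars
    (FaithfulSMul.algebraMap_injective k ℓ)
  refine isRuled_of_eq_top (ℓ.map (e : κ →ₐ[k] κ')) (x := e x) ?_ ?_
  · intro h
    exact hxk ((isAlgebraic_algHom_iff (e : κ →ₐ[k] κ') e.injective).1 h)
  · have h1 : ℓ ⊔ IntermediateField.adjoin k {x} = ⊤ := by
      rw [← IntermediateField.restrictScalars_adjoin_eq_sup, htop,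
        IntermediateField.restrictScalars_top]
    have h2 := congrArg (IntermediateField.map (e : κ →ₐ[k] κ')) h1
    rw [IntermediateField.map_sup, IntermediateField.adjoin_map, Set.image_singleton,
      ← AlgHom.fieldRange_eq_map] at h2
    rw [eq_top_iff]
    intro y _
    have h3 : y ∈ (e : κ →ₐ[k] κ').fieldRange := ⟨e.symm y, by simp⟩
    rw [← h2] at h3
    exact h3

theorem isRuled_top_iff : IsRuled k (⊤ : IntermediateField k κ) ↔ IsRuled k κ :=
  ⟨IsRuled.of_algEquiv IntermediateField.topEquiv,
    IsRuled.of_algEquiv IntermediateField.topEquiv.symm⟩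

theorem isRuled_of_eq_sup (ℓ : IntermediateField k κ) [FiniteDimensional k ℓ] {x : κ}
    (hx : Transcendental k x) {M : IntermediateField k κ}
    (h : M = ℓ ⊔ IntermediateField.adjoin k {x}) : IsRuled k M := by
  have hℓ : ℓ ≤ M := h ▸ le_sup_left
  have hxM : x ∈ M := h ▸ (le_sup_right : _ ≤ ℓ ⊔ IntermediateField.adjoin k {x})
    (IntermediateField.mem_adjoin_simple_self k x)
  have e := IntermediateField.restrictAlgEquiv hℓ
  have : FiniteDimensional k (IntermediateField.restrict hℓ) := Module.Finite.equiv e.toLinearEquiv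
  refine isRuled_of_eq_top (IntermediateField.restrict hℓ) (x := (⟨x, hxM⟩ : M)) ?_ ?_
  · exact (transcendental_algebraMap_iff
      (FaithfulSMul.algebraMap_injective M κ)).1 (show Transcendental k (algebraMap M κ ⟨x, hxM⟩) from hx)
  · apply IntermediateField.lift_injective
    rw [IntermediateField.lift_sup, IntermediateField.lift_restrict,
      IntermediateField.lift_adjoin_simple, IntermediateField.lift_top, ← h]

end Ruled

/-! ### Gauss valuations -/

section Gauss

variable {E F : Type*} [Field E] [Field F] [Algebra E F] {v : ValuationSubring E} (w : ValExt v F)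
  {K : IntermediateField E F}

/-- The polynomial with coefficients the residues of the `b i`, for `i ∈ s`. -/
noncomputable def resPoly (b : ℕ → K) (s : Finset ℕ) : (resField w K)[X] :=
  ∑ i ∈ s, monomial i ⟨residue w.ring (b i : F), residue_mem_resField w (b i).2⟩

theorem coeff_resPoly (b : ℕ → K) (s : Finset ℕ) (j : ℕ) :
    (((resPoly w b s).coeff j : resField w K) : Res w.ring) =
      if j ∈ s then residue w.ring (b j : F) else 0 := by
  classical
  simp only [resPoly, finsetSum_coeff, coeff_monomial]
  rw [Finset.sum_ite_eq' s j]
  split_ifs <;> rfl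

theorem aeval_resPoly (b : ℕ → K) (s : Finset ℕ) (hb : ∀ i ∈ s, (b i : F) ∈ w.ring) {T : F}
    (hT : T ∈ w.ring) :
    aeval (residue w.ring T) (resPoly w b s) = residue w.ring (∑ i ∈ s, (b i : F) * T ^ i) := by
  rw [resPoly, map_sum, residue_sum _ _ _ fun i hi => mul_mem (hb i hi) (pow_mem hT i)]
  refine Finset.sum_congr rfl fun i hi => ?_
  rw [aeval_monomial, residue_mul _ (hb i hi) (pow_mem hT i), residue_pow _ hT]
  rfl

theorem val_eq_one_of_transcendental {R : Type*} [Field R] [Algebra R (Res w.ring)] {T : F}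
    (hT : Transcendental R (residue w.ring T)) : w.ring.valuation T = 1 := by
  rw [← residue_ne_zero_iff]
  intro h
  exact hT (h ▸ isAlgebraic_zero)

/-- If the residue of `T` is transcendental, then the value of a polynomial in `T` is the value
of its dominant term. -/
theorem val_coeff_le_val_sum (b : ℕ → K) (s : Finset ℕ) {T : F}
    (hT : Transcendental (resField w K) (residue w.ring T)) {j : ℕ} (hj : j ∈ s) :
    w.ring.valuation (b j : F) ≤ w.ring.valuation (∑ i ∈ s, (b i : F) * T ^ i) := by
  have hT1 := val_eq_one_of_transcendental w hT
  have hTA := mem_of_val_eq_one _ hT1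
  -- After division by a coefficient of largest value the reduced polynomial is nonzero, so it does
  -- not vanish at a transcendental residue.
  obtain ⟨m, hm, hmax⟩ := s.exists_max_image (fun i => w.ring.valuation (b i : F)) ⟨j, hj⟩
  refine (hmax j hj).trans ?_
  by_cases hm0 : b m = 0
  · simp [hm0]
  have hm0' : (b m : F) ≠ 0 := by simpa using hm0
  have hint : ∀ i ∈ s, ((b i / b m : K) : F) ∈ w.ring := by
    intro i hi
    rw [← w.ring.valuation_le_one_iff, IntermediateField.coe_div, map_div₀]
    exact div_le_one_of_le₀ (hmax i hi) zero_le
  have h1 := aeval_resPoly w (fun i => b i / b m) s hint hTA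
  have h2 : resPoly w (fun i => b i / b m) s ≠ 0 := by
    intro h
    have h3 := coeff_resPoly w (fun i => b i / b m) s m
    rw [h, if_pos hm, div_self hm0] at h3
    simp [residue_one] at h3
  have h4 : aeval (residue w.ring T) (resPoly w (fun i => b i / b m) s) ≠ 0 :=
    fun h => h2 ((transcendental_iff.1 hT) _ h)
  rw [h1, residue_ne_zero_iff] at h4
  have h5 : ∑ i ∈ s, (b i : F) * T ^ i =
      b m * ∑ i ∈ s, ((b i / b m : K) : F) * T ^ i := by
    rw [Finset.mul_sum]
    refine Finset.sum_congr rfl fun i _ => ?_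
    rw [IntermediateField.coe_div]
    field_simp
  rw [h5, map_mul, h4, mul_one]

end Gauss

/-! ### Residue fields of quadratic extensions: ramified, split, inert -/

section Quadratic

variable {E F : Type*} [Field E] [Field F] [Algebra E F] {v : ValuationSubring E} (w : ValExt v F)
  {K : IntermediateField E F} {Y : F}

/-- The field of the elements `a + b Y` with `a` and `b` in `K`, where `Y ^ 2` is in `K`. -/
def quadField (K : IntermediateField E F) (Y : F) (hY : Y ^ 2 ∈ K) : IntermediateField E F where
  carrier := {x | ∃ a ∈ K, ∃ b ∈ K, x = a + b * Y}
  mul_mem' := by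
    rintro _ _ ⟨a, ha, b, hb, rfl⟩ ⟨a', ha', b', hb', rfl⟩
    exact ⟨a * a' + b * b' * Y ^ 2, add_mem (mul_mem ha ha') (mul_mem (mul_mem hb hb') hY),
      a * b' + b * a', add_mem (mul_mem ha hb') (mul_mem hb ha'), by ring⟩
  add_mem' := by
    rintro _ _ ⟨a, ha, b, hb, rfl⟩ ⟨a', ha', b', hb', rfl⟩
    exact ⟨a + a', add_mem ha ha', b + b', add_mem hb hb', by ring⟩
  algebraMap_mem' c := ⟨algebraMap E F c, K.algebraMap_mem c, 0, K.zero_mem, by simp⟩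
  inv_mem' := by
    rintro _ ⟨a, ha, b, hb, rfl⟩
    -- Y may lie in K, so the norm can vanish with a + bY nonzero; then a = bY and the element is
    -- 2a, already in K.
    by_cases h : a ^ 2 - b ^ 2 * Y ^ 2 = 0
    · have h' : (a + b * Y) * (a - b * Y) = 0 := by rw [← h]; ring
      rcases mul_eq_zero.1 h' with h1 | h1
      · exact ⟨0, K.zero_mem, 0, K.zero_mem, by rw [h1]; simp⟩
      · have h2 : a + b * Y = a + a := by rw [← sub_eq_zero.1 h1]
        exact ⟨(a + a)⁻¹, inv_mem (add_mem ha ha), 0, K.zero_mem, by rw [h2]; simp⟩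
    · have hN : a ^ 2 - b ^ 2 * Y ^ 2 ∈ K :=
        sub_mem (pow_mem ha 2) (mul_mem (pow_mem hb 2) hY)
      have h1 : a + b * Y ≠ 0 := by
        intro h1
        apply h
        have : a ^ 2 - b ^ 2 * Y ^ 2 = (a + b * Y) * (a - b * Y) := by ring
        rw [this, h1, zero_mul]
      refine ⟨a / (a ^ 2 - b ^ 2 * Y ^ 2), div_mem ha hN, -b / (a ^ 2 - b ^ 2 * Y ^ 2),
        div_mem (neg_mem hb) hN, ?_⟩
      rw [inv_eq_iff_eq_inv, eq_comm, inv_eq_iff_eq_inv, ← sub_eq_zero]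
      field_simp
      ring

theorem exists_eq_add_mul_of_adjoin {X : F}
    (hF : IntermediateField.adjoin E {X, Y} = ⊤) (hX : X ∈ K) (hY : Y ^ 2 ∈ K) (x : F) :
    ∃ a ∈ K, ∃ b ∈ K, x = a + b * Y := by
  have h : (⊤ : IntermediateField E F) ≤ quadField K Y hY := by
    rw [← hF, IntermediateField.adjoin_le_iff]
    rintro y (rfl | rfl)
    · exact ⟨y, hX, 0, K.zero_mem, by simp⟩
    · exact ⟨0, K.zero_mem, 1, K.one_mem, by simp⟩
  exact h IntermediateField.mem_top

/-- If the value of `Y ^ 2` is not twice a value of `K`, then the residue field does not grow. -/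
theorem residue_mem_of_ramified (hN : ∀ x : F, ∃ a ∈ K, ∃ b ∈ K, x = a + b * Y)
    (h : ∀ g ∈ K, w.ring.valuation g ≠ w.ring.valuation Y) (x : F) :
    residue w.ring x ∈ resField w K := by
  obtain ⟨a, ha, b, hb, rfl⟩ := hN x
  -- The values of a and bY never tie, since a tie would make |Y| = |a/b| a value of K.
  have hne : b ≠ 0 → w.ring.valuation a ≠ w.ring.valuation (b * Y) := by
    intro hb0 he
    apply h (a / b) (div_mem ha hb)
    rw [map_div₀, he, map_mul, mul_div_cancel_left₀ _ ((Valuation.ne_zero_iff _).2 hb0)]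
  have h1 : w.ring.valuation (b * Y) ≠ 1 := by
    intro h1
    have hb0 : b ≠ 0 := by
      rintro rfl
      simp at h1
    apply h b⁻¹ (inv_mem hb)
    rw [map_mul] at h1
    rw [map_inv₀]
    exact inv_eq_of_mul_eq_one_right h1
  by_cases hb0 : b = 0
  · rw [hb0, zero_mul, add_zero]
    exact residue_mem_resField w ha
  rcases lt_or_gt_of_ne (hne hb0) with hlt | hlt
  · have h2 : residue w.ring (a + b * Y) = 0 := by
      by_contra h3
      rw [← Ne, residue_ne_zero_iff, Valuation.map_add_eq_of_lt_right _ hlt] at h3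
      exact h1 h3
    rw [h2]
    exact zero_mem _
  · have h2 : Near w.ring (a + b * Y) a := by
      rw [Near, add_sub_cancel_left]
      exact hlt
    rw [h2.residue_eq]
    exact residue_mem_resField w ha

/-- If `Y` has residue `1`, then the residue field does not grow. -/
theorem residue_mem_of_split (hN : ∀ x : F, ∃ a ∈ K, ∃ b ∈ K, x = a + b * Y)
    (hY : Y ^ 2 ∈ K) (hY1 : w.ring.valuation (Y - 1) < 1)
    (h2 : w.ring.valuation 2 = 1) (x : F) :
    residue w.ring x ∈ resField w K := by
  suffices hs : x = 0 ∨ ∃ y ∈ K, Near w.ring x y by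
    rcases hs with rfl | ⟨y, hy, hxy⟩
    · exact residue_mem_resField w K.zero_mem
    · exact hxy.residue_eq ▸ residue_mem_resField w hy
  by_cases hx0 : x = 0
  · exact Or.inl hx0
  right
  obtain ⟨a, ha, b, hb, hx⟩ := hN x
  set x' := a - b * Y with hx'
  have h2K : (2 : F) ∈ K := by
    have := add_mem K.one_mem K.one_mem
    rwa [one_add_one_eq_two] at this
  have hNK : a ^ 2 - b ^ 2 * Y ^ 2 ∈ K := sub_mem (pow_mem ha 2) (mul_mem (pow_mem hb 2) hY)
  have hmul : x * x' = a ^ 2 - b ^ 2 * Y ^ 2 := by rw [hx, hx']; ring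
  have hadd : x + x' = 2 * a := by rw [hx, hx']; ring
  have hsub : x - x' = 2 * (b * Y) := by rw [hx, hx']; ring
  have hYv : w.ring.valuation Y = 1 := by
    have : Near w.ring Y 1 := by rwa [Near, map_one]
    rw [this.val_eq, map_one]
  have hxpos : 0 < w.ring.valuation x := (Valuation.pos_iff _).2 hx0
  -- Compare x with its conjugate x'. If |x| < |x'|, then x' is near x + x' = 2a, so x is near its
  -- norm divided by 2a. If |x| = |x'|, then |b| ≤ |x|, and Y may be replaced by 1. If |x| > |x'|,
  -- then x is near 2a.
  rcases lt_trichotomy (w.ring.valuation x) (w.ring.valuation x') with hlt | heq | hlt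
  · have hx'0 : x' ≠ 0 := by
      intro h
      rw [h, map_zero] at hlt
      exact not_lt_zero hlt
    have hn : Near w.ring (2 * a) x' := by
      rw [Near, ← hadd, add_sub_cancel_right]
      exact hlt
    refine ⟨(a ^ 2 - b ^ 2 * Y ^ 2) / (2 * a), div_mem hNK (mul_mem h2K ha), ?_⟩
    have h3 := (near_refl (A := w.ring) (mul_ne_zero hx0 hx'0)).div hn.symm
    rwa [mul_div_cancel_right₀ _ hx'0, hmul] at h3
  · refine ⟨a + b, add_mem ha hb, Near.symm ?_⟩
    have e : a + b - x = -(b * (Y - 1)) := by rw [hx]; ring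
    have hbx : w.ring.valuation b ≤ w.ring.valuation x := by
      have h3 : w.ring.valuation (x - x') ≤ w.ring.valuation x :=
        (Valuation.map_sub _ _ _).trans (by rw [heq, max_self])
      rwa [hsub, map_mul, map_mul, h2, hYv, one_mul, mul_one] at h3
    rw [Near, e, Valuation.map_neg, map_mul]
    by_cases hb0 : w.ring.valuation b = 0
    · rwa [hb0, zero_mul]
    · exact lt_of_lt_of_le ((mul_lt_iff_lt_one_right (zero_lt_iff.2 hb0)).2 hY1) hbx
  · refine ⟨2 * a, mul_mem h2K ha, Near.symm ?_⟩
    rw [Near, ← hadd, add_sub_cancel_left]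
    exact hlt

/-- If the residue of `Y` is not in the residue field of `K`, then `1, Y` is an integral basis. -/
theorem mem_ring_iff_of_inert (hY : residue w.ring Y ∉ resField w K) {a b : F} (ha : a ∈ K)
    (hb : b ∈ K) : a + b * Y ∈ w.ring ↔ a ∈ w.ring ∧ b ∈ w.ring := by
  have hYA : Y ∈ w.ring := by
    by_contra h
    rw [residue_of_notMem _ h] at hY
    exact hY (zero_mem _)
  have hYv : w.ring.valuation Y = 1 := by
    rw [← residue_ne_zero_iff]
    intro h
    exact hY (h ▸ zero_mem _)
  refine ⟨fun h => ?_, fun h => add_mem h.1 (mul_mem h.2 hYA)⟩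
  suffices hbA : b ∈ w.ring by
    refine ⟨?_, hbA⟩
    have := sub_mem h (mul_mem hbA hYA)
    rwa [add_sub_cancel_right] at this
  -- If |b| > 1, dividing by b shows that Y and -a/b have the same residue, which puts the residue
  -- of Y in that of K.
  by_contra hbA
  rw [← w.ring.valuation_le_one_iff, not_le] at hbA
  have hb0 : b ≠ 0 := by
    rintro rfl
    simp at hbA
  have h1 : w.ring.valuation (a / b + Y) < 1 := by
    have e : a / b + Y = (a + b * Y) / b := by field_simp
    rw [e, map_div₀]
    exact (div_lt_one₀ (zero_lt_one.trans hbA)).2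
      (lt_of_le_of_lt ((w.ring.valuation_le_one_iff _).2 h) hbA)
  have h2 : a / b ∈ w.ring := by
    have := sub_mem ((w.ring.valuation_le_one_iff _).1 h1.le) hYA
    rwa [add_sub_cancel_right] at this
  apply hY
  have h3 := residue_eq_zero_of_lt w.ring h1
  rw [residue_add _ h2 hYA] at h3
  rw [eq_neg_of_add_eq_zero_right h3]
  exact neg_mem (residue_mem_resField w (div_mem ha hb))

theorem residue_mem_of_inert (hN : ∀ x : F, ∃ a ∈ K, ∃ b ∈ K, x = a + b * Y)
    (hY : residue w.ring Y ∉ resField w K) (x : F) :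
    residue w.ring x ∈ resField w K ⊔ IntermediateField.adjoin (Res v) {residue w.ring Y} := by
  obtain ⟨a, ha, b, hb, rfl⟩ := hN x
  by_cases h : a + b * Y ∈ w.ring
  · have h' := (mem_ring_iff_of_inert w hY ha hb).1 h
    have hYA : Y ∈ w.ring := by
      by_contra h
      rw [residue_of_notMem _ h] at hY
      exact hY (zero_mem _)
    rw [residue_add _ h'.1 (mul_mem h'.2 hYA), residue_mul _ h'.2 hYA]
    have hle : resField w K ≤ resField w K ⊔ IntermediateField.adjoin (Res v) {residue w.ring Y} :=
      le_sup_left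
    have hle' : IntermediateField.adjoin (Res v) {residue w.ring Y} ≤
      resField w K ⊔ IntermediateField.adjoin (Res v) {residue w.ring Y} := le_sup_right
    exact add_mem (hle (residue_mem_resField w ha)) (mul_mem (hle (residue_mem_resField w hb))
      (hle' (IntermediateField.mem_adjoin_simple_self _ _)))
  · rw [residue_of_notMem _ h]
    exact zero_mem _

/-- Either the residue field does not grow, or the extension is inert. -/
theorem resField_eq_top_or_inert (hN : ∀ x : F, ∃ a ∈ K, ∃ b ∈ K, x = a + b * Y)
    (hY : Y ^ 2 ∈ K) (hY0 : Y ≠ 0) (h2 : w.ring.valuation 2 = 1) :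
    resField w K = ⊤ ∨ ∃ g ∈ K, w.ring.valuation g = w.ring.valuation Y ∧
      residue w.ring (Y / g) ∉ resField w K := by
  have top_of : (∀ x, residue w.ring x ∈ resField w K) → resField w K = ⊤ := by
    intro h
    rw [eq_top_iff]
    intro y _
    obtain ⟨x, -, rfl⟩ := exists_residue_eq w.ring y
    exact h x
  by_cases hr : ∀ g ∈ K, w.ring.valuation g ≠ w.ring.valuation Y
  · exact Or.inl (top_of (residue_mem_of_ramified w hN hr))
  push Not at hr
  obtain ⟨g, hg, hgY⟩ := hr
  by_cases hs : residue w.ring (Y / g) ∈ resField w K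
  swap
  · exact Or.inr ⟨g, hg, hgY, hs⟩
  left
  obtain ⟨r, hr, hrA, hr'⟩ := hs
  have hg0 : g ≠ 0 := by
    rw [← Valuation.ne_zero_iff w.ring.valuation, hgY]
    exact (Valuation.ne_zero_iff _).2 hY0
  have h1 : w.ring.valuation (Y / g) = 1 := by
    rw [map_div₀, hgY, div_self ((Valuation.ne_zero_iff _).2 hY0)]
  have hr1 : w.ring.valuation r = 1 := by
    rw [← residue_ne_zero_iff, hr', residue_ne_zero_iff, h1]
  have hr0 := ne_zero_of_val_eq_one _ hr1
  -- With r in K lifting the residue of Y/g, the square root Y/(gr) has residue 1 and generates the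
  -- same extension.
  refine top_of (residue_mem_of_split w (Y := Y / (g * r)) ?_ ?_ ?_ h2)
  · intro x
    obtain ⟨a, ha, b, hb, rfl⟩ := hN x
    exact ⟨a, ha, b * (g * r), mul_mem hb (mul_mem hg hr), by field_simp⟩
  · rw [div_pow]
    exact div_mem hY (pow_mem (mul_mem hg hr) 2)
  · rw [residue_eq_iff _ hrA (mem_of_val_eq_one _ h1), Valuation.map_sub_swap, ← hr1] at hr'
    have h3 := (near_iff_div hr0).1 hr'
    rwa [div_div] at h3

end Quadratic

/-! ### Extending valuations to a larger field -/

section Transfer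

variable {E F L : Type*} [Field E] [Field F] [Field L] [Algebra E F] [Algebra E L] [Algebra F L]
  [IsScalarTower E F L] {v : ValuationSubring E} (w : ValExt v F) (W : ValExt w.ring L)

/-- The restriction to `E` of an extension of a valuation on `F`. -/
def ValExt.below : ValExt v L where
  ring := W.ring
  restrict_eq := by
    rw [IsScalarTower.algebraMap_eq E F L, ← ValuationSubring.comap_comap, W.restrict_eq,
      w.restrict_eq]

theorem algebraMap_algebraMap_res (c : Res v) :
    algebraMap (Res w.ring) (Res W.ring) (algebraMap (Res v) (Res w.ring) c) =
      algebraMap (Res v) (Res (w.below W).ring) c := by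
  obtain ⟨x, -, rfl⟩ := exists_residue_eq v c
  rw [algebraMap_residue, algebraMap_residue, algebraMap_residue,
    ← IsScalarTower.algebraMap_apply E F L]
  rfl

/-- The inclusion of residue fields, as a homomorphism over the residue field of the base. -/
noncomputable def resHom : Res w.ring →ₐ[Res v] Res (w.below W).ring where
  toRingHom := (algebraMap (Res w.ring) (Res W.ring) : Res w.ring →+* Res W.ring)
  commutes' := algebraMap_algebraMap_res w W

theorem resHom_residue (x : F) :
    resHom w W (residue w.ring x) = residue (w.below W).ring (algebraMap F L x) :=
  algebraMap_residue W x

theorem below_val_le_iff (x y : F) :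
    (w.below W).ring.valuation (algebraMap F L x) ≤ (w.below W).ring.valuation (algebraMap F L y) ↔
      w.ring.valuation x ≤ w.ring.valuation y := by
  by_cases hy : y = 0
  · simp [hy]
  have h1 : 0 < w.ring.valuation y := (Valuation.pos_iff _).2 hy
  have h2 : 0 < (w.below W).ring.valuation (algebraMap F L y) :=
    (Valuation.pos_iff _).2 (by simpa using hy)
  rw [← div_le_one₀ h1, ← div_le_one₀ h2, ← map_div₀, ← map_div₀, ← map_div₀,
    ValuationSubring.valuation_le_one_iff, ValuationSubring.valuation_le_one_iff]
  exact W.algebraMap_mem_iff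

theorem below_val_lt_iff (x y : F) :
    (w.below W).ring.valuation (algebraMap F L x) < (w.below W).ring.valuation (algebraMap F L y) ↔
      w.ring.valuation x < w.ring.valuation y := by
  rw [← not_le, ← not_le, below_val_le_iff]

theorem below_val_eq_iff (x y : F) :
    (w.below W).ring.valuation (algebraMap F L x) = (w.below W).ring.valuation (algebraMap F L y) ↔
      w.ring.valuation x = w.ring.valuation y := by
  rw [le_antisymm_iff, le_antisymm_iff, below_val_le_iff, below_val_le_iff]

theorem resField_map (K : IntermediateField E F) :
    resField (w.below W) (K.map (IsScalarTower.toAlgHom E F L)) =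
      (resField w K).map (resHom w W) := by
  ext y
  constructor
  · rintro ⟨_, ⟨x, hx, rfl⟩, hxA, rfl⟩
    exact ⟨residue w.ring x, residue_mem_resField w hx, resHom_residue w W x⟩
  · rintro ⟨_, ⟨x, hx, hxA, rfl⟩, rfl⟩
    exact ⟨algebraMap F L x, ⟨x, hx, rfl⟩, W.algebraMap_mem_iff.2 hxA,
      (resHom_residue w W x).symm⟩

/-- Ruledness of Kw over Ev does not see the ambient field, so it may be checked after extending w
to an algebraic closure, where roots are available. -/
theorem isRuled_resField_of_below (K : IntermediateField E F)
    (h : IsRuled (Res v) (resField (w.below W) (K.map (IsScalarTower.toAlgHom E F L)))) :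
    IsRuled (Res v) (resField w K) := by
  rw [resField_map] at h
  exact h.of_algEquiv ((resField w K).equivMap (resHom w W)).symm

/-- A valuation ring B of L dominating the image of A contracts to A: if x lies in B but not in A,
then 1/x lies in A and is a unit of B, hence by domination a unit of A. -/
theorem exists_valExt {F : Type*} [Field F] (A : ValuationSubring F) (L : Type*) [Field L]
    [Algebra F L] : Nonempty (ValExt A L) := by
  obtain ⟨B, hB⟩ := (A.toLocalSubring.map (algebraMap F L)).exists_le_valuationSubring
  refine ⟨⟨B, ValuationSubring.ext _ _ fun x => ?_⟩⟩
  rw [ValuationSubring.mem_comap]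
  have hle : ∀ x ∈ A, algebraMap F L x ∈ B := fun x hx => hB.1 ⟨x, hx, rfl⟩
  refine ⟨fun hx => ?_, hle x⟩
  by_contra hxA
  have hx0 : x ≠ 0 := by
    rintro rfl
    exact hxA A.zero_mem
  have hinv : x⁻¹ ∈ A := (A.mem_or_inv_mem x).resolve_left hxA
  have hmem : algebraMap F L x⁻¹ ∈ (A.toLocalSubring.map (algebraMap F L)).toSubring :=
    ⟨x⁻¹, hinv, rfl⟩
  have hunit : IsUnit (Subring.inclusion hB.1 ⟨algebraMap F L x⁻¹, hmem⟩) :=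
    isUnit_iff_exists_inv.2 ⟨⟨algebraMap F L x, hx⟩, Subtype.ext (by
      change algebraMap F L x⁻¹ * algebraMap F L x = 1
      rw [← map_mul, inv_mul_cancel₀ hx0, map_one])⟩
  obtain ⟨⟨_, y, hy, rfl⟩, hy'⟩ := isUnit_iff_exists_inv.1 (hB.2.1 _ hunit)
  have h1 : algebraMap F L x⁻¹ * algebraMap F L y = 1 := congrArg Subtype.val hy'
  rw [← map_mul, ← map_one (algebraMap F L)] at h1
  have h2 := (algebraMap F L).injective h1
  have h3 : y = x := by
    field_simp at h2
    exact h2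
  exact hxA (h3 ▸ hy)

end Transfer

end HyperellipticResidue

namespace HyperellipticResidue

open Polynomial

section IsAlgebraic

theorem _root_.IsAlgebraic.div {k K : Type*} [Field k] [Field K] [Algebra k K] {x y : K}
    (hx : IsAlgebraic k x) (hy : IsAlgebraic k y) : IsAlgebraic k (x / y) := by
  rw [div_eq_mul_inv]
  exact hx.mul hy.inv

end IsAlgebraic

/-! ### Algebraic centers of residually transcendental valuations -/

section Center

variable {E L : Type*} [Field E] [Field L] [Algebra E L] {v : ValuationSubring E} (w : ValExt v L)

instance : Algebra.IsAlgebraic (Res v) (resField w (algebraicClosure E L)) :=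
  algebra_isAlgebraic_resField w _

/-- `c` and `d` are algebraic over the base and `(X - c) / d` has transcendental residue. -/
structure IsCenter (X c d : L) : Prop where
  alg : IsAlgebraic E c
  alg_scale : IsAlgebraic E d
  trans : Transcendental (Res v) (residue w.ring ((X - c) / d))

variable {w} {X c d : L}

theorem IsCenter.scale_ne_zero (h : IsCenter w X c d) : d ≠ 0 := by
  rintro rfl
  have := h.trans
  rw [div_zero, residue_zero] at this
  exact this isAlgebraic_zero

theorem IsCenter.val_eq (h : IsCenter w X c d) :
    w.ring.valuation (X - c) = w.ring.valuation d := by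
  have h1 := val_eq_one_of_transcendental w h.trans
  rw [map_div₀] at h1
  exact (div_eq_one_iff_eq ((Valuation.ne_zero_iff _).2 h.scale_ne_zero)).1 h1

/-- |d| is the least distance from X to an algebraic element: with a closer c', the residue of (X -
c)/d would be that of the algebraic element (c' - c)/d. -/
theorem IsCenter.le_val (h : IsCenter w X c d) {c' : L} (hc' : IsAlgebraic E c') :
    w.ring.valuation d ≤ w.ring.valuation (X - c') := by
  by_contra! hlt
  rw [← h.val_eq] at hlt
  have h1 := (near_sub_of_lt hlt).div (near_refl h.scale_ne_zero)
  have h2 := h.trans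
  rw [h1.residue_eq] at h2
  exact h2 (isAlgebraic_residue_of_isAlgebraic w ((hc'.sub h.alg).div h.alg_scale))

theorem IsCenter.residue_sub (h : IsCenter w X c d) {a : L}
    (hval : w.ring.valuation (X - a) ≤ w.ring.valuation d) :
    (c - a) / d ∈ w.ring ∧ residue w.ring ((X - a) / d) =
      residue w.ring ((X - c) / d) + residue w.ring ((c - a) / d) := by
  have hc : (X - c) / d ∈ w.ring := mem_of_val_eq_one _ (val_eq_one_of_transcendental w h.trans)
  have ha' : (X - a) / d ∈ w.ring := by
    rw [← w.ring.valuation_le_one_iff, map_div₀]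
    exact div_le_one_of_le₀ hval zero_le
  have e : (c - a) / d = (X - a) / d - (X - c) / d := by ring
  have hca : (c - a) / d ∈ w.ring := e ▸ sub_mem ha' hc
  refine ⟨hca, ?_⟩
  rw [← residue_add _ hc hca]
  congr 1
  ring

/-- Recentering within distance |d| translates the residue by an algebraic element. -/
theorem IsCenter.of_val_le (h : IsCenter w X c d) {a : L} (ha : IsAlgebraic E a)
    (hval : w.ring.valuation (X - a) ≤ w.ring.valuation d) : IsCenter w X a d := by
  refine ⟨ha, h.alg_scale, fun hcon => h.trans ?_⟩
  rw [(h.residue_sub hval).2] at hcon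
  have h1 := hcon.sub (isAlgebraic_residue_of_isAlgebraic w ((h.alg.sub ha).div h.alg_scale))
  rwa [add_sub_cancel_right] at h1

/-- Take c in R nearest to X. The delicate case is |X - c'| = |X - c| = |c - c'| with no algebraic
element nearer to X than c. Then (X - c)/(c - c') is a unit whose residue is algebraic because there
is no center; lifting this residue to b gives the algebraic point c + b(c - c'), strictly nearer to
X, a contradiction. -/
theorem exists_common_center [IsAlgClosed L] (hX : ¬ IsAlgebraic E X)
    (hno : ∀ c d, ¬ IsCenter w X c d) (R : Multiset L) (hR : ∀ c ∈ R, IsAlgebraic E c) :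
    ∃ c, IsAlgebraic E c ∧ ∀ c' ∈ R, (∃ m, IsAlgebraic E m ∧ Near w.ring (X - c') m) ∨
      Near w.ring (X - c') (X - c) := by
  classical
  by_cases hR0 : R = 0
  · exact ⟨0, isAlgebraic_zero, by simp [hR0]⟩
  obtain ⟨c₀, hc₀⟩ := Multiset.exists_mem_of_ne_zero hR0
  obtain ⟨c, hc, hmin⟩ := R.toFinset.exists_min_image (fun c => w.ring.valuation (X - c))
    ⟨c₀, Multiset.mem_toFinset.2 hc₀⟩
  rw [Multiset.mem_toFinset] at hc
  have hcalg := hR c hc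
  refine ⟨c, hcalg, fun c' hc' => ?_⟩
  have hle := hmin c' (Multiset.mem_toFinset.2 hc')
  have hc'alg := hR c' hc'
  by_cases hbest : ∃ e, IsAlgebraic E e ∧ w.ring.valuation (X - e) < w.ring.valuation (X - c)
  · obtain ⟨e, he, hlt⟩ := hbest
    exact Or.inl ⟨e - c', he.sub hc'alg, near_sub_of_lt (hlt.trans_le hle)⟩
  push Not at hbest
  rcases hle.lt_or_eq with hlt | heq
  · exact Or.inl ⟨c - c', hcalg.sub hc'alg, near_sub_of_lt hlt⟩
  right
  have hXc : X - c ≠ 0 := fun h => hX (sub_eq_zero.1 h ▸ hcalg)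
  have hdiff : w.ring.valuation (c - c') ≤ w.ring.valuation (X - c) := by
    have : c - c' = (X - c') - (X - c) := by ring
    rw [this]
    exact (Valuation.map_sub _ _ _).trans (by rw [← heq, max_self])
  rcases hdiff.lt_or_eq with hlt | heq'
  · have : X - c' - (X - c) = c - c' := by ring
    rwa [Near, this]
  exfalso
  set s := c - c'
  have hs0 : s ≠ 0 := by
    rw [← Valuation.ne_zero_iff w.ring.valuation, heq']
    exact (Valuation.ne_zero_iff _).2 hXc
  have hsalg : IsAlgebraic E s := hcalg.sub hc'alg
  have ht : w.ring.valuation ((X - c) / s) = 1 := by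
    rw [map_div₀, heq', div_self ((Valuation.ne_zero_iff _).2 hXc)]
  have htalg : IsAlgebraic (Res v) (residue w.ring ((X - c) / s)) := by
    by_contra h
    exact hno c s ⟨hcalg, hsalg, h⟩
  obtain ⟨b, hb, hbA, hbt⟩ := exists_algebraic_residue_eq w htalg
  rw [residue_eq_iff _ hbA (mem_of_val_eq_one _ ht), Valuation.map_sub_swap] at hbt
  have h1 := hbest (c + b * s) (hcalg.add (hb.mul hsalg))
  have e : X - (c + b * s) = ((X - c) / s - b) * s := by field_simp; ring
  rw [e, map_mul, ← heq'] at h1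
  have h2 : 0 < w.ring.valuation s := (Valuation.pos_iff _).2 hs0
  exact absurd ((mul_lt_iff_lt_one_left h2).2 hbt) (not_lt.2 h1)

theorem exists_near_monomial [IsAlgClosed L] (R : Multiset L)
    (hR : ∀ c' ∈ R, (∃ m, IsAlgebraic E m ∧ Near w.ring (X - c') m) ∨
      Near w.ring (X - c') (X - c)) :
    ∃ m, IsAlgebraic E m ∧ ∃ k : ℕ,
      Near w.ring (R.map fun c' => X - c').prod (m * (X - c) ^ k) := by
  induction R using Multiset.induction_on with
  | empty => exact ⟨1, isAlgebraic_one, 0, by simpa using near_refl one_ne_zero⟩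
  | cons c' R ih =>
    obtain ⟨m, hm, k, hk⟩ := ih fun x hx => hR x (Multiset.mem_cons_of_mem hx)
    rw [Multiset.map_cons, Multiset.prod_cons]
    rcases hR c' (Multiset.mem_cons_self c' R) with ⟨m', hm', hn⟩ | hn
    · exact ⟨m' * m, hm'.mul hm, k, by rw [mul_assoc]; exact hn.mul hk⟩
    · refine ⟨m, hm, k + 1, ?_⟩
      have e : m * (X - c) ^ (k + 1) = (X - c) * (m * (X - c) ^ k) := by ring
      rw [e]
      exact hn.mul hk

theorem isAlgebraic_of_mem_aroots {g : E[X]} {x : L} (hx : x ∈ g.aroots L) : IsAlgebraic E x := by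
  rw [mem_aroots] at hx
  exact ⟨g, hx.1, hx.2⟩

theorem aeval_eq_prod_sub [IsAlgClosed L] (g : E[X]) (x : L) : aeval x g =
    algebraMap E L g.leadingCoeff * ((g.aroots L).map fun c => x - c).prod :=
  (IsAlgClosed.splits _).aeval_eq_prod_aroots x

/-- Without a center, the numerator and denominator of y are both near monomials in one X - c, so y
is near μ(X - c)^n. If n = 0, the residue of y is algebraic. Otherwise an n-th root d of 1/μ turns
this into ((X - c)/d)^n, and (c, d) is a center after all. -/
theorem exists_isCenter [IsAlgClosed L] {y : L} (hy : y ∈ IntermediateField.adjoin E {X})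
    (hyt : Transcendental (Res v) (residue w.ring y)) : ∃ c d, IsCenter w X c d := by
  by_contra! hno
  have hX : ¬ IsAlgebraic E X := by
    intro hX
    apply hyt
    apply isAlgebraic_residue_of_isAlgebraic w
    have : Algebra.IsAlgebraic E (IntermediateField.adjoin E {X}) :=
      IntermediateField.isAlgebraic_adjoin_simple hX.isIntegral
    exact IntermediateField.isAlgebraic_iff.1
      (Algebra.IsAlgebraic.isAlgebraic (R := E) (⟨y, hy⟩ : IntermediateField.adjoin E {X}))
  obtain ⟨g, h, rfl⟩ := (IntermediateField.mem_adjoin_simple_iff E y).1 hy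
  have hyv := val_eq_one_of_transcendental w hyt
  have hy0 := ne_zero_of_val_eq_one _ hyv
  have hg0 : g ≠ 0 := by
    rintro rfl
    simp at hy0
  have hh0 : h ≠ 0 := by
    rintro rfl
    simp at hy0
  obtain ⟨c, hc, hcR⟩ := exists_common_center hX hno (g.aroots L + h.aroots L) (by
    intro x hx
    rcases Multiset.mem_add.1 hx with hx | hx
    · exact isAlgebraic_of_mem_aroots hx
    · exact isAlgebraic_of_mem_aroots hx)
  have key : ∀ p : E[X], p ≠ 0 → (∀ c' ∈ p.aroots L, c' ∈ g.aroots L + h.aroots L) →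
      ∃ m, IsAlgebraic E m ∧ ∃ k : ℕ, Near w.ring (aeval X p) (m * (X - c) ^ k) := by
    intro p hp hpR
    obtain ⟨m, hm, k, hk⟩ := exists_near_monomial (p.aroots L) fun c' hc' => hcR c' (hpR c' hc')
    refine ⟨algebraMap E L p.leadingCoeff * m, (isAlgebraic_algebraMap _).mul hm, k, ?_⟩
    rw [aeval_eq_prod_sub, mul_assoc]
    exact (near_refl (by simpa using hp)).mul hk
  obtain ⟨m, hm, k, hk⟩ := key g hg0 fun c' hc' => Multiset.mem_add.2 (Or.inl hc')
  obtain ⟨m', hm', k', hk'⟩ := key h hh0 fun c' hc' => Multiset.mem_add.2 (Or.inr hc')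
  have hXc : X - c ≠ 0 := fun h => hX (sub_eq_zero.1 h ▸ hc)
  have hn := hk.div hk'
  have e : m * (X - c) ^ k / (m' * (X - c) ^ k') = (m / m') * (X - c) ^ ((k : ℤ) - k') := by
    rw [zpow_sub₀ hXc, zpow_natCast, zpow_natCast, mul_div_mul_comm]
  rw [e] at hn
  have hmm : IsAlgebraic E (m / m') := hm.div hm'
  have hmm0 : m / m' ≠ 0 := left_ne_zero_of_mul hn.right_ne_zero
  rw [hn.residue_eq] at hyt
  rw [hn.val_eq] at hyv
  generalize m / m' = μ at *
  generalize (k : ℤ) - k' = n at *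
  by_cases hn0 : n = 0
  · rw [hn0, zpow_zero, mul_one] at hyt
    exact hyt (isAlgebraic_residue_of_isAlgebraic w hmm)
  obtain ⟨d, hd⟩ : ∃ d : L, d ^ n = μ⁻¹ := by
    obtain ⟨z, hz⟩ := IsAlgClosed.exists_pow_nat_eq μ⁻¹ (Int.natAbs_pos.2 hn0)
    rcases Int.natAbs_eq n with h1 | h1
    · exact ⟨z, by rw [h1, zpow_natCast, hz]⟩
    · exact ⟨z⁻¹, by rw [h1, zpow_neg, zpow_natCast, inv_pow, inv_inv, hz]⟩
  have hd0 : d ≠ 0 := by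
    rintro rfl
    rw [zero_zpow _ hn0] at hd
    exact inv_ne_zero hmm0 hd.symm
  have hdalg : IsAlgebraic E d := by
    have h1 : IsAlgebraic E (d ^ n.natAbs) := by
      rcases Int.natAbs_eq n with h1 | h1
      · rw [h1, zpow_natCast] at hd
        rw [hd]
        exact hmm.inv
      · rw [h1, zpow_neg, zpow_natCast, inv_inj] at hd
        rw [hd]
        exact hmm
    exact h1.of_pow (Int.natAbs_pos.2 hn0)
  have e2 : μ * (X - c) ^ n = ((X - c) / d) ^ n := by
    rw [div_zpow, hd, div_inv_eq_mul, mul_comm]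
  rw [e2] at hyt hyv
  have h1 : w.ring.valuation ((X - c) / d) = 1 := by
    rw [map_zpow₀] at hyv
    have h2 : w.ring.valuation ((X - c) / d) ^ n.natAbs = 1 := by
      rcases Int.natAbs_eq n with h1 | h1
      · rwa [h1, zpow_natCast] at hyv
      · rwa [h1, zpow_neg, zpow_natCast, inv_eq_one] at hyv
    exact (pow_eq_one_iff_of_nonneg zero_le (Int.natAbs_ne_zero.2 hn0)).1 h2
  rw [residue_zpow _ h1] at hyt
  refine hno c d ⟨hc, hdalg, fun halg => hyt ?_⟩
  rcases Int.natAbs_eq n with h2 | h2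
  · rw [h2, zpow_natCast]
    exact halg.pow _
  · rw [h2, zpow_neg, zpow_natCast]
    exact (halg.pow _).inv

/-- A center of minimal degree. -/
structure IsMinCenter (w : ValExt v L) (X a d : L) : Prop extends IsCenter w X a d where
  lt_val : ∀ c, IsAlgebraic E c → (minpoly E c).natDegree < (minpoly E a).natDegree →
    w.ring.valuation d < w.ring.valuation (X - c)

/-- The scale d stays fixed: an element of smaller degree within distance |d| of X would be a center
with the same d. -/
theorem IsCenter.exists_isMinCenter (h : IsCenter w X c d) : ∃ a, IsMinCenter w X a d := by
  classical
  have hex : ∃ n, ∃ a, IsCenter w X a d ∧ (minpoly E a).natDegree = n := ⟨_, c, h, rfl⟩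
  obtain ⟨a, ha, han⟩ := Nat.find_spec hex
  refine ⟨a, ha, fun c' hc' hlt => ?_⟩
  by_contra! hle
  rw [han] at hlt
  exact Nat.find_min hex hlt ⟨c', h.of_val_le hc' hle, rfl⟩

theorem IsCenter.isMinCenter_zero (h : IsCenter w X 0 d) : IsMinCenter w X 0 d := by
  refine ⟨h, fun c hc hlt => ?_⟩
  rw [minpoly.zero, natDegree_X] at hlt
  exact absurd (minpoly.natDegree_pos hc.isIntegral) (by omega)

theorem near_aeval_of_roots [IsAlgClosed L] {a : L} {g : E[X]} (hg : g ≠ 0)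
    (h : ∀ c ∈ g.aroots L, w.ring.valuation (X - a) < w.ring.valuation (X - c)) :
    Near w.ring (aeval X g) (aeval a g) := by
  rw [aeval_eq_prod_sub, aeval_eq_prod_sub]
  refine (near_refl (by simpa using hg)).mul ?_
  generalize g.aroots L = R at h
  induction R using Multiset.induction_on with
  | empty => simpa using near_refl one_ne_zero
  | cons c R ih =>
    rw [Multiset.map_cons, Multiset.prod_cons, Multiset.map_cons, Multiset.prod_cons]
    exact (near_sub_of_lt (h c (Multiset.mem_cons_self c R))).mul
      (ih fun x hx => h x (Multiset.mem_cons_of_mem hx))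

/-- The roots of g have smaller degree than a, so they are farther from X than a is, and a may
replace X in each linear factor. -/
theorem IsMinCenter.near_aeval [IsAlgClosed L] {a : L} (h : IsMinCenter w X a d) {g : E[X]}
    (hg : g ≠ 0) (hdeg : g.natDegree < (minpoly E a).natDegree) :
    Near w.ring (aeval X g) (aeval a g) := by
  refine near_aeval_of_roots hg fun c hc => ?_
  rw [h.val_eq]
  refine h.lt_val c (isAlgebraic_of_mem_aroots hc) (lt_of_le_of_lt ?_ hdeg)
  rw [mem_aroots] at hc
  exact natDegree_le_of_dvd (minpoly.dvd E c hc.2) hg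

/-- The residue of a normalized product of factors `X - c`, as a polynomial in the residue of
`(X - a) / d`. -/
theorem IsCenter.exists_resPoly_prod {a : L} (h : IsCenter w X a d) (R : Multiset L)
    (hR : ∀ c ∈ R, IsAlgebraic E c) :
    ∃ κ y, IsAlgebraic E κ ∧ κ ≠ 0 ∧ (R.map fun c => X - c).prod = κ * y ∧ y ∈ w.ring ∧
      ∃ ρ : (resField w (algebraicClosure E L))[X], ρ.Monic ∧
        ρ.natDegree = Multiset.countP (fun c => w.ring.valuation (X - c) = w.ring.valuation d) R ∧
        residue w.ring y = aeval (residue w.ring ((X - a) / d)) ρ := by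
  classical
  induction R using Multiset.induction_on with
  | empty =>
    exact ⟨1, 1, isAlgebraic_one, one_ne_zero, by simp, w.ring.one_mem, 1, monic_one, by simp,
      by simp [residue_one]⟩
  | cons c R ih =>
    obtain ⟨κ, y, hκ, hκ0, hprod, hyA, ρ, hρ, hdeg, hres⟩ :=
      ih fun x hx => hR x (Multiset.mem_cons_of_mem hx)
    have hc := hR c (Multiset.mem_cons_self c R)
    rw [Multiset.map_cons, Multiset.prod_cons, hprod]
    -- No root is nearer to X than |d|. A root at distance exactly |d| contributes a linear factor
    -- in the residue of (X - a)/d; a farther one only the constant a - c.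
    by_cases hval : w.ring.valuation (X - c) = w.ring.valuation d
    · obtain ⟨hca, hca'⟩ := h.residue_sub hval.le
      have hdalg := h.alg_scale
      have hz : (X - c) / d ∈ w.ring := by
        apply mem_of_val_eq_one
        rw [map_div₀, hval, div_self ((Valuation.ne_zero_iff _).2 h.scale_ne_zero)]
      have hmemC : (a - c) / d ∈ algebraicClosure E L := by
        rw [mem_algebraicClosure_iff]
        exact (h.alg.sub hc).div hdalg
      refine ⟨d * κ, (X - c) / d * y, hdalg.mul hκ, mul_ne_zero h.scale_ne_zero hκ0, ?_,
        mul_mem hz hyA, (Polynomial.X + C ⟨_, residue_mem_resField w hmemC⟩) * ρ,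
        (monic_X_add_C _).mul hρ, ?_, ?_⟩
      · have := h.scale_ne_zero
        field_simp
      · rw [(monic_X_add_C _).natDegree_mul hρ, natDegree_X_add_C, hdeg,
          Multiset.countP_cons_of_pos R hval, add_comm]
      · rw [residue_mul _ hz hyA, hca', hres, map_mul, map_add, aeval_X, aeval_C]
        rfl
    · have hlt : w.ring.valuation (X - a) < w.ring.valuation (X - c) := by
        rw [h.val_eq]
        exact lt_of_le_of_ne (h.le_val hc) (Ne.symm hval)
      have hn := near_sub_of_lt hlt
      have hn1 := hn.div (near_refl hn.right_ne_zero)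
      rw [div_self hn.right_ne_zero] at hn1
      have hv1 : w.ring.valuation ((X - c) / (a - c)) = 1 := by rw [hn1.val_eq, map_one]
      refine ⟨(a - c) * κ, (X - c) / (a - c) * y, (h.alg.sub hc).mul hκ,
        mul_ne_zero hn.right_ne_zero hκ0, ?_, mul_mem (mem_of_val_eq_one _ hv1) hyA, ρ, hρ, ?_, ?_⟩
      · have := hn.right_ne_zero
        field_simp
      · rw [hdeg, Multiset.countP_cons_of_neg R hval]
      · rw [residue_mul _ (mem_of_val_eq_one _ hv1) hyA, hn1.residue_eq, residue_one, one_mul, hres]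

end Center

end HyperellipticResidue

namespace HyperellipticResidue

open Polynomial

/-! ### Expansions in powers of a key polynomial -/

section Frame

variable {E L : Type*} [Field E] [Field L] [Algebra E L] {v : ValuationSubring E} (w : ValExt v L)

/-- A description of the valuation on `E(X)` by expansions in powers of an element `Q = κ q`, with
coefficients algebraic over `E` and with `q` of transcendental residue. -/
structure Frame (X a Q κ q : L) : Prop where
  alg : IsAlgebraic E a
  mem : Q ∈ IntermediateField.adjoin E {X}
  alg_scale : IsAlgebraic E κ
  scale_ne_zero : κ ≠ 0
  eq_mul : Q = κ * q
  trans : Transcendental (Res v) (residue w.ring q)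
  approx : ∀ b ∈ IntermediateField.adjoin E {a}, b ≠ 0 →
    ∃ b' ∈ IntermediateField.adjoin E {X}, Near w.ring b b'
  expand : ∀ g : E[X], g ≠ 0 → ∃ N, ∃ b : ℕ → L, (∀ i, b i ∈ IntermediateField.adjoin E {a}) ∧
    Near w.ring (aeval X g) (∑ i ∈ Finset.range N, b i * Q ^ i)

variable {w} {X a d : L}

theorem isAlgebraic_of_mem_adjoin (ha : IsAlgebraic E a) {b : L}
    (hb : b ∈ IntermediateField.adjoin E {a}) : IsAlgebraic E b := by
  have : Algebra.IsAlgebraic E (IntermediateField.adjoin E {a}) :=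
    IntermediateField.isAlgebraic_adjoin_simple ha.isIntegral
  exact IntermediateField.isAlgebraic_iff.1
    (Algebra.IsAlgebraic.isAlgebraic (R := E) (⟨b, hb⟩ : IntermediateField.adjoin E {a}))

theorem aeval_mem_adjoin_simple (x : L) (g : E[X]) :
    aeval x g ∈ IntermediateField.adjoin E {x} :=
  IntermediateField.algebra_adjoin_le_adjoin E _ (aeval_mem_adjoin_singleton E x)

theorem exists_aeval_eq_of_mem_adjoin (ha : IsAlgebraic E a) {b : L}
    (hb : b ∈ IntermediateField.adjoin E {a}) :
    ∃ g : E[X], g.natDegree < (minpoly E a).natDegree ∧ aeval a g = b := by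
  rw [← IntermediateField.mem_toSubalgebra,
    IntermediateField.adjoin_simple_toSubalgebra_of_isAlgebraic ha,
    Algebra.adjoin_singleton_eq_range_aeval] at hb
  obtain ⟨g, rfl⟩ := hb
  have hmonic := minpoly.monic ha.isIntegral
  refine ⟨g %ₘ minpoly E a, natDegree_modByMonic_lt g hmonic (minpoly.ne_one E a), ?_⟩
  conv_rhs => rw [← modByMonic_add_div g (minpoly E a)]
  simp

/-- After Q = κq this is the Gauss property of q over the algebraic closure of E in L, which
contains κ and all b i; its residue field is algebraic over Ev, so the residue of q stays
transcendental over it. -/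
theorem val_term_le {Q κ q : L} (hκ : IsAlgebraic E κ) (hQ : Q = κ * q)
    (hq : Transcendental (Res v) (residue w.ring q)) (b : ℕ → L) (hb : ∀ i, IsAlgebraic E (b i))
    (s : Finset ℕ) {j : ℕ} (hj : j ∈ s) :
    w.ring.valuation (b j * Q ^ j) ≤ w.ring.valuation (∑ i ∈ s, b i * Q ^ i) := by
  have hmem : ∀ i, b i * κ ^ i ∈ algebraicClosure E L := fun i => by
    rw [mem_algebraicClosure_iff]
    exact (hb i).mul (hκ.pow i)
  have h := val_coeff_le_val_sum w (fun i => (⟨_, hmem i⟩ : algebraicClosure E L)) s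
    (hq.extendScalars (resField w (algebraicClosure E L))) hj
  have h1 : w.ring.valuation (b j * Q ^ j) = w.ring.valuation (b j * κ ^ j) := by
    rw [hQ, mul_pow, ← mul_assoc, map_mul, map_pow _ q, val_eq_one_of_transcendental w hq, one_pow,
      mul_one]
  have h2 : ∑ i ∈ s, b i * Q ^ i = ∑ i ∈ s, b i * κ ^ i * q ^ i :=
    Finset.sum_congr rfl fun i _ => by rw [hQ]; ring
  rw [h1, h2]
  exact h

/-- The expansion of a polynomial in powers of a monic polynomial. -/
theorem exists_expansion {Q : E[X]} (hQ : Q.Monic) (hdeg : 0 < Q.natDegree) (g : E[X]) :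
    ∃ N, ∃ s : ℕ → E[X], (∀ i, (s i).natDegree < Q.natDegree) ∧
      g = ∑ i ∈ Finset.range N, s i * Q ^ i := by
  induction hn : g.natDegree using Nat.strong_induction_on generalizing g with
  | _ n ih =>
    by_cases hlt : n < Q.natDegree
    · exact ⟨1, fun i => if i = 0 then g else 0, fun i => by
        dsimp only
        split_ifs
        · rwa [hn]
        · rwa [natDegree_zero], by simp⟩
    have h1 : (g /ₘ Q).natDegree < n := by
      rw [natDegree_divByMonic g hQ]
      omega
    obtain ⟨N, s, hs, hsum⟩ := ih _ h1 (g /ₘ Q) rfl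
    refine ⟨N + 1, fun i => if i = 0 then g %ₘ Q else s (i - 1), fun i => ?_, ?_⟩
    · dsimp only
      split_ifs
      · exact natDegree_modByMonic_lt g hQ (by rintro rfl; simp at hdeg)
      · exact hs _
    · rw [Finset.sum_range_succ']
      simp only [Nat.add_eq_zero_iff, one_ne_zero, and_false, if_false, Nat.add_sub_cancel, if_true,
        pow_zero, mul_one]
      have h2 : ∑ i ∈ Finset.range N, s i * Q ^ (i + 1) = Q * (g /ₘ Q) := by
        conv_rhs => rw [hsum, Finset.mul_sum]
        exact Finset.sum_congr rfl fun i _ => by ring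
      rw [h2, add_comm, modByMonic_add_div]

/-- Q-adic digits have degree less than that of a, so minimality of the center lets their values at
X be replaced by their values at a. The residue of q is a polynomial ρ in the residue of (X - a)/d;
ρ is not constant, because a itself is a root of its minimal polynomial at distance |d|. -/
theorem IsMinCenter.exists_frame [IsAlgClosed L] (h : IsMinCenter w X a d) :
    ∃ κ q, Frame w X a (aeval X (minpoly E a)) κ q ∧
      ∃ ρ : (resField w (algebraicClosure E L))[X], 0 < ρ.natDegree ∧
        residue w.ring q = aeval (residue w.ring ((X - a) / d)) ρ := by
  classical
  have hmonic := minpoly.monic h.alg.isIntegral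
  have hdeg := minpoly.natDegree_pos h.alg.isIntegral
  obtain ⟨κ, q, hκ, hκ0, hprod, hqA, ρ, hρ, hρdeg, hres⟩ :=
    h.exists_resPoly_prod ((minpoly E a).aroots L) fun c hc => isAlgebraic_of_mem_aroots hc
  have hQ : aeval X (minpoly E a) = κ * q := by
    rw [aeval_eq_prod_sub, hmonic.leadingCoeff, map_one, one_mul, hprod]
  have hρ0 : 0 < ρ.natDegree := by
    rw [hρdeg, Multiset.countP_pos]
    exact ⟨a, by rw [mem_aroots]; exact ⟨hmonic.ne_zero, minpoly.aeval E a⟩, h.val_eq⟩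
  have hτ := h.trans.extendScalars (resField w (algebraicClosure E L))
  have htrans : Transcendental (Res v) (residue w.ring q) := by
    have h1 : Transcendental (resField w (algebraicClosure E L)) (residue w.ring q) := by
      rw [hres]
      exact hτ.aeval ρ hρ0.ne' (by rw [hρ.leadingCoeff]; exact one_mem _)
    exact h1.restrictScalars (algebraMap (Res v) _).injective
  refine ⟨κ, q, ⟨h.alg, aeval_mem_adjoin_simple X _, hκ, hκ0, hQ, htrans, ?_, ?_⟩,
    ρ, hρ0, hres⟩
  · intro b hb hb0
    obtain ⟨g, hgdeg, rfl⟩ : ∃ g : E[X], g.natDegree < (minpoly E a).natDegree ∧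
        aeval a g = b := exists_aeval_eq_of_mem_adjoin h.alg hb
    have hg0 : g ≠ 0 := by
      rintro rfl
      simp at hb0
    exact ⟨aeval X g, aeval_mem_adjoin_simple X g, (h.near_aeval hg0 hgdeg).symm⟩
  · intro g hg
    obtain ⟨N, s, hs, hsum⟩ := exists_expansion hmonic hdeg g
    have hbmem : ∀ i, aeval a (s i) ∈ IntermediateField.adjoin E {a} := fun i =>
      aeval_mem_adjoin_simple a (s i)
    refine ⟨N, fun i => aeval a (s i), hbmem, ?_⟩
    have hle := fun {j} => val_term_le (w := w) hκ hQ htrans (fun i => aeval a (s i))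
      (fun i => isAlgebraic_of_mem_adjoin h.alg (hbmem i)) (Finset.range N) (j := j)
    have hQ0 : aeval X (minpoly E a) ≠ 0 := by
      rw [hQ]
      exact mul_ne_zero hκ0 (ne_zero_of_val_eq_one _ (val_eq_one_of_transcendental w htrans))
    obtain ⟨i₀, hi₀, hsi₀⟩ : ∃ i ∈ Finset.range N, s i ≠ 0 := by
      by_contra! hcon
      apply hg
      rw [hsum]
      exact Finset.sum_eq_zero fun i hi => by rw [hcon i hi, zero_mul]
    have hpos : 0 < w.ring.valuation
        (∑ i ∈ Finset.range N, aeval a (s i) * aeval X (minpoly E a) ^ i) :=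
      lt_of_lt_of_le ((Valuation.pos_iff _).2 (mul_ne_zero
        (h.near_aeval hsi₀ (hs i₀)).right_ne_zero (pow_ne_zero _ hQ0))) (hle hi₀)
    have hg' : aeval X g = ∑ i ∈ Finset.range N, aeval X (s i) * aeval X (minpoly E a) ^ i := by
      conv_lhs => rw [hsum, map_sum]
      exact Finset.sum_congr rfl fun i _ => by rw [map_mul, map_pow]
    rw [Near, hg', ← Finset.sum_sub_distrib]
    -- Replacing X by a in a digit changes its term by less than that term, and no term exceeds the
    -- sum.
    refine Valuation.map_sum_lt _ hpos.ne' fun i hi => ?_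
    by_cases hsi : s i = 0
    · simpa [hsi] using hpos
    rw [← sub_mul]
    refine lt_of_lt_of_le ?_ (hle hi)
    rw [map_mul, map_mul]
    exact mul_lt_mul_of_pos_right (h.near_aeval hsi (hs i)) ((Valuation.pos_iff _).2 (pow_ne_zero _ hQ0))

end Frame

/-! ### The residue field of E(X) is rational over that of E(a) -/

section Generator

variable {E L : Type*} [Field E] [Field L] [Algebra E L] {v : ValuationSubring E} {w : ValExt v L}
  {X a Q κ q : L}

theorem Frame.ne_zero (h : Frame w X a Q κ q) : Q ≠ 0 := by
  rw [h.eq_mul]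
  exact mul_ne_zero h.scale_ne_zero
    (ne_zero_of_val_eq_one _ (val_eq_one_of_transcendental w h.trans))

theorem Frame.val_eq (h : Frame w X a Q κ q) : w.ring.valuation Q = w.ring.valuation κ := by
  rw [h.eq_mul, map_mul, val_eq_one_of_transcendental w h.trans, mul_one]

/-- The exponents `e` such that the value of `Q ^ e` is a value of `E(a)` are the multiples of
a nonzero one. -/
theorem Frame.exists_exponent (h : Frame w X a Q κ q) : ∃ e : ℤ, e ≠ 0 ∧
    (∃ b ∈ IntermediateField.adjoin E {a}, w.ring.valuation (b * Q ^ e) = 1) ∧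
    ∀ j : ℤ, ∀ b ∈ IntermediateField.adjoin E {a}, w.ring.valuation (b * Q ^ j) = 1 →
      ∃ r : ℤ, j = e * r := by
  have hQ0 := h.ne_zero
  let H : AddSubgroup ℤ :=
    { carrier := {j | ∃ b ∈ IntermediateField.adjoin E {a}, w.ring.valuation (b * Q ^ j) = 1}
      zero_mem' := ⟨1, one_mem _, by simp⟩
      add_mem' := by
        rintro i j ⟨b, hb, hb1⟩ ⟨c, hc, hc1⟩
        refine ⟨b * c, mul_mem hb hc, ?_⟩
        rw [zpow_add₀ hQ0, mul_mul_mul_comm, map_mul, hb1, hc1, one_mul]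
      neg_mem' := by
        rintro i ⟨b, hb, hb1⟩
        refine ⟨b⁻¹, inv_mem hb, ?_⟩
        rw [zpow_neg, ← mul_inv, map_inv₀, hb1, inv_one] }
  obtain ⟨e, he⟩ := Int.subgroup_cyclic H
  have hmem : ∀ j : ℤ, j ∈ H ↔ ∃ r : ℤ, j = e * r := by
    intro j
    rw [he, AddSubgroup.mem_closure_singleton]
    exact exists_congr fun r => by rw [smul_eq_mul, mul_comm, eq_comm]
  refine ⟨e, ?_, (hmem e).2 ⟨1, by simp⟩, fun j b hb hb1 => (hmem j).1 ⟨b, hb, hb1⟩⟩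
  -- The group of exponents is nonzero: |Q| = |κ| is torsion modulo the value group of E, because κ
  -- is algebraic.
  rintro rfl
  obtain ⟨N, hN, c, hc, hval⟩ := exists_val_pow_eq w h.alg_scale h.scale_ne_zero
  have h1 : (N : ℤ) ∈ H := by
    refine ⟨algebraMap E L c⁻¹, IntermediateField.algebraMap_mem _ _, ?_⟩
    rw [zpow_natCast, map_mul, map_pow, h.val_eq, ← map_pow, hval, ← map_mul, ← map_mul,
      inv_mul_cancel₀ hc, map_one, map_one]
  obtain ⟨r, hr⟩ := (hmem _).1 h1
  simp at hr
  omega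

/-- A choice of the exponent of `Frame.exists_exponent`, together with a unit `b * Q ^ e`. -/
structure Generator (w : ValExt v L) (a Q : L) (e : ℤ) (b : L) : Prop where
  ne_zero : e ≠ 0
  mem : b ∈ IntermediateField.adjoin E {a}
  val : w.ring.valuation (b * Q ^ e) = 1
  dvd : ∀ j : ℤ, ∀ c ∈ IntermediateField.adjoin E {a}, w.ring.valuation (c * Q ^ j) = 1 →
      ∃ r : ℤ, j = e * r

theorem Frame.exists_generator (h : Frame w X a Q κ q) : ∃ e b, Generator w a Q e b := by
  obtain ⟨e, he, ⟨b, hb, hb1⟩, hdvd⟩ := h.exists_exponent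
  exact ⟨e, b, he, hb, hb1, hdvd⟩

variable {e : ℤ} {b : L}

/-- b Q^e is the algebraic unit b κ^e times q^e with e nonzero. The exponent may be negative, hence
the inverses. -/
theorem Frame.transcendental_generator (h : Frame w X a Q κ q) (hg : Generator w a Q e b) :
    Transcendental (Res v) (residue w.ring (b * Q ^ e)) := by
  have hq1 := val_eq_one_of_transcendental w h.trans
  have h1 : b * Q ^ e = b * κ ^ e * q ^ e := by rw [h.eq_mul, mul_zpow, mul_assoc]
  have h2 : w.ring.valuation (q ^ e) = 1 := by rw [map_zpow₀, hq1, one_zpow]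
  have h3 : w.ring.valuation (b * κ ^ e) = 1 := by
    have := hg.val
    rwa [h1, map_mul, h2, mul_one] at this
  have h4 : IsAlgebraic E (b * κ ^ e) := by
    refine (isAlgebraic_of_mem_adjoin h.alg hg.mem).mul ?_
    obtain ⟨n, rfl | rfl⟩ := e.eq_nat_or_neg
    · rw [zpow_natCast]
      exact h.alg_scale.pow n
    · rw [zpow_neg, zpow_natCast]
      exact (h.alg_scale.pow n).inv
  have h5 := isAlgebraic_residue_of_isAlgebraic w h4
  have h6 : residue w.ring (b * κ ^ e) ≠ 0 := (residue_ne_zero_iff _).2 h3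
  rw [h1, residue_mul _ (mem_of_val_eq_one _ h3) (mem_of_val_eq_one _ h2), residue_zpow _ hq1]
  intro hcon
  have h7 := hcon.div h5
  rw [mul_div_cancel_left₀ _ h6] at h7
  apply h.trans
  obtain ⟨n, rfl | rfl⟩ := e.eq_nat_or_neg
  · rw [zpow_natCast] at h7
    exact h7.of_pow (Nat.pos_of_ne_zero (by simpa using hg.ne_zero))
  · rw [zpow_neg, zpow_natCast] at h7
    have h8 := h7.inv
    rw [inv_inv] at h8
    exact h8.of_pow (Nat.pos_of_ne_zero (by simpa using hg.ne_zero))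

/-- The residue of a unit monomial. -/
theorem Generator.residue_monomial (hg : Generator w a Q e b) {c : L} {j : ℤ}
    (hc : c ∈ IntermediateField.adjoin E {a}) (h1 : w.ring.valuation (c * Q ^ j) = 1) :
    ∃ r : ℤ, j = e * r ∧ ∃ l ∈ resField w (IntermediateField.adjoin E {a}), l ≠ 0 ∧
      residue w.ring (c * Q ^ j) = l * residue w.ring (b * Q ^ e) ^ r := by
  obtain ⟨r, rfl⟩ := hg.dvd j c hc h1
  have hb0 : b ≠ 0 := left_ne_zero_of_mul (ne_zero_of_val_eq_one _ hg.val)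
  have h2 : c * Q ^ (e * r) = c * b ^ (-r) * (b * Q ^ e) ^ r := by
    rw [mul_zpow, ← zpow_mul, zpow_neg]
    have := zpow_ne_zero r hb0
    field_simp
  have h3 : w.ring.valuation ((b * Q ^ e) ^ r) = 1 := by rw [map_zpow₀, hg.val, one_zpow]
  have h4 : w.ring.valuation (c * b ^ (-r)) = 1 := by
    rwa [h2, map_mul, h3, mul_one] at h1
  refine ⟨r, rfl, residue w.ring (c * b ^ (-r)),
    residue_mem_resField w (mul_mem hc (zpow_mem hg.mem _)), (residue_ne_zero_iff _).2 h4, ?_⟩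
  rw [h2, residue_mul _ (mem_of_val_eq_one _ h4) (mem_of_val_eq_one _ h3), residue_zpow _ hg.val]

theorem Generator.residue_monomial_mem (hg : Generator w a Q e b) {c : L} {j : ℤ}
    (hc : c ∈ IntermediateField.adjoin E {a}) (h1 : w.ring.valuation (c * Q ^ j) ≤ 1) :
    residue w.ring (c * Q ^ j) ∈ resField w (IntermediateField.adjoin E {a}) ⊔
      IntermediateField.adjoin (Res v) {residue w.ring (b * Q ^ e)} := by
  rcases h1.lt_or_eq with h1 | h1
  · rw [residue_eq_zero_of_lt _ h1]
    exact zero_mem _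
  obtain ⟨r, -, l, hl, -, hres⟩ := hg.residue_monomial hc h1
  rw [hres]
  have hle : resField w (IntermediateField.adjoin E {a}) ≤
    resField w (IntermediateField.adjoin E {a}) ⊔
      IntermediateField.adjoin (Res v) {residue w.ring (b * Q ^ e)} := le_sup_left
  have hle' : IntermediateField.adjoin (Res v) {residue w.ring (b * Q ^ e)} ≤
    resField w (IntermediateField.adjoin E {a}) ⊔
      IntermediateField.adjoin (Res v) {residue w.ring (b * Q ^ e)} := le_sup_right
  exact mul_mem (hle hl) (zpow_mem (hle' (IntermediateField.mem_adjoin_simple_self _ _)) _)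

/-- Every polynomial in `X` is a monomial times a unit with residue in the expected field. -/
theorem Frame.exists_monomial_mul (h : Frame w X a Q κ q) (hg : Generator w a Q e b)
    {g : E[X]} (hg0 : g ≠ 0) : ∃ c ∈ IntermediateField.adjoin E {a}, ∃ j : ℤ, ∃ u,
      aeval X g = c * Q ^ j * u ∧ w.ring.valuation u = 1 ∧
      residue w.ring u ∈ resField w (IntermediateField.adjoin E {a}) ⊔
        IntermediateField.adjoin (Res v) {residue w.ring (b * Q ^ e)} := by
  obtain ⟨N, s, hs, hn⟩ := h.expand g hg0
  have hsum0 := hn.right_ne_zero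
  have hN : (Finset.range N).Nonempty := by
    rw [Finset.nonempty_iff_ne_empty]
    intro h0
    rw [h0, Finset.sum_empty] at hsum0
    exact hsum0 rfl
  obtain ⟨j, hj, hmax⟩ := (Finset.range N).exists_max_image
    (fun i => w.ring.valuation (s i * Q ^ i)) hN
  have hle := val_term_le h.alg_scale h.eq_mul h.trans s
    (fun i => isAlgebraic_of_mem_adjoin h.alg (hs i)) (Finset.range N) hj
  have heq : w.ring.valuation (∑ i ∈ Finset.range N, s i * Q ^ i) =
      w.ring.valuation (s j * Q ^ j) :=
    le_antisymm (Valuation.map_sum_le _ hmax) hle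
  have hQ0 := h.ne_zero
  have hsj : s j * Q ^ j ≠ 0 := by
    rw [← Valuation.ne_zero_iff w.ring.valuation, ← heq]
    exact (Valuation.ne_zero_iff _).2 hsum0
  have hsj0 := left_ne_zero_of_mul hsj
  -- The unit is the quotient of g(X) by its dominant term. Its residue is a sum of residues of
  -- monomials, each zero or a constant times a power of the generator.
  refine ⟨s j, hs j, j, aeval X g / (s j * Q ^ j), ?_, ?_, ?_⟩
  · rw [zpow_natCast, mul_div_cancel₀ _ hsj]
  · rw [map_div₀, hn.val_eq, heq, div_self ((Valuation.ne_zero_iff _).2 hsj)]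
  · rw [(hn.div (near_refl hsj)).residue_eq, Finset.sum_div]
    have hterm : ∀ i, s i * Q ^ i / (s j * Q ^ j) = s i / s j * Q ^ ((i : ℤ) - j) := by
      intro i
      rw [zpow_sub₀ hQ0, zpow_natCast, zpow_natCast, mul_div_mul_comm]
    have hint : ∀ i ∈ Finset.range N,
        w.ring.valuation (s i / s j * Q ^ ((i : ℤ) - j)) ≤ 1 := by
      intro i hi
      rw [← hterm, map_div₀]
      exact div_le_one_of_le₀ (hmax i hi) zero_le
    simp only [hterm]
    rw [residue_sum _ _ _ fun i hi => (w.ring.valuation_le_one_iff _).1 (hint i hi)]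
    exact sum_mem fun i hi => hg.residue_monomial_mem (div_mem (hs i) (hs j)) (hint i hi)

/-- The residue field of `E(X)` is rational over that of `E(a)`. -/
theorem Frame.resField_eq (h : Frame w X a Q κ q) (hg : Generator w a Q e b) :
    resField w (IntermediateField.adjoin E {X}) = resField w (IntermediateField.adjoin E {a}) ⊔
      IntermediateField.adjoin (Res v) {residue w.ring (b * Q ^ e)} := by
  have hQ0 := h.ne_zero
  have hb0 : b ≠ 0 := left_ne_zero_of_mul (ne_zero_of_val_eq_one _ hg.val)
  apply le_antisymm
  · rintro _ ⟨y, hy, hyA, rfl⟩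
    by_cases hy1 : residue w.ring y = 0
    · rw [hy1]
      exact zero_mem _
    rw [← Ne, residue_ne_zero_iff] at hy1
    have hy0 := ne_zero_of_val_eq_one _ hy1
    obtain ⟨g, g', rfl⟩ := (IntermediateField.mem_adjoin_simple_iff E y).1 hy
    have hg0 : g ≠ 0 := by
      rintro rfl
      simp at hy0
    have hg'0 : g' ≠ 0 := by
      rintro rfl
      simp at hy0
    obtain ⟨c, hc, j, u, hu, hu1, hur⟩ := h.exists_monomial_mul hg hg0
    obtain ⟨c', hc', j', u', hu', hu1', hur'⟩ := h.exists_monomial_mul hg hg'0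
    have e1 : aeval X g / aeval X g' = c / c' * Q ^ (j - j') * (u * u'⁻¹) := by
      rw [hu, hu', zpow_sub₀ hQ0]
      have := zpow_ne_zero j' hQ0
      field_simp
    have hv : w.ring.valuation (u * u'⁻¹) = 1 := by
      rw [map_mul, map_inv₀, hu1, hu1', inv_one, one_mul]
    have hv' : w.ring.valuation (c / c' * Q ^ (j - j')) = 1 := by
      rwa [e1, map_mul, hv, mul_one] at hy1
    rw [e1, residue_mul _ (mem_of_val_eq_one _ hv') (mem_of_val_eq_one _ hv),
      residue_mul _ (mem_of_val_eq_one _ hu1) (mem_of_val_eq_one _ (val_inv_eq_one _ hu1')),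
      residue_inv _ hu1']
    exact mul_mem (hg.residue_monomial_mem (div_mem hc hc') hv'.le) (mul_mem hur (inv_mem hur'))
  -- Elements of E(a) need not lie in E(X), but they are near elements of E(X), so their residues
  -- occur there.
  · refine sup_le ?_ ?_
    · rintro _ ⟨c, hc, hcA, rfl⟩
      by_cases hc0 : c = 0
      · rw [hc0, residue_zero]
        exact zero_mem _
      obtain ⟨c', hc', hn⟩ := h.approx c hc hc0
      rw [hn.residue_eq]
      exact residue_mem_resField w hc'
    · rw [IntermediateField.adjoin_simple_le_iff]
      obtain ⟨b', hb', hn⟩ := h.approx b hg.mem hb0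
      rw [(hn.mul (near_refl (zpow_ne_zero e hQ0))).residue_eq]
      exact residue_mem_resField w (mul_mem hb' (zpow_mem h.mem e))

theorem Frame.finiteDimensional (h : Frame w X a Q κ q) :
    FiniteDimensional (Res v) (resField w (IntermediateField.adjoin E {a})) := by
  have : FiniteDimensional E (IntermediateField.adjoin E {a}) :=
    IntermediateField.adjoin.finiteDimensional h.alg.isIntegral
  exact finiteDimensional_resField w _

theorem Frame.isRuled (h : Frame w X a Q κ q) :
    IsRuled (Res v) (resField w (IntermediateField.adjoin E {X})) := by
  obtain ⟨e, b, hg⟩ := h.exists_generator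
  have := h.finiteDimensional
  exact isRuled_of_eq_sup _ (h.transcendental_generator hg) (h.resField_eq hg)

end Generator

end HyperellipticResidue

namespace HyperellipticResidue

open Polynomial

/-! ### Square roots over a rational function field that keep it ruled -/

section RuledQuadratic

variable {k κ : Type*} [Field k] [Field κ] [Algebra k κ] {ℓ : IntermediateField k κ} {x θ : κ}

/-- The relation expresses x through θ, so θ alone generates the compositum over ℓ. -/
theorem isRuled_of_sq_eq_linear [FiniteDimensional k ℓ] (hx : Transcendental k x) {l l' : κ}
    (hl : l ∈ ℓ) (hl' : l' ∈ ℓ) (hl0 : l' ≠ 0) (h : θ ^ 2 = l + l' * x) :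
    IsRuled k (ℓ ⊔ IntermediateField.adjoin k {x} ⊔ IntermediateField.adjoin k {θ} :
      IntermediateField k κ) := by
  have hxe : x = (θ ^ 2 - l) / l' := by
    rw [h]
    field_simp
    ring
  have alg : ∀ z ∈ ℓ, IsAlgebraic k z := fun z hz =>
    IntermediateField.isAlgebraic_iff.1
      ((Algebra.IsAlgebraic.of_finite k ℓ).isAlgebraic (⟨z, hz⟩ : ℓ))
  refine isRuled_of_eq_sup ℓ (x := θ) ?_ ?_
  · intro hθ
    apply hx
    rw [hxe]
    exact ((hθ.pow 2).sub (alg l hl)).div (alg l' hl')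
  · apply le_antisymm
    · refine sup_le (sup_le le_sup_left ?_) le_sup_right
      rw [IntermediateField.adjoin_simple_le_iff, hxe]
      have h1 : ℓ ≤ ℓ ⊔ IntermediateField.adjoin k {θ} := le_sup_left
      have h2 : IntermediateField.adjoin k {θ} ≤ ℓ ⊔ IntermediateField.adjoin k {θ} := le_sup_right
      exact div_mem (sub_mem (pow_mem (h2 (IntermediateField.mem_adjoin_simple_self k θ)) 2)
        (h1 hl)) (h1 hl')
    · exact sup_le (le_sup_left.trans le_sup_left) le_sup_right

theorem sup_adjoin_mul_eq {M : IntermediateField k κ} {m : κ} (hm : m ∈ M) (hm0 : m ≠ 0) :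
    M ⊔ IntermediateField.adjoin k {θ} = M ⊔ IntermediateField.adjoin k {θ * m} := by
  have h1 : M ≤ M ⊔ IntermediateField.adjoin k {θ} := le_sup_left
  have h2 : IntermediateField.adjoin k {θ} ≤ M ⊔ IntermediateField.adjoin k {θ} := le_sup_right
  have h3 : M ≤ M ⊔ IntermediateField.adjoin k {θ * m} := le_sup_left
  have h4 : IntermediateField.adjoin k {θ * m} ≤ M ⊔ IntermediateField.adjoin k {θ * m} :=
    le_sup_right
  apply le_antisymm <;> refine sup_le le_sup_left ?_ <;>
    rw [IntermediateField.adjoin_simple_le_iff]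
  · have := div_mem (h4 (IntermediateField.mem_adjoin_simple_self k (θ * m))) (h3 hm)
    rwa [mul_div_cancel_right₀ _ hm0] at this
  · exact mul_mem (h2 (IntermediateField.mem_adjoin_simple_self k θ)) (h1 hm)

/-- Multiplying θ by a power of x reduces r to 0 or 1. For 0, θ becomes algebraic and only the
constant field grows; for 1, the linear case applies. -/
theorem isRuled_of_sq_eq_monomial [FiniteDimensional k ℓ] (hx : Transcendental k x) {l : κ}
    (hl : l ∈ ℓ) (hl0 : l ≠ 0) {r : ℤ} (h : θ ^ 2 = l * x ^ r) :
    IsRuled k (ℓ ⊔ IntermediateField.adjoin k {x} ⊔ IntermediateField.adjoin k {θ} :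
      IntermediateField k κ) := by
  have hx0 : x ≠ 0 := by
    rintro rfl
    exact hx isAlgebraic_zero
  have hxmem : x ∈ ℓ ⊔ IntermediateField.adjoin k {x} :=
    (le_sup_right : IntermediateField.adjoin k {x} ≤ _) (IntermediateField.mem_adjoin_simple_self k x)
  have hpow : ∀ s : ℤ, (θ * x ^ (-s)) ^ 2 = l * x ^ (r - 2 * s) := by
    intro s
    rw [mul_pow, h, ← zpow_natCast, ← zpow_mul, mul_assoc, ← zpow_add₀ hx0]
    congr 2
    push_cast
    ring
  obtain ⟨s, rfl | rfl⟩ := Int.even_or_odd' r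
  · have h1 := hpow s
    rw [sub_self, zpow_zero, mul_one] at h1
    rw [sup_adjoin_mul_eq (zpow_mem hxmem (-s)) (zpow_ne_zero _ hx0), sup_right_comm]
    have hθ : IsAlgebraic k (θ * x ^ (-s)) := by
      refine IsAlgebraic.of_pow (n := 2) two_pos ?_
      rw [h1]
      exact IntermediateField.isAlgebraic_iff.1
        ((Algebra.IsAlgebraic.of_finite k ℓ).isAlgebraic (⟨l, hl⟩ : ℓ))
    have : FiniteDimensional k (IntermediateField.adjoin k {θ * x ^ (-s)}) :=
      IntermediateField.adjoin.finiteDimensional hθ.isIntegral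
    exact isRuled_of_eq_sup (ℓ ⊔ IntermediateField.adjoin k {θ * x ^ (-s)}) hx rfl
  · have h1 := hpow s
    rw [add_sub_cancel_left, zpow_one] at h1
    rw [sup_adjoin_mul_eq (zpow_mem hxmem (-s)) (zpow_ne_zero _ hx0)]
    exact isRuled_of_sq_eq_linear hx ℓ.zero_mem hl hl0 (by rw [h1, zero_add])

end RuledQuadratic

/-! ### Shapes of f(X) that force a ruled residue field -/

section Good

variable {E L : Type*} [Field E] [Field L] [Algebra E L] {v : ValuationSubring E} {w : ValExt v L}
  {X a d Q κ q : L}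

theorem Frame.exists_val_monomial (h : Frame w X a Q κ q) {y : L}
    (hy : y ∈ IntermediateField.adjoin E {X}) (hy0 : y ≠ 0) :
    ∃ c ∈ IntermediateField.adjoin E {a}, c ≠ 0 ∧ ∃ j : ℤ,
      w.ring.valuation y = w.ring.valuation (c * Q ^ j) := by
  obtain ⟨e, b, hg⟩ := h.exists_generator
  have hQ0 := h.ne_zero
  obtain ⟨g, g', rfl⟩ := (IntermediateField.mem_adjoin_simple_iff E y).1 hy
  have hg0 : g ≠ 0 := by
    rintro rfl
    simp at hy0
  have hg'0 : g' ≠ 0 := by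
    rintro rfl
    simp at hy0
  obtain ⟨c, hc, j, u, hu, hu1, -⟩ := h.exists_monomial_mul hg hg0
  obtain ⟨c', hc', j', u', hu', hu1', -⟩ := h.exists_monomial_mul hg hg'0
  have e1 : aeval X g / aeval X g' = c / c' * Q ^ (j - j') * (u * u'⁻¹) := by
    rw [hu, hu', zpow_sub₀ hQ0]
    have := zpow_ne_zero j' hQ0
    field_simp
  refine ⟨c / c', div_mem hc hc', ?_, j - j', ?_⟩
  · rw [e1] at hy0
    exact left_ne_zero_of_mul (left_ne_zero_of_mul hy0)
  · rw [e1, map_mul, map_mul _ u, map_inv₀, hu1, hu1', inv_one, one_mul, mul_one]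

/-- Independence of the scaling of the square root. -/
theorem sup_adjoin_residue_div_eq {K : IntermediateField E L} {Y g g' : L} (hg : g ∈ K)
    (hg' : g' ∈ K) (hY0 : Y ≠ 0) (hgY : w.ring.valuation g = w.ring.valuation Y)
    (hgY' : w.ring.valuation g' = w.ring.valuation Y) :
    resField w K ⊔ IntermediateField.adjoin (Res v) {residue w.ring (Y / g)} =
      resField w K ⊔ IntermediateField.adjoin (Res v) {residue w.ring (Y / g')} := by
  have hYv : w.ring.valuation Y ≠ 0 := (Valuation.ne_zero_iff _).2 hY0
  have hg0 : g ≠ 0 := by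
    rw [← Valuation.ne_zero_iff w.ring.valuation, hgY]
    exact hYv
  have hgg : w.ring.valuation (g / g') = 1 := by rw [map_div₀, hgY, hgY', div_self hYv]
  have hYg : w.ring.valuation (Y / g) = 1 := by rw [map_div₀, hgY, div_self hYv]
  have e : Y / g' = Y / g * (g / g') := by field_simp
  rw [e, residue_mul _ (mem_of_val_eq_one _ hYg) (mem_of_val_eq_one _ hgg)]
  exact sup_adjoin_mul_eq (residue_mem_resField w (div_mem hg hg')) ((residue_ne_zero_iff _).2 hgg)

/-- If `Y ^ 2` is close to a monomial, then the residue field is ruled. -/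
theorem Frame.isRuled_of_near_monomial (h : Frame w X a Q κ q) {c Y g : L} {j : ℤ}
    (hc : c ∈ IntermediateField.adjoin E {a}) (hY : Near w.ring (Y ^ 2) (c * Q ^ j))
    (hg : g ∈ IntermediateField.adjoin E {X}) (hgY : w.ring.valuation g = w.ring.valuation Y) :
    IsRuled (Res v) (resField w (IntermediateField.adjoin E {X}) ⊔
      IntermediateField.adjoin (Res v) {residue w.ring (Y / g)} :
        IntermediateField (Res v) (Res w.ring)) := by
  have hQ0 := h.ne_zero
  have hY0 : Y ≠ 0 := by
    rintro rfl
    exact hY.left_ne_zero (by simp)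
  have hYv : w.ring.valuation Y ≠ 0 := (Valuation.ne_zero_iff _).2 hY0
  have hg0 : g ≠ 0 := by
    rw [← Valuation.ne_zero_iff w.ring.valuation, hgY]
    exact hYv
  -- Exchange g for an element of E(X) near a monomial of the same value; then (Y/g)^2 is near a
  -- monomial of value 1.
  obtain ⟨c', hc', hc'0, j', hval⟩ := h.exists_val_monomial hg hg0
  obtain ⟨c'', hc'', hn⟩ := h.approx c' hc' hc'0
  have hn' := hn.symm.mul (near_refl (A := w.ring) (zpow_ne_zero j' hQ0))
  rw [sup_adjoin_residue_div_eq hg (mul_mem hc'' (zpow_mem h.mem j')) hY0 hgY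
    (by rw [hn'.val_eq, ← hval, hgY])]
  have h1 : w.ring.valuation (Y / (c'' * Q ^ j')) = 1 := by
    rw [map_div₀, hn'.val_eq, ← hval, hgY, div_self hYv]
  have e1 : c * Q ^ j / (c' * Q ^ j') ^ 2 = c / c' ^ 2 * Q ^ (j - 2 * j') := by
    rw [zpow_sub₀ hQ0, mul_comm 2 j', zpow_mul]
    have := zpow_ne_zero j' hQ0
    have e2 : (Q ^ j') ^ (2 : ℤ) = (Q ^ j') ^ 2 := zpow_natCast _ 2
    rw [e2]
    field_simp
  have hn2 := hY.div (hn'.pow 2)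
  rw [e1, ← div_pow] at hn2
  have hv : w.ring.valuation (c / c' ^ 2 * Q ^ (j - 2 * j')) = 1 := by
    rw [← hn2.val_eq, map_pow, h1, one_pow]
  obtain ⟨e, b, hgen⟩ := h.exists_generator
  obtain ⟨r, -, l, hl, hl0, hres⟩ := hgen.residue_monomial (div_mem hc (pow_mem hc' 2)) hv
  rw [← hn2.residue_eq, residue_pow _ (mem_of_val_eq_one _ h1)] at hres
  have := h.finiteDimensional
  rw [h.resField_eq hgen]
  exact isRuled_of_sq_eq_monomial (h.transcendental_generator hgen) hl hl0 hres

/-- If `Y ^ 2` is close to a balanced linear expression in `Q`, then the residue field is ruled. -/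
theorem Frame.isRuled_of_near_linear (h : Frame w X a Q κ q) {c c₁ Y g : L}
    (hc : c ∈ IntermediateField.adjoin E {a}) (hc₁ : c₁ ∈ IntermediateField.adjoin E {a})
    (hY : Near w.ring (Y ^ 2) (c + c₁ * Q))
    (hcv : w.ring.valuation c = w.ring.valuation (Y ^ 2))
    (hc₁v : w.ring.valuation (c₁ * Q) = w.ring.valuation (Y ^ 2))
    (hg : g ∈ IntermediateField.adjoin E {X}) (hgY : w.ring.valuation g = w.ring.valuation Y) :
    IsRuled (Res v) (resField w (IntermediateField.adjoin E {X}) ⊔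
      IntermediateField.adjoin (Res v) {residue w.ring (Y / g)} :
        IntermediateField (Res v) (Res w.ring)) := by
  have hQ0 := h.ne_zero
  have hY0 : Y ≠ 0 := by
    rintro rfl
    exact hY.left_ne_zero (by simp)
  have hYv : w.ring.valuation Y ≠ 0 := (Valuation.ne_zero_iff _).2 hY0
  have hYv2 : w.ring.valuation (Y ^ 2) ≠ 0 := (Valuation.ne_zero_iff _).2 (pow_ne_zero 2 hY0)
  have hg0 : g ≠ 0 := by
    rw [← Valuation.ne_zero_iff w.ring.valuation, hgY]
    exact hYv
  have hc0 : c ≠ 0 := by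
    rw [← Valuation.ne_zero_iff w.ring.valuation, hcv]
    exact hYv2
  have hc₁0 : c₁ ≠ 0 := by
    rintro rfl
    rw [zero_mul, map_zero] at hc₁v
    exact hYv2 hc₁v.symm
  -- Balance of the two terms makes |Q| a value of E(a), so g may be exchanged for an element of
  -- E(X) near a constant m of E(a).
  have hQv : w.ring.valuation Q = w.ring.valuation (c / c₁) := by
    rw [map_div₀, hcv, ← hc₁v, map_mul,
      mul_div_cancel_left₀ _ ((Valuation.ne_zero_iff _).2 hc₁0)]
  obtain ⟨c', hc', hc'0, j', hval⟩ := h.exists_val_monomial hg hg0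
  set m := c' * (c / c₁) ^ j' with hm
  have hmmem : m ∈ IntermediateField.adjoin E {a} := mul_mem hc' (zpow_mem (div_mem hc hc₁) _)
  have hm0 : m ≠ 0 := mul_ne_zero hc'0 (zpow_ne_zero _ (div_ne_zero hc0 hc₁0))
  have hmv : w.ring.valuation m = w.ring.valuation Y := by
    rw [hm, map_mul, map_zpow₀, ← hQv, ← map_zpow₀, ← map_mul, ← hval, hgY]
  obtain ⟨m', hm', hn⟩ := h.approx m hmmem hm0
  rw [sup_adjoin_residue_div_eq hg hm' hY0 hgY (by rw [← hn.val_eq, hmv])]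
  have h1 : w.ring.valuation (Y / m') = 1 := by
    rw [map_div₀, ← hn.val_eq, hmv, div_self hYv]
  have hn2 := hY.div (hn.symm.pow 2)
  have e1 : (c + c₁ * Q) / m ^ 2 = c / m ^ 2 + c₁ / m ^ 2 * Q ^ (1 : ℤ) := by
    rw [zpow_one]
    field_simp
  rw [e1, ← div_pow] at hn2
  have hv : w.ring.valuation (c / m ^ 2) = 1 := by
    rw [map_div₀, hcv, map_pow, map_pow, hmv, ← map_pow, div_self hYv2]
  have hv1 : w.ring.valuation (c₁ / m ^ 2 * Q ^ (1 : ℤ)) = 1 := by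
    rw [zpow_one, div_mul_eq_mul_div, map_div₀, hc₁v, map_pow, map_pow, hmv, ← map_pow,
      div_self hYv2]
  obtain ⟨e, b, hgen⟩ := h.exists_generator
  obtain ⟨r, hr, l, hl, hl0, hres⟩ := hgen.residue_monomial (div_mem hc₁ (pow_mem hmmem 2)) hv1
  have hres2 : residue w.ring (Y / m') ^ 2 = residue w.ring (c / m ^ 2) +
      l * residue w.ring (b * Q ^ e) ^ r := by
    rw [← residue_pow _ (mem_of_val_eq_one _ h1), hn2.residue_eq,
      residue_add _ (mem_of_val_eq_one _ hv) (mem_of_val_eq_one _ hv1), hres]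
  have hcm := residue_mem_resField w (div_mem hc (pow_mem hmmem 2))
  have := h.finiteDimensional
  have hx := h.transcendental_generator hgen
  rw [h.resField_eq hgen]
  -- From 1 = e r the exponent r is 1 or -1; in the second case the inverse generator serves.
  rcases Int.isUnit_iff.1 (IsUnit.of_mul_eq_one _ ((mul_comm r e).trans hr.symm)) with rfl | rfl
  · rw [zpow_one] at hres2
    exact isRuled_of_sq_eq_linear hx hcm hl hl0 hres2
  · rw [zpow_neg_one] at hres2
    have hx' : Transcendental (Res v) (residue w.ring (b * Q ^ e))⁻¹ := fun hcon =>
      hx (by simpa using hcon.inv)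
    have h2 := isRuled_of_sq_eq_linear hx' hcm hl hl0 hres2
    have h3 : IntermediateField.adjoin (Res v) {(residue w.ring (b * Q ^ e))⁻¹} =
        IntermediateField.adjoin (Res v) {residue w.ring (b * Q ^ e)} := by
      apply le_antisymm <;> rw [IntermediateField.adjoin_simple_le_iff]
      · exact inv_mem (IntermediateField.mem_adjoin_simple_self _ _)
      · have := inv_mem (IntermediateField.mem_adjoin_simple_self (Res v)
          (residue w.ring (b * Q ^ e))⁻¹)
        rwa [inv_inv] at this
    rwa [h3] at h2

/-- A polynomial with at most one root as close to `X` as possible is close to a monomial or to a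
balanced linear expression in `Q`. -/
theorem Frame.near_of_countP_le_one [IsAlgClosed L] (hc : IsCenter w X a d)
    (h : Frame w X a Q κ q)
    {ρ : (resField w (algebraicClosure E L))[X]} (hρ : 0 < ρ.natDegree)
    (hρq : residue w.ring q = aeval (residue w.ring ((X - a) / d)) ρ) {f : E[X]} (hf : f ≠ 0)
    (hcount : ∀ c c', {c, c'} ≤ f.aroots L → w.ring.valuation (X - c) = w.ring.valuation d →
      w.ring.valuation (X - c') ≠ w.ring.valuation d) :
    (∃ c ∈ IntermediateField.adjoin E {a}, ∃ j : ℤ, Near w.ring (aeval X f) (c * Q ^ j)) ∨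
    ∃ c ∈ IntermediateField.adjoin E {a}, ∃ c₁ ∈ IntermediateField.adjoin E {a},
      Near w.ring (aeval X f) (c + c₁ * Q) ∧
      w.ring.valuation c = w.ring.valuation (aeval X f) ∧
      w.ring.valuation (c₁ * Q) = w.ring.valuation (aeval X f) := by
  classical
  obtain ⟨μ, y, hμ, hμ0, hprod, hyA, ρf, hρf, hρfdeg, hres⟩ :=
    hc.exists_resPoly_prod (f.aroots L) fun c hc => isAlgebraic_of_mem_aroots hc
  -- The degree of ρf counts, with multiplicity, the roots of f at distance |d|.
  have hcount1 : ρf.natDegree ≤ 1 := by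
    rw [hρfdeg, Multiset.countP_eq_card_filter]
    by_contra! hlt
    obtain ⟨c, hcm⟩ := Multiset.card_pos_iff_exists_mem.1 (lt_trans zero_lt_one hlt)
    obtain ⟨t, ht⟩ := Multiset.exists_cons_of_mem hcm
    rw [ht, Multiset.card_cons] at hlt
    obtain ⟨c', hct⟩ := Multiset.card_pos_iff_exists_mem.1 (Nat.lt_of_succ_lt_succ hlt)
    have hc'm : c' ∈ (f.aroots L).filter
        fun c => w.ring.valuation (X - c) = w.ring.valuation d := by
      rw [ht]
      exact Multiset.mem_cons_of_mem hct
    refine hcount c c' ?_ (Multiset.mem_filter.1 hcm).2 (Multiset.mem_filter.1 hc'm).2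
    refine le_trans ?_ (Multiset.filter_le (fun c => w.ring.valuation (X - c) =
      w.ring.valuation d) _)
    rw [ht]
    exact Multiset.cons_le_cons c (Multiset.singleton_le.2 hct)
  set ν := algebraMap E L f.leadingCoeff * μ with hν
  have hfν : aeval X f = ν * y := by rw [aeval_eq_prod_sub, hprod, hν, mul_assoc]
  have hνalg : IsAlgebraic E ν := (isAlgebraic_algebraMap _).mul hμ
  have hτ := hc.trans.extendScalars (resField w (algebraicClosure E L))
  have hy1 : w.ring.valuation y = 1 := by
    rw [← residue_ne_zero_iff, hres]
    exact fun h0 => hρf.ne_zero (transcendental_iff.1 hτ _ h0)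
  have hfv : w.ring.valuation (aeval X f) = w.ring.valuation ν := by
    rw [hfν, map_mul, hy1, mul_one]
  obtain ⟨N, s, hs, hsn⟩ := h.expand f hf
  have hQ0 := h.ne_zero
  -- Pad the expansion with zeros so that the coefficients of index 0 and 1 are always in range.
  obtain ⟨b, hb, hn⟩ : ∃ b : ℕ → L, (∀ i, b i ∈ IntermediateField.adjoin E {a}) ∧
      Near w.ring (aeval X f) (∑ i ∈ Finset.range (N + 2), b i * Q ^ i) := by
    refine ⟨fun i => if i < N then s i else 0, fun i => ?_, ?_⟩
    · dsimp only
      split_ifs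
      · exact hs i
      · exact zero_mem _
    · convert hsn using 1
      symm
      refine Finset.sum_subset_zero_on_sdiff (Finset.range_subset_range.2 (by omega)) ?_ ?_
      · intro i hi
        dsimp only
        rw [if_neg (by simp at hi; omega), zero_mul]
      · intro i hi
        dsimp only
        rw [if_pos (Finset.mem_range.1 hi)]
  have halg : ∀ i, IsAlgebraic E (b i) := fun i => isAlgebraic_of_mem_adjoin h.alg (hb i)
  have hsum0 := hn.right_ne_zero
  obtain ⟨j, hj, hmax⟩ := (Finset.range (N + 2)).exists_max_image
    (fun i => w.ring.valuation (b i * Q ^ i)) ⟨0, by simp⟩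
  have heq : w.ring.valuation (∑ i ∈ Finset.range (N + 2), b i * Q ^ i) =
      w.ring.valuation (b j * Q ^ j) :=
    le_antisymm (Valuation.map_sum_le _ hmax) (val_term_le h.alg_scale h.eq_mul h.trans b halg _ hj)
  have hbj : b j * Q ^ j ≠ 0 := by
    rw [← Valuation.ne_zero_iff w.ring.valuation, ← heq]
    exact (Valuation.ne_zero_iff _).2 hsum0
  have hκ0 := h.scale_ne_zero
  have hbj0 : b j * κ ^ j ≠ 0 := mul_ne_zero (left_ne_zero_of_mul hbj) (pow_ne_zero j hκ0)
  have hvκ : ∀ i, w.ring.valuation (b i * κ ^ i) = w.ring.valuation (b i * Q ^ i) := fun i => by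
    rw [map_mul, map_mul, map_pow, map_pow, h.val_eq]
  have hqv := val_eq_one_of_transcendental w h.trans
  have hβmem : ∀ i, b i * κ ^ i / (b j * κ ^ j) ∈ algebraicClosure E L := fun i => by
    rw [mem_algebraicClosure_iff]
    exact ((halg i).mul (h.alg_scale.pow i)).div ((halg j).mul (h.alg_scale.pow j))
  let β : ℕ → algebraicClosure E L := fun i => ⟨_, hβmem i⟩
  have hβint : ∀ i ∈ Finset.range (N + 2), (β i : L) ∈ w.ring := by
    intro i hi
    rw [← w.ring.valuation_le_one_iff]
    change w.ring.valuation (b i * κ ^ i / (b j * κ ^ j)) ≤ 1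
    rw [map_div₀, hvκ, hvκ]
    exact div_le_one_of_le₀ (hmax i hi) zero_le
  set B := resPoly w β (Finset.range (N + 2)) with hB
  have hBσ : aeval (residue w.ring q) B = residue w.ring (ν / (b j * κ ^ j)) *
      aeval (residue w.ring ((X - a) / d)) ρf := by
    rw [hB, aeval_resPoly w β _ hβint (mem_of_val_eq_one _ hqv), ← hres]
    have e1 : ∑ i ∈ Finset.range (N + 2), (β i : L) * q ^ i =
        (∑ i ∈ Finset.range (N + 2), b i * Q ^ i) / (b j * κ ^ j) := by
      rw [Finset.sum_div]
      refine Finset.sum_congr rfl fun i _ => ?_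
      change b i * κ ^ i / (b j * κ ^ j) * q ^ i = _
      rw [h.eq_mul, mul_pow]
      ring
    have hνv : w.ring.valuation (ν / (b j * κ ^ j)) = 1 := by
      rw [map_div₀, hvκ, ← heq, ← hn.val_eq, ← hfv,
        div_self ((Valuation.ne_zero_iff _).2 hn.left_ne_zero)]
    rw [e1, ← (hn.div (near_refl hbj0)).residue_eq, hfν, mul_div_right_comm,
      residue_mul _ (mem_of_val_eq_one _ hνv) hyA]
  have hmmem : ν / (b j * κ ^ j) ∈ algebraicClosure E L := by
    rw [mem_algebraicClosure_iff]
    exact hνalg.div ((halg j).mul (h.alg_scale.pow j))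
  -- Both sides express the residue of f(X), suitably scaled, in the transcendental residue of (X -
  -- a)/d, so they agree as polynomials; this bounds deg B · deg ρ by 1.
  have hcomp : B.comp ρ = C ⟨_, residue_mem_resField w hmmem⟩ * ρf := by
    apply transcendental_iff_injective.1 hτ
    rw [aeval_comp, ← hρq, hBσ, map_mul, aeval_C]
    rfl
  have hBdeg : B.natDegree ≤ 1 := by
    have h1 : B.natDegree * ρ.natDegree ≤ 1 := by
      rw [← natDegree_comp, hcomp]
      exact (natDegree_C_mul_le _ _).trans hcount1
    exact (Nat.le_mul_of_pos_right _ hρ).trans h1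
  -- The reduced coefficients of index at least 2 vanish, so only b 0 + b 1 * Q matters.
  have hsmall : ∀ i ∈ Finset.range N,
      w.ring.valuation (b (i + 2) * Q ^ (i + 2)) < w.ring.valuation (b j * Q ^ j) := by
    intro i hi
    have hi2 : i + 2 ∈ Finset.range (N + 2) := by simpa using hi
    have h1 := coeff_resPoly w β (Finset.range (N + 2)) (i + 2)
    rw [← hB, coeff_eq_zero_of_natDegree_lt (by omega), if_pos hi2] at h1
    have h2 := (residue_eq_zero_iff _ (hβint _ hi2)).1 h1.symm
    change w.ring.valuation (b (i + 2) * κ ^ (i + 2) / (b j * κ ^ j)) < 1 at h2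
    rwa [map_div₀, hvκ, hvκ, div_lt_one₀ ((Valuation.pos_iff _).2 hbj)] at h2
  have hpos : 0 < w.ring.valuation (b j * Q ^ j) := (Valuation.pos_iff _).2 hbj
  have hn2 : Near w.ring (b 0 + b 1 * Q) (aeval X f) := by
    refine Near.trans ?_ hn.symm
    have e2 : b 0 + b 1 * Q - ∑ i ∈ Finset.range (N + 2), b i * Q ^ i =
        -∑ i ∈ Finset.range N, b (i + 2) * Q ^ (i + 2) := by
      rw [Finset.sum_range_succ', Finset.sum_range_succ', zero_add]
      ring
    rw [Near, e2, Valuation.map_neg, heq]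
    exact Valuation.map_sum_lt _ hpos.ne' hsmall
  have hjv : w.ring.valuation (aeval X f) = w.ring.valuation (b j * Q ^ j) := by
    rw [hn.val_eq, heq]
  have h0 : w.ring.valuation (b 0) ≤ w.ring.valuation (aeval X f) := by
    simpa [hjv] using hmax 0 (by simp)
  have h1 : w.ring.valuation (b 1 * Q) ≤ w.ring.valuation (aeval X f) := by
    simpa [hjv] using hmax 1 (by simp)
  rcases h0.lt_or_eq with h0 | h0
  · left
    refine ⟨b 1, hb 1, 1, hn2.symm.trans ?_⟩
    rw [zpow_one]
    refine Near.symm ?_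
    rw [Near, sub_add_cancel_right, Valuation.map_neg, hn2.val_eq]
    exact h0
  · rcases h1.lt_or_eq with h1 | h1
    · left
      refine ⟨b 0, hb 0, 0, hn2.symm.trans ?_⟩
      rw [zpow_zero, mul_one]
      refine Near.symm ?_
      rw [Near, sub_add_cancel_left, Valuation.map_neg, hn2.val_eq]
      exact h1
    · exact Or.inr ⟨b 0, hb 0, b 1, hb 1, hn2.symm, h0, h1⟩

end Good

end HyperellipticResidue

namespace HyperellipticResidue

open Polynomial

/-! ### Minimal indices and the integer e_S -/

section MinIndices

variable {E F : Type*} [Field E] [Field F] [Algebra E F] {v : ValuationSubring E} {w : ValExt v F}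
  {f : E[X]} {X : F}

theorem val_term_le_termValue {i : ℕ} (hi : i ∈ Finset.range (f.natDegree + 1)) :
    w.ring.valuation (algebraMap E F (f.coeff i) * X ^ i) ≤ termValue w f X :=
  Finset.le_sup' (fun i => w.ring.valuation (algebraMap E F (f.coeff i) * X ^ i)) hi

theorem mem_minIndices : ∀ {i : ℕ}, i ∈ minIndices w f X ↔ i ∈ Finset.range (f.natDegree + 1) ∧
    w.ring.valuation (algebraMap E F (f.coeff i) * X ^ i) = termValue w f X := by
  intro i
  rw [minIndices, Finset.mem_filter]

theorem mem_minIndices_iff {i : ℕ} : i ∈ minIndices w f X ↔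
    i ∈ Finset.range (f.natDegree + 1) ∧ ∀ j ∈ Finset.range (f.natDegree + 1),
      w.ring.valuation (algebraMap E F (f.coeff j) * X ^ j) ≤
        w.ring.valuation (algebraMap E F (f.coeff i) * X ^ i) := by
  rw [mem_minIndices]
  refine and_congr_right fun hi => ⟨fun h j hj => h ▸ val_term_le_termValue hj, fun h => ?_⟩
  exact le_antisymm (val_term_le_termValue hi) (Finset.sup'_le _ _ h)

theorem minIndices_nonempty : (minIndices w f X).Nonempty := by
  obtain ⟨i, hi, h⟩ := Finset.exists_mem_eq_sup' Finset.nonempty_range_add_one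
    (fun i => w.ring.valuation (algebraMap E F (f.coeff i) * X ^ i))
    (s := Finset.range (f.natDegree + 1))
  exact ⟨i, mem_minIndices.2 ⟨hi, h.symm⟩⟩

theorem termValue_ne_zero (hf : f ≠ 0) (hX : X ≠ 0) : termValue w f X ≠ 0 := by
  have h := val_term_le_termValue (w := w) (X := X) (Finset.self_mem_range_succ f.natDegree)
  intro h0
  rw [h0, le_zero_iff, map_eq_zero] at h
  have h1 : f.leadingCoeff ≠ 0 := leadingCoeff_ne_zero.2 hf
  exact mul_ne_zero (by simpa using h1) (pow_ne_zero _ hX) h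

theorem term_ne_zero_of_mem (hf : f ≠ 0) (hX : X ≠ 0) {i : ℕ} (hi : i ∈ minIndices w f X) :
    algebraMap E F (f.coeff i) * X ^ i ≠ 0 := by
  rw [← Valuation.ne_zero_iff w.ring.valuation, (mem_minIndices.1 hi).2]
  exact termValue_ne_zero hf hX

theorem dvd_gap {S : Finset ℕ} {i : ℕ} (hi : i ∈ S) : gapGcd S ∣ i - firstIndex S :=
  Finset.gcd_dvd (f := fun i => i - firstIndex S) hi

theorem gapGcd_pos_and_le {S : Finset ℕ} (hcard : 2 ≤ S.card) {n : ℕ}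
    (hS : S ⊆ Finset.range (n + 1)) : 0 < gapGcd S ∧ gapGcd S ≤ n := by
  have hne : S.Nonempty := Finset.card_pos.1 (by omega)
  obtain ⟨i, hi, hi0⟩ := Finset.exists_mem_ne hcard (firstIndex S)
  have hlt : firstIndex S < i := lt_of_le_of_ne (firstIndex_le hi) (Ne.symm hi0)
  have hd := dvd_gap hi
  have hin := Finset.mem_range.1 (hS hi)
  refine ⟨Nat.pos_of_dvd_of_pos hd (by omega), (Nat.le_of_dvd (by omega) hd).trans (by omega)⟩

theorem orderModValueGp_dvd (b : Eˣ) {d : ℕ} (hd : 0 < d) : orderModValueGp v b d ∣ d := by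
  rw [orderModValueGp]
  apply addOrderOf_dvd_of_nsmul_eq_zero
  rw [← QuotientAddGroup.mk_nsmul, QuotientAddGroup.eq_zero_iff]
  refine ⟨val v b, ?_⟩
  rw [← Nat.cast_smul_eq_nsmul ℚ, smul_smul, mul_inv_cancel₀ (by positivity), one_smul]

/-- Additively, e v(b)/d lies in vE, so it is some v(c). Multiplying by d and using that vE embeds
in its divisible hull gives e v(b) = d v(c). -/
theorem exists_val_pow_eq_orderModValueGp (b : Eˣ) {d : ℕ} (hd : 0 < d) :
    ∃ c : Eˣ, v.valuation (b : E) ^ orderModValueGp v b d = v.valuation (c : E) ^ d := by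
  set e := orderModValueGp v b d with he
  have h1 := addOrderOf_nsmul_eq_zero (QuotientAddGroup.mk
    ((d : ℚ)⁻¹ • DivisibleHull.coeAddMonoidHom (ValueGp v) (val v b)) :
    DivisibleHull (ValueGp v) ⧸ (DivisibleHull.coeAddMonoidHom (ValueGp v)).range)
  change e • _ = _ at h1
  rw [← QuotientAddGroup.mk_nsmul, QuotientAddGroup.eq_zero_iff] at h1
  obtain ⟨γ, hγ⟩ := h1
  have h2 : DivisibleHull.coeAddMonoidHom (ValueGp v) (d • γ) =
      DivisibleHull.coeAddMonoidHom (ValueGp v) (e • val v b) := by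
    rw [map_nsmul, map_nsmul, hγ, smul_comm d e, ← Nat.cast_smul_eq_nsmul ℚ d, smul_smul,
      mul_inv_cancel₀ (by positivity), one_smul]
  have h3 : d • γ = e • val v b := DivisibleHull.coe_injective h2
  obtain ⟨c, hc⟩ := v.valuation_surjective (γ.toMul : v.ValueGroup)
  have hc0 : c ≠ 0 := by
    rintro rfl
    rw [map_zero] at hc
    exact γ.toMul.ne_zero hc.symm
  refine ⟨Units.mk0 c hc0, ?_⟩
  have h4 := congrArg (fun z : ValueGp v => (z.toMul : v.ValueGroup)) h3
  simp only [toMul_nsmul, Units.val_pow_eq_pow_val] at h4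
  rw [Units.val_mk0, hc, h4]
  rfl

/-- The defining properties of `e_S`. -/
theorem eS_spec (hf : f ≠ 0) (hX : X ≠ 0) (hw : w ∈ resTrans v F)
    (hcard : 2 ≤ (minIndices w f X).card) :
    eS v f X (minIndices w f X) ∣ gapGcd (minIndices w f X) ∧
    ∃ c : E, w.ring.valuation
      (algebraMap E F c * X ^ eS v f X (minIndices w f X)) = 1 := by
  set S := minIndices w f X with hS
  have hne : S.Nonempty := Finset.card_pos.1 (by omega)
  have hd := (gapGcd_pos_and_le hcard (n := f.natDegree) (fun i hi => (mem_minIndices.1 hi).1)).1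
  refine ⟨orderModValueGp_dvd _ hd, ?_⟩
  obtain ⟨c, hc⟩ := exists_val_pow_eq_orderModValueGp (v := v) (scale v f X S) hd
  have hb := isScale_scale v hf hX hne w ⟨hw, hS.symm⟩
  refine ⟨c, ?_⟩
  change v.valuation _ ^ eS v f X S = _ at hc
  have hc' : w.ring.valuation (algebraMap E F (scale v f X S : E)) ^ eS v f X S =
      w.ring.valuation (algebraMap E F (c : E)) ^ gapGcd S := by
    have h1 : v.valuation ((scale v f X S : E) ^ eS v f X S / (c : E) ^ gapGcd S) = 1 := by
      rw [map_div₀, map_pow, map_pow, hc, div_self]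
      exact pow_ne_zero _ ((Valuation.ne_zero_iff _).2 c.ne_zero)
    have h2 : w.ring.valuation (algebraMap E F
        ((scale v f X S : E) ^ eS v f X S / (c : E) ^ gapGcd S)) = 1 := by
      apply le_antisymm
      · exact (w.ring.valuation_le_one_iff _).2 (w.algebraMap_mem_iff.2 (mem_of_val_eq_one v h1))
      · have h3 := (w.ring.valuation_le_one_iff _).2 (w.algebraMap_mem_iff.2
          (mem_of_val_eq_one v (val_inv_eq_one v h1)))
        rw [map_inv₀, map_inv₀] at h3
        have h4 : 0 < w.ring.valuation (algebraMap E F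
            ((scale v f X S : E) ^ eS v f X S / (c : E) ^ gapGcd S)) :=
          (Valuation.pos_iff _).2 (by simp)
        exact (inv_le_one₀ h4).1 h3
    rw [map_div₀, map_div₀, map_pow, map_pow, map_pow, map_pow] at h2
    exact (div_eq_one_iff_eq (pow_ne_zero _ ((Valuation.ne_zero_iff _).2
      (by simp)))).1 h2
  -- With e = e_S and b the chosen scale, (cX^e)^d has the value of (bX^d)^e, which is 1; the value
  -- group is torsion-free.
  have h5 : w.ring.valuation (algebraMap E F (c : E) * X ^ eS v f X S) ^ gapGcd S = 1 := by
    rw [map_mul, mul_pow, ← hc', map_pow, pow_right_comm, ← mul_pow, ← map_pow, ← map_mul, hb, one_pow]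
  exact (pow_eq_one_iff_of_nonneg zero_le hd.ne').1 h5

end MinIndices

/-! ### Roots near X and double roots of the residue polynomial -/

section Newton

variable {E L : Type*} [Field E] [Field L] [Algebra E L] {v : ValuationSubring E} {w : ValExt v L}
  {f : E[X]} {X : L}

/-- If two roots of `f` are close to `X`, then the leading terms of `f(X)` and of `X f'(X)`
cancel. -/
theorem sum_residue_eq_zero_of_roots (hf : f ≠ 0) (hX : X ≠ 0) {N : L}
    (hNv : w.ring.valuation N = termValue w f X) {α β : L} (hroots : {α, β} ≤ f.aroots L)
    (hα : w.ring.valuation (X - α) < w.ring.valuation X)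
    (hβ : w.ring.valuation (X - β) < w.ring.valuation X) :
    ∑ i ∈ minIndices w f X, residue w.ring (algebraMap E L (f.coeff i) * X ^ i / N) = 0 ∧
    ∑ i ∈ minIndices w f X, (i : Res w.ring) *
      residue w.ring (algebraMap E L (f.coeff i) * X ^ i / N) = 0 := by
  classical
  have hint : ∀ i, algebraMap E L (f.coeff i) * X ^ i / N ∈ w.ring := by
    intro i
    by_cases hi : i ∈ Finset.range (f.natDegree + 1)
    · rw [← w.ring.valuation_le_one_iff, map_div₀, hNv]
      exact div_le_one_of_le₀ (val_term_le_termValue hi) zero_le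
    · rw [coeff_eq_zero_of_natDegree_lt (by simp at hi; omega)]
      simp
  -- G is f(XT)/N as a polynomial in T. Its coefficients are integral because |N| is the largest
  -- value of a term, and roots γ of f become roots γ/X of G.
  set G : w.ring[X] := ∑ i ∈ Finset.range (f.natDegree + 1), monomial i ⟨_, hint i⟩ with hG
  have hGc : ∀ i, ((G.coeff i : w.ring) : L) = algebraMap E L (f.coeff i) * X ^ i / N := by
    intro i
    simp only [hG, finsetSum_coeff, coeff_monomial]
    rw [Finset.sum_ite_eq' _ i]
    split_ifs with hi
    · rfl
    · rw [coeff_eq_zero_of_natDegree_lt (by simp at hi; omega)]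
      simp
  have hGmap : G.map w.ring.subtype =
      C N⁻¹ * (f.map (algebraMap E L)).comp (C X * Polynomial.X) := by
    ext i
    rw [coeff_map, coeff_C_mul, comp_C_mul_X_coeff, coeff_map]
    change ((G.coeff i : w.ring) : L) = _
    rw [hGc]
    ring
  have unit_of : ∀ γ : L, w.ring.valuation (X - γ) < w.ring.valuation X →
      ∃ h : γ / X ∈ w.ring, IsLocalRing.residue w.ring ⟨γ / X, h⟩ = 1 := by
    intro γ hγ
    have h1 : Near w.ring γ X := by rwa [Near, Valuation.map_sub_swap]
    have h2 := h1.div (near_refl hX)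
    rw [div_self hX] at h2
    have h3 : γ / X ∈ w.ring := mem_of_val_eq_one _ (by rw [h2.val_eq, map_one])
    exact ⟨h3, by rw [← residue_of_mem, h2.residue_eq, residue_one]⟩
  obtain ⟨hαm, hα1⟩ := unit_of α hα
  obtain ⟨hβm, hβ1⟩ := unit_of β hβ
  have hdvd : (Polynomial.X - C α) * (Polynomial.X - C β) ∣ f.map (algebraMap E L) := by
    have := (Multiset.prod_X_sub_C_dvd_iff_le_roots
      (Polynomial.map_ne_zero hf : f.map (algebraMap E L) ≠ 0) {α, β}).2 hroots
    simpa using this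
  obtain ⟨g, hg⟩ := hdvd
  have hfac : ∀ γ : L, C X * Polynomial.X - C γ = C X * (Polynomial.X - C (γ / X)) := by
    intro γ
    rw [mul_sub, ← C_mul, mul_div_cancel₀ _ hX]
  -- Division by a monic polynomial descends from L to the valuation ring. As α/X and β/X have
  -- residue 1, the reduction of G has a double zero at 1; α = β is covered because roots are
  -- counted with multiplicity.
  have hdvd2 : ((Polynomial.X - C (⟨α / X, hαm⟩ : w.ring)) *
      (Polynomial.X - C (⟨β / X, hβm⟩ : w.ring))) ∣ G := by
    rw [← map_dvd_map w.ring.subtype Subtype.val_injective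
      ((monic_X_sub_C _).mul (monic_X_sub_C _)), hGmap, hg]
    refine ⟨C N⁻¹ * (C X * C X) * g.comp (C X * Polynomial.X), ?_⟩
    simp only [mul_comp, sub_comp, X_comp, C_comp, Polynomial.map_mul, Polynomial.map_sub, map_X,
      map_C]
    rw [hfac, hfac]
    change _ = (Polynomial.X - C (α / X)) * (Polynomial.X - C (β / X)) * _
    ring
  obtain ⟨H, hH⟩ := hdvd2
  have hres : G.map (IsLocalRing.residue w.ring) =
      (Polynomial.X - 1) * (Polynomial.X - 1) * H.map (IsLocalRing.residue w.ring) := by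
    rw [hH, Polynomial.map_mul, Polynomial.map_mul, Polynomial.map_sub, Polynomial.map_sub, map_X,
      map_C, map_C, hα1, hβ1, C_1]
  have hsumG : G.map (IsLocalRing.residue w.ring) = ∑ i ∈ minIndices w f X,
      monomial i (residue w.ring (algebraMap E L (f.coeff i) * X ^ i / N)) := by
    rw [hG, Polynomial.map_sum]
    simp only [map_monomial, ← residue_of_mem]
    symm
    apply Finset.sum_subset fun i hi => (mem_minIndices.1 hi).1
    intro i hi hi'
    rw [residue_eq_zero_of_lt, monomial_zero_right]
    rw [map_div₀, hNv, div_lt_one₀ (zero_lt_iff.2 (termValue_ne_zero hf hX))]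
    exact lt_of_le_of_ne (val_term_le_termValue hi) fun h => hi' (mem_minIndices.2 ⟨hi, h⟩)
  constructor
  · have h1 := congrArg (eval 1) (hsumG.symm.trans hres)
    simpa [eval_finsetSum] using h1
  · have h1 := congrArg (fun p => eval 1 (derivative p)) (hsumG.symm.trans hres)
    simp only [derivative_mul, derivative_sum, derivative_monomial, eval_finsetSum,
      eval_monomial, one_pow, mul_one, eval_add, eval_mul, eval_sub, eval_X, eval_one, sub_self,
      zero_mul, mul_zero, add_zero] at h1
    rw [← h1]
    exact Finset.sum_congr rfl fun i _ => mul_comm _ _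

/-- If `p_{S,f,c}` is separable, then at most one root of `f` is closer to `X` than `0`. -/
theorem not_two_roots (hf : f ≠ 0) (hX : X ≠ 0)
    (hsep : 2 ≤ (minIndices w f X).card → ∃ c : E, ∃ e : ℕ,
      w.ring.valuation (algebraMap E L c * X ^ e) = 1 ∧
      (residuePoly v f (minIndices w f X) e c).Separable ∧
      (∀ i ∈ minIndices w f X, e ∣ i - firstIndex (minIndices w f X)) ∧ (e : Res v) ≠ 0)
    {α β : L} (hroots : {α, β} ≤ f.aroots L)
    (hα : w.ring.valuation (X - α) < w.ring.valuation X) :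
    ¬ w.ring.valuation (X - β) < w.ring.valuation X := by
  intro hβ
  set S := minIndices w f X with hS
  have hi₀ : firstIndex S ∈ S := mem_firstIndex minIndices_nonempty
  set i₀ := firstIndex S
  set N := algebraMap E L (f.coeff i₀) * X ^ i₀ with hN
  have hN0 : N ≠ 0 := term_ne_zero_of_mem hf hX hi₀
  have hNv : w.ring.valuation N = termValue w f X := (mem_minIndices.1 hi₀).2
  obtain ⟨h0, h1⟩ := sum_residue_eq_zero_of_roots hf hX hNv hroots hα hβ
  rw [← hS] at h0 h1
  by_cases hcard : 2 ≤ S.card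
  swap
  · have hS1 : S = {i₀} := by
      have h2 : S.card = 1 := le_antisymm (by omega) (Finset.card_pos.2 ⟨_, hi₀⟩)
      obtain ⟨j, hj⟩ := Finset.card_eq_one.1 h2
      rw [hj, Finset.mem_singleton] at hi₀
      rw [hj, hi₀]
    rw [hS1, Finset.sum_singleton, div_self hN0, residue_one] at h0
    exact one_ne_zero h0
  obtain ⟨c, e, hc, hsep, hdvd, he⟩ := hsep hcard
  have hθ0 : residue w.ring (algebraMap E L c * X ^ e) ≠ 0 := (residue_ne_zero_iff _).2 hc
  have hc0 : algebraMap E L c ≠ 0 := left_ne_zero_of_mul (ne_zero_of_val_eq_one _ hc)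
  set θ := residue w.ring (algebraMap E L c * X ^ e)
  -- With θ the residue of cX^e, each term of p_{S,f,c}(θ) is the residue of a_i X^i / N.
  have hterm : ∀ i ∈ S, algebraMap (Res v) (Res w.ring) (residue v (f.coeff i * (f.coeff i₀)⁻¹ *
      (c ^ ((i - i₀) / e))⁻¹)) * θ ^ ((i - i₀) / e) =
      residue w.ring (algebraMap E L (f.coeff i) * X ^ i / N) := by
    intro i hi
    have hpow : X ^ i = X ^ i₀ * (X ^ e) ^ ((i - i₀) / e) := by
      rw [← pow_mul, Nat.mul_div_cancel' (hdvd i hi), ← pow_add,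
        Nat.add_sub_cancel' (firstIndex_le hi)]
    have e1 : algebraMap E L (f.coeff i) * X ^ i / N =
        algebraMap E L (f.coeff i * (f.coeff i₀)⁻¹ * (c ^ ((i - i₀) / e))⁻¹) *
          (algebraMap E L c * X ^ e) ^ ((i - i₀) / e) := by
      have h2 := left_ne_zero_of_mul hN0
      have h3 := right_ne_zero_of_mul hN0
      simp only [map_mul, map_inv₀, map_pow]
      rw [hN, hpow, mul_pow]
      field_simp
    have hv1 : w.ring.valuation (algebraMap E L (f.coeff i) * X ^ i / N) = 1 := by
      rw [map_div₀, (mem_minIndices.1 hi).2, hNv, div_self (termValue_ne_zero hf hX)]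
    have hv2 : w.ring.valuation ((algebraMap E L c * X ^ e) ^ ((i - i₀) / e)) = 1 := by
      rw [map_pow, hc, one_pow]
    have hv3 : w.ring.valuation (algebraMap E L (f.coeff i * (f.coeff i₀)⁻¹ *
        (c ^ ((i - i₀) / e))⁻¹)) = 1 := by
      rwa [e1, map_mul, hv2, mul_one] at hv1
    rw [e1, residue_mul _ (mem_of_val_eq_one _ hv3) (mem_of_val_eq_one _ hv2),
      algebraMap_residue, residue_pow _ (mem_of_val_eq_one _ hc)]
  have heval : aeval θ (residuePoly v f S e c) = 0 := by
    rw [residuePoly, map_sum, ← h0]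
    refine Finset.sum_congr rfl fun i hi => ?_
    rw [aeval_monomial, ← hterm i hi]
  have heval' : aeval θ (derivative (residuePoly v f S e c)) = 0 := by
    have h2 : (e : Res w.ring) ≠ 0 := by
      rw [← map_natCast (algebraMap (Res v) (Res w.ring))]
      exact (_root_.map_ne_zero (algebraMap (Res v) (Res w.ring))).2 he
    -- Writing i = i₀ + e n_i splits the sum weighted by i into i₀ p(θ) + e θ p'(θ); since e and θ
    -- are nonzero, p'(θ) = 0.
    have h3 : (e : Res w.ring) * (aeval θ (derivative (residuePoly v f S e c)) * θ) = 0 := by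
      have h4 : ∑ i ∈ S, (i : Res w.ring) *
            residue w.ring (algebraMap E L (f.coeff i) * X ^ i / N) =
          (i₀ : Res w.ring) * ∑ i ∈ S, residue w.ring (algebraMap E L (f.coeff i) * X ^ i / N) +
          (e : Res w.ring) * (aeval θ (derivative (residuePoly v f S e c)) * θ) := by
        rw [residuePoly, derivative_sum, map_sum, Finset.sum_mul, Finset.mul_sum, Finset.mul_sum,
          ← Finset.sum_add_distrib]
        refine Finset.sum_congr rfl fun i hi => ?_
        rw [derivative_monomial, aeval_monomial, map_mul, map_natCast, ← hterm i hi]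
        have h5 : (i : Res w.ring) = i₀ + e * ((i - i₀) / e : ℕ) := by
          rw [← Nat.cast_mul, ← Nat.cast_add, Nat.mul_div_cancel' (hdvd i hi),
            Nat.add_sub_cancel' (firstIndex_le hi)]
        rcases Nat.eq_zero_or_pos ((i - i₀) / e) with h6 | h6
        · rw [h6] at h5 ⊢
          rw [h5]
          simp
        · have h7 : θ ^ ((i - i₀) / e) = θ ^ ((i - i₀) / e - 1) * θ := by
            rw [← pow_succ, Nat.sub_add_cancel h6]
          rw [h5, h7]
          ring
      rwa [h1, h0, mul_zero, zero_add, eq_comm] at h4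
    exact (mul_eq_zero.1 ((mul_eq_zero.1 h3).resolve_left h2)).resolve_right hθ0
  obtain ⟨p, q, hpq⟩ := hsep
  have h2 := congrArg (aeval θ) hpq
  rw [map_add, map_mul, map_mul, heval, heval', mul_zero, mul_zero, add_zero, map_one] at h2
  exact zero_ne_one h2

end Newton

end HyperellipticResidue

namespace HyperellipticResidue

open Polynomial

/-! ### The ruled residue theorem and changes of the base field -/

section RuledResidue

variable {E F : Type*} [Field E] [Field F] [Algebra E F] {v : ValuationSubring E} (w : ValExt v F)

/-- The ruled residue theorem. -/
theorem isRuled_resField_adjoin_simple {X y : F} (hy : y ∈ IntermediateField.adjoin E {X})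
    (hyt : Transcendental (Res v) (residue w.ring y)) :
    IsRuled (Res v) (resField w (IntermediateField.adjoin E {X})) := by
  obtain ⟨W⟩ := exists_valExt w.ring (AlgebraicClosure F)
  apply isRuled_resField_of_below w W
  have hmap : (IntermediateField.adjoin E {X}).map
      (IsScalarTower.toAlgHom E F (AlgebraicClosure F)) =
      IntermediateField.adjoin E {algebraMap F (AlgebraicClosure F) X} := by
    rw [IntermediateField.adjoin_map, Set.image_singleton]
    rfl
  have hy' : algebraMap F (AlgebraicClosure F) y ∈
      IntermediateField.adjoin E {algebraMap F (AlgebraicClosure F) X} := by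
    rw [← hmap]
    exact ⟨y, hy, rfl⟩
  have hyt' : Transcendental (Res v)
      (residue (w.below W).ring (algebraMap F (AlgebraicClosure F) y)) := by
    rw [← resHom_residue]
    intro h
    exact hyt ((isAlgebraic_algHom_iff (resHom w W) (resHom w W).injective).1 h)
  obtain ⟨c, d, hc⟩ := exists_isCenter hy' hyt'
  obtain ⟨a, ha⟩ := hc.exists_isMinCenter
  obtain ⟨κ, q, hframe, -⟩ := ha.exists_frame
  rw [hmap]
  exact hframe.isRuled

variable {w} in
theorem exists_transcendental_residue (hw : w ∈ resTrans v F) :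
    ∃ y, Transcendental (Res v) (residue w.ring y) := by
  obtain ⟨t, ht⟩ := hw.transcendental
  obtain ⟨y, -, rfl⟩ := exists_residue_eq w.ring t
  exact ⟨y, ht⟩

variable {w} in
-- If all residues from K were algebraic over Ev, so would be those from F, because F is algebraic
-- over K.
theorem exists_transcendental_residue_mem (hw : w ∈ resTrans v F) {K : IntermediateField E F}
    [Algebra.IsAlgebraic K F] : ∃ y ∈ K, Transcendental (Res v) (residue w.ring y) := by
  by_contra! hcon
  obtain ⟨y, hy⟩ := exists_transcendental_residue hw
  apply hy
  have : Algebra.IsAlgebraic (Res v) (resField w K) := by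
    constructor
    rintro ⟨_, x, hx, hx', rfl⟩
    rw [← isAlgebraic_algebraMap_iff (FaithfulSMul.algebraMap_injective _ (Res w.ring))]
    by_contra h
    exact hcon x hx h
  exact (isAlgebraic_residue w (Algebra.IsAlgebraic.isAlgebraic (R := K) y)).restrictScalars (Res v)

variable {w} in
theorem isRuled_of_adjoin_eq_top (hw : w ∈ resTrans v F) {X : F}
    (hX : IntermediateField.adjoin E {X} = ⊤) : IsRuled (Res v) (Res w.ring) := by
  obtain ⟨y, hy⟩ := exists_transcendental_residue hw
  have h := isRuled_resField_adjoin_simple w (X := X) (y := y)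
    (hX ▸ IntermediateField.mem_top) hy
  rw [hX, resField_top] at h
  exact isRuled_top_iff.1 h

theorem IsRuled.trans {k k₁ κ : Type*} [Field k] [Field k₁] [Field κ] [Algebra k k₁]
    [Algebra k₁ κ] [Algebra k κ] [IsScalarTower k k₁ κ] [FiniteDimensional k k₁]
    (h : IsRuled k₁ κ) : IsRuled k κ := by
  obtain ⟨ℓ, hℓ, x, hx, htop⟩ := h
  have hfin : FiniteDimensional k (ℓ.restrictScalars k) := by
    have : FiniteDimensional k ℓ := FiniteDimensional.trans k k₁ ℓ
    exact this
  refine isRuled_of_eq_top (ℓ.restrictScalars k) (x := x) ?_ ?_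
  · exact (hx.restrictScalars (algebraMap k₁ ℓ).injective).restrictScalars (algebraMap k k₁).injective
  · rw [eq_top_iff]
    intro y _
    have hy : y ∈ IntermediateField.adjoin ℓ {x} := htop ▸ IntermediateField.mem_top
    let M : IntermediateField ℓ κ := Subfield.toIntermediateField
      (ℓ.restrictScalars k ⊔ IntermediateField.adjoin k {x}).toSubfield (fun z =>
        (le_sup_left : ℓ.restrictScalars k ≤ ℓ.restrictScalars k ⊔ IntermediateField.adjoin k {x})
          z.2)
    have hM : IntermediateField.adjoin ℓ {x} ≤ M := by
      rw [IntermediateField.adjoin_simple_le_iff]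
      exact (le_sup_right : IntermediateField.adjoin k {x} ≤
        ℓ.restrictScalars k ⊔ IntermediateField.adjoin k {x})
          (IntermediateField.mem_adjoin_simple_self k x)
    exact hM hy

/-- A finite extension of the base has a finite residue extension, which is absorbed into the
constant field. -/
theorem isRuled_of_isRuled_below {E₁ : Type*} [Field E₁] [Algebra E E₁] [Algebra E₁ F]
    [IsScalarTower E E₁ F] [FiniteDimensional E E₁] (v₁ : ValExt v E₁) (w₁ : ValExt v₁.ring F)
    (hw : v₁.below w₁ ∈ resTrans v F) (h : w₁ ∈ resTrans v₁.ring F →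
      IsRuled (Res v₁.ring) (Res w₁.ring)) : IsRuled (Res v) (Res (v₁.below w₁).ring) := by
  let algInst : Algebra (Res v₁.ring) (Res (v₁.below w₁).ring) :=
    (inferInstance : Algebra (Res v₁.ring) (Res w₁.ring))
  have htower : IsScalarTower (Res v) (Res v₁.ring) (Res (v₁.below w₁).ring) :=
    IsScalarTower.of_algebraMap_eq fun c => (algebraMap_algebraMap_res v₁ w₁ c).symm
  have hfin₁ : FiniteDimensional (Res v) (Res v₁.ring) := by
    have : FiniteDimensional E (⊤ : IntermediateField E E₁) :=
      Module.Finite.equiv (IntermediateField.topEquiv (F := E) (E := E₁)).symm.toLinearEquiv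
    have h1 := finiteDimensional_resField v₁ ⊤
    rw [resField_top] at h1
    exact Module.Finite.equiv (IntermediateField.topEquiv (F := Res v)
      (E := Res v₁.ring)).toLinearEquiv
  have hw₁ : w₁ ∈ resTrans v₁.ring F := by
    obtain ⟨t, ht⟩ := hw.transcendental
    have : Algebra.IsAlgebraic (Res v) (Res v₁.ring) := Algebra.IsAlgebraic.of_finite _ _
    exact ⟨⟨t, ht.extendScalars (Res v₁.ring)⟩⟩
  have h1 : IsRuled (Res v₁.ring) (Res (v₁.below w₁).ring) := h hw₁
  exact h1.trans

variable {w} in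
theorem isRuled_of_isAlgebraic_adjoin (hw : w ∈ resTrans v F) {X Y : F} (hY : IsAlgebraic E Y)
    (hF : IntermediateField.adjoin E {X, Y} = ⊤) : IsRuled (Res v) (Res w.ring) := by
  have hfin : FiniteDimensional E (IntermediateField.adjoin E {Y}) :=
    IntermediateField.adjoin.finiteDimensional hY.isIntegral
  have htop : IntermediateField.adjoin (IntermediateField.adjoin E {Y}) {X} = ⊤ := by
    rw [← IntermediateField.restrictScalars_eq_top_iff (K := E), eq_top_iff, ← hF, Set.pair_comm,
      IntermediateField.adjoin_simple_adjoin_simple]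
  exact isRuled_of_isRuled_below ⟨w.ring.comap (algebraMap (IntermediateField.adjoin E {Y}) F), by
    rw [ValuationSubring.comap_comap, ← IsScalarTower.algebraMap_eq]
    exact w.restrict_eq⟩ ⟨w.ring, rfl⟩ hw fun hw₁ => isRuled_of_adjoin_eq_top hw₁ htop

end RuledResidue

section Below

variable {E F L : Type*} [Field E] [Field F] [Field L] [Algebra E F] [Algebra E L] [Algebra F L]
  [IsScalarTower E F L] {v : ValuationSubring E} (w : ValExt v F) (W : ValExt w.ring L)

theorem minIndices_below (f : E[X]) (X : F) :
    minIndices (w.below W) f (algebraMap F L X) = minIndices w f X := by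
  ext i
  rw [mem_minIndices_iff, mem_minIndices_iff]
  refine and_congr_right fun _ => forall₂_congr fun j _ => ?_
  have key : ∀ j, algebraMap E L (f.coeff j) * algebraMap F L X ^ j =
      algebraMap F L (algebraMap E F (f.coeff j) * X ^ j) := fun j => by
    rw [map_mul, map_pow, ← IsScalarTower.algebraMap_apply]
  rw [key, key, below_val_le_iff]

end Below

/-! ### Non-ruled residue fields force inertia and a monomial valuation -/

section Main

variable {E F : Type*} [Field E] [Field F] [Algebra E F] {v : ValuationSubring E} {w : ValExt v F}
  {f : E[X]} {X Y : F}

/-- Over a non-ruled residue field, the extension `F / E(X)` is inert, the valuation on `E(X)` is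
monomial in `X` and the minimum of the values of the terms of `f(X)` is attained at least twice. -/
theorem inert_and_monomial_of_not_isRuled (hf : f ≠ 0) (hX : Transcendental E X)
    (hY : Y ^ 2 = aeval X f) (hF : IntermediateField.adjoin E {X, Y} = ⊤)
    (h2 : w.ring.valuation 2 = 1) (hw : w ∈ resTransNonRuled v F)
    (hsep : 2 ≤ (minIndices w f X).card → ∃ c : E, ∃ e : ℕ,
      w.ring.valuation (algebraMap E F c * X ^ e) = 1 ∧
      (residuePoly v f (minIndices w f X) e c).Separable ∧
      (∀ i ∈ minIndices w f X, e ∣ i - firstIndex (minIndices w f X)) ∧ (e : Res v) ≠ 0) :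
    (∃ g ∈ IntermediateField.adjoin E {X}, w.ring.valuation g = w.ring.valuation Y ∧
      residue w.ring (Y / g) ∉ resField w (IntermediateField.adjoin E {X})) ∧
    (∀ (p : E[X]) (i : ℕ), w.ring.valuation (algebraMap E F (p.coeff i) * X ^ i) ≤
      w.ring.valuation (aeval X p)) ∧
    2 ≤ (minIndices w f X).card := by
  classical
  obtain ⟨hwt, hwr⟩ := hw
  set K := IntermediateField.adjoin E {X} with hK
  have hX0 : X ≠ 0 := by
    rintro rfl
    exact hX isAlgebraic_zero
  have hfX : aeval X f ≠ 0 := fun h => hf ((transcendental_iff.1 hX) f h)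
  have hY0 : Y ≠ 0 := by
    rintro rfl
    exact hfX (by rw [← hY]; simp)
  have hXK : X ∈ K := IntermediateField.mem_adjoin_simple_self E X
  have hYK : Y ^ 2 ∈ K := hY ▸ aeval_mem_adjoin_simple X f
  have hN := exists_eq_add_mul_of_adjoin hF hXK hYK
  have hKalg : Algebra.IsAlgebraic K F := by
    constructor
    intro x
    obtain ⟨a, ha, b, hb, rfl⟩ := hN x
    have hYalg : IsAlgebraic K Y := by
      refine IsAlgebraic.of_pow (n := 2) two_pos ?_
      exact isAlgebraic_algebraMap (⟨_, hYK⟩ : K)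
    exact (isAlgebraic_algebraMap (⟨a, ha⟩ : K)).add ((isAlgebraic_algebraMap (⟨b, hb⟩ : K)).mul hYalg)
  obtain ⟨y, hy, hyt⟩ := exists_transcendental_residue_mem hwt (K := K)
  -- If the residue field does not grow from K to F, the ruled residue theorem for K already makes
  -- Fw ruled.
  rcases resField_eq_top_or_inert w hN hYK hY0 h2 with htop | ⟨g, hg, hgY, hinert⟩
  · refine (hwr (isRuled_top_iff.1 ?_)).elim
    rw [← htop]
    exact isRuled_resField_adjoin_simple w hy hyt
  refine ⟨⟨g, hg, hgY, hinert⟩, ?_⟩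
  have hg0 : g ≠ 0 := by
    rw [← Valuation.ne_zero_iff w.ring.valuation, hgY]
    exact (Valuation.ne_zero_iff _).2 hY0
  have hMtop : resField w K ⊔ IntermediateField.adjoin (Res v) {residue w.ring (Y / g)} = ⊤ := by
    rw [eq_top_iff]
    intro t _
    obtain ⟨x, -, rfl⟩ := exists_residue_eq w.ring t
    refine residue_mem_of_inert w (fun x => ?_) hinert x
    obtain ⟨a, ha, b, hb, rfl⟩ := hN x
    exact ⟨a, ha, b * g, mul_mem hb hg, by field_simp⟩
  let L := AlgebraicClosure F
  obtain ⟨W⟩ := exists_valExt w.ring L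
  set φ := algebraMap F L
  have hφ : ∀ c : E, φ (algebraMap E F c) = algebraMap E L c := fun c =>
    (IsScalarTower.algebraMap_apply E F L c).symm
  have hmap : K.map (IsScalarTower.toAlgHom E F L) = IntermediateField.adjoin E {φ X} := by
    rw [hK, IntermediateField.adjoin_map, Set.image_singleton]
    rfl
  have hφK : ∀ x ∈ K, φ x ∈ IntermediateField.adjoin E {φ X} := fun x hx => by
    rw [← hmap]
    exact ⟨x, hx, rfl⟩
  have hyt' : Transcendental (Res v) (residue (w.below W).ring (φ y)) := by
    rw [← resHom_residue]
    intro h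
    exact hyt ((isAlgebraic_algHom_iff (resHom w W) (resHom w W).injective).1 h)
  have hnot : ¬ IsRuled (Res v) (resField (w.below W) (IntermediateField.adjoin E {φ X}) ⊔
      IntermediateField.adjoin (Res v) {residue (w.below W).ring (φ Y / φ g)} :
        IntermediateField (Res v) (Res (w.below W).ring)) := by
    intro h
    have h1 : resField (w.below W) (IntermediateField.adjoin E {φ X}) ⊔
      IntermediateField.adjoin (Res v) {residue (w.below W).ring (φ Y / φ g)} =
        (⊤ : IntermediateField (Res v) (Res w.ring)).map (resHom w W) := by
      rw [← hMtop, IntermediateField.map_sup, ← resField_map, hmap, IntermediateField.adjoin_map,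
        Set.image_singleton, resHom_residue, map_div₀]
    rw [h1] at h
    exact hwr (isRuled_top_iff.1 (h.of_algEquiv
      ((⊤ : IntermediateField (Res v) (Res w.ring)).equivMap (resHom w W)).symm))
  have hφY : φ Y ^ 2 = aeval (φ X) f := by
    rw [← map_pow, hY, aeval_algebraMap_apply]
  have hφX0 : φ X ≠ 0 := by simpa using hX0
  have hφg := hφK g hg
  have hφgY : (w.below W).ring.valuation (φ g) = (w.below W).ring.valuation (φ Y) :=
    (below_val_eq_iff w W g Y).2 hgY
  obtain ⟨c, d, hc⟩ := exists_isCenter (hφK y hy) hyt'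
  -- The question is whether 0 is within the least distance |d| from X to algebraic elements. If
  -- not, every root at distance |d| is nearer to X than 0, and separability leaves at most one.
  rcases lt_or_ge ((w.below W).ring.valuation d) ((w.below W).ring.valuation (φ X)) with hlt | hge
  · exfalso
    obtain ⟨a, ha⟩ := hc.exists_isMinCenter
    obtain ⟨κ, q, hframe, ρ, hρ, hρq⟩ := ha.exists_frame
    have hcount : ∀ c c', {c, c'} ≤ f.aroots L →
        (w.below W).ring.valuation (φ X - c) = (w.below W).ring.valuation d →
        (w.below W).ring.valuation (φ X - c') ≠ (w.below W).ring.valuation d := by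
      intro c c' hle hc hc'
      refine not_two_roots (w := w.below W) hf hφX0 ?_ hle (hc ▸ hlt) (hc' ▸ hlt)
      rw [minIndices_below]
      intro hcard
      obtain ⟨c, e, hce, h⟩ := hsep hcard
      refine ⟨c, e, ?_, h⟩
      rw [← map_one w.ring.valuation, ← below_val_eq_iff w W, map_one, map_one, map_mul, map_pow,
        ← IsScalarTower.algebraMap_apply] at hce
      exact hce
    rcases hframe.near_of_countP_le_one ha.toIsCenter hρ hρq hf hcount with
      ⟨c, hc, j, hn⟩ | ⟨c, hc, c₁, hc₁, hn, hcv, hc₁v⟩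
    · exact hnot (hframe.isRuled_of_near_monomial hc (hφY ▸ hn) hφg hφgY)
    · exact hnot (hframe.isRuled_of_near_linear hc hc₁ (hφY ▸ hn) (hφY ▸ hcv) (hφY ▸ hc₁v) hφg hφgY)
  -- Here 0 is a center, automatically of minimal degree, with Q = X: the frame is the Gauss
  -- valuation in X.
  · have hc0 : IsCenter (w.below W) (φ X) 0 d :=
      hc.of_val_le isAlgebraic_zero (by rwa [sub_zero])
    obtain ⟨κ, q, hframe, -⟩ := hc0.isMinCenter_zero.exists_frame
    rw [minpoly.zero, aeval_X] at hframe
    have hgauss : ∀ (p : E[X]) (i : ℕ),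
        w.ring.valuation (algebraMap E F (p.coeff i) * X ^ i) ≤ w.ring.valuation (aeval X p) := by
      intro p i
      by_cases hi : i ∈ Finset.range (p.natDegree + 1)
      · have h1 := val_term_le hframe.alg_scale hframe.eq_mul hframe.trans
          (fun i => algebraMap E L (p.coeff i)) (fun i => isAlgebraic_algebraMap _) _ hi
        have h3 : ∑ i ∈ Finset.range (p.natDegree + 1), algebraMap E L (p.coeff i) * φ X ^ i =
            φ (aeval X p) := by
          rw [aeval_eq_sum_range, map_sum]
          exact Finset.sum_congr rfl fun i _ => by
            rw [Algebra.smul_def, map_mul, map_pow, hφ]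
        rw [h3, ← hφ, ← map_pow, ← map_mul] at h1
        exact (below_val_le_iff w W _ _).1 h1
      · rw [coeff_eq_zero_of_natDegree_lt (by simp at hi; omega)]
        simp
    refine ⟨hgauss, ?_⟩
    -- A single dominant term would put f(X) near a monomial in Q = X, and Fw would be ruled.
    by_contra hcard
    obtain ⟨i₀, hi₀⟩ : ∃ i₀, minIndices w f X = {i₀} := by
      rw [← Finset.card_eq_one]
      exact le_antisymm (by omega) (Finset.card_pos.2 minIndices_nonempty)
    have hi₀S : i₀ ∈ minIndices w f X := hi₀ ▸ Finset.mem_singleton_self i₀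
    have hn : Near w.ring (aeval X f) (algebraMap E F (f.coeff i₀) * X ^ i₀) := by
      have h3 : aeval X f = ∑ i ∈ Finset.range (f.natDegree + 1),
          algebraMap E F (f.coeff i) * X ^ i := by
        rw [aeval_eq_sum_range]
        exact Finset.sum_congr rfl fun i _ => Algebra.smul_def _ _
      rw [Near, h3, ← Finset.add_sum_erase _ _ (mem_minIndices.1 hi₀S).1, add_sub_cancel_left]
      refine Valuation.map_sum_lt _ ((Valuation.ne_zero_iff _).2
        (term_ne_zero_of_mem hf hX0 hi₀S)) fun i hi => ?_
      rw [(mem_minIndices.1 hi₀S).2]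
      refine lt_of_le_of_ne (val_term_le_termValue (Finset.mem_of_mem_erase hi)) fun h => ?_
      have h4 : i ∈ minIndices w f X := mem_minIndices.2 ⟨Finset.mem_of_mem_erase hi, h⟩
      rw [hi₀, Finset.mem_singleton] at h4
      exact Finset.ne_of_mem_erase hi h4
    have hn' : Near (w.below W).ring (φ Y ^ 2) (algebraMap E L (f.coeff i₀) * φ X ^ (i₀ : ℤ)) := by
      rw [zpow_natCast, ← hφ, ← map_pow, ← map_pow, ← map_mul, Near, ← map_sub, below_val_lt_iff,
        hY]
      exact hn
    exact hnot (hframe.isRuled_of_near_monomial (IntermediateField.algebraMap_mem _ _) hn' hφg hφgY)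

end Main

end HyperellipticResidue

namespace HyperellipticResidue

open Polynomial

/-! ### A non-ruled valuation is determined by its minimal indices -/

section Uniqueness

variable {E F : Type*} [Field E] [Field F] [Algebra E F] {v : ValuationSubring E}
  {w w' : ValExt v F} {f : E[X]} {X Y : F}

/-- Equality of the terms of index i and j gives |X|^(j-i) = |a_i/a_j|. Raising to the power j - i
therefore turns the condition on a monomial into one on v alone. -/
theorem val_monomial_le_one_iff (hf : f ≠ 0) (hX : X ≠ 0) {i j : ℕ} (hij : i < j)
    (hi : i ∈ minIndices w f X) (hj : j ∈ minIndices w f X) (c : E) (l : ℤ) :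
    w.ring.valuation (algebraMap E F c * X ^ l) ≤ 1 ↔
      c ^ (j - i) * (f.coeff i / f.coeff j) ^ l ∈ v := by
  have hXm : w.ring.valuation (X ^ (j - i)) =
      w.ring.valuation (algebraMap E F (f.coeff i / f.coeff j)) := by
    have h1 := (mem_minIndices.1 hi).2.trans (mem_minIndices.1 hj).2.symm
    have h2 : algebraMap E F (f.coeff j) ≠ 0 := left_ne_zero_of_mul (term_ne_zero_of_mem hf hX hj)
    rw [pow_sub₀ _ hX hij.le, ← div_eq_mul_inv, map_div₀ w.ring.valuation, map_div₀ (algebraMap E F),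
      map_div₀ w.ring.valuation, div_eq_div_iff ((Valuation.ne_zero_iff _).2 (pow_ne_zero _ hX))
      ((Valuation.ne_zero_iff _).2 h2), ← map_mul, ← map_mul, h1, mul_comm]
  rw [← w.algebraMap_mem_iff, ← w.ring.valuation_le_one_iff]
  have h3 : w.ring.valuation (algebraMap E F (c ^ (j - i) * (f.coeff i / f.coeff j) ^ l)) =
      w.ring.valuation (algebraMap E F c * X ^ l) ^ (j - i) := by
    rw [map_mul, map_mul, map_zpow₀, map_zpow₀, ← hXm, ← map_zpow₀, ← map_pow, mul_pow, map_mul,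
      map_pow, ← zpow_natCast (X ^ l), zpow_comm, zpow_natCast]
  rw [h3]
  exact (pow_le_one_iff_of_nonneg zero_le (by omega)).symm

theorem val_term_le_iff (hX : X ≠ 0) {c c' : E} (hc' : c' ≠ 0) (i j : ℕ) :
    w.ring.valuation (algebraMap E F c * X ^ i) ≤ w.ring.valuation (algebraMap E F c' * X ^ j) ↔
      w.ring.valuation (algebraMap E F (c / c') * X ^ ((i : ℤ) - j)) ≤ 1 := by
  have h1 : algebraMap E F c' * X ^ j ≠ 0 := mul_ne_zero (by simpa using hc') (pow_ne_zero _ hX)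
  have h2 : algebraMap E F (c / c') * X ^ ((i : ℤ) - j) =
      algebraMap E F c * X ^ i / (algebraMap E F c' * X ^ j) := by
    rw [zpow_sub₀ hX, zpow_natCast, zpow_natCast, map_div₀, mul_div_mul_comm]
  rw [h2, map_div₀, div_le_one₀ ((Valuation.pos_iff _).2 h1)]

/-- For a monomial valuation the value of a polynomial is its largest term value, so comparing
polynomials only involves comparing monomials. -/
theorem val_aeval_le_iff (hX : X ≠ 0)
    (hw : ∀ (p : E[X]) (i : ℕ), w.ring.valuation (algebraMap E F (p.coeff i) * X ^ i) ≤
      w.ring.valuation (aeval X p)) (g : E[X]) {h : E[X]} (hh : h ≠ 0) :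
    w.ring.valuation (aeval X g) ≤ w.ring.valuation (aeval X h) ↔
      ∀ i, ∃ j ∈ h.support, w.ring.valuation
        (algebraMap E F (g.coeff i / h.coeff j) * X ^ ((i : ℤ) - j)) ≤ 1 := by
  have hsum : ∀ p : E[X], aeval X p = ∑ i ∈ p.support, algebraMap E F (p.coeff i) * X ^ i := by
    intro p
    rw [aeval_def, eval₂_eq_sum, Polynomial.sum]
  obtain ⟨j, hj, hmax⟩ := h.support.exists_max_image
    (fun i => w.ring.valuation (algebraMap E F (h.coeff i) * X ^ i)) (nonempty_support_iff.2 hh)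
  have hval : w.ring.valuation (aeval X h) =
      w.ring.valuation (algebraMap E F (h.coeff j) * X ^ j) := by
    refine le_antisymm ?_ (hw h j)
    rw [hsum]
    exact Valuation.map_sum_le _ hmax
  constructor
  · intro hle i
    refine ⟨j, hj, (val_term_le_iff hX (mem_support_iff.1 hj) i j).1 ?_⟩
    exact (hw g i).trans (hle.trans hval.le)
  · intro hle
    rw [hsum g]
    refine Valuation.map_sum_le _ fun i _ => ?_
    obtain ⟨j', hj', hle'⟩ := hle i
    exact ((val_term_le_iff hX (mem_support_iff.1 hj') i j').2 hle').trans (hw h j')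

/-- A monomial valuation on `E(X)` is determined by the set of minimal indices. -/
theorem mem_ring_iff_of_minIndices_eq (hf : f ≠ 0) (hX : Transcendental E X)
    (hS : minIndices w f X = minIndices w' f X) (hcard : 2 ≤ (minIndices w f X).card)
    (hw : ∀ (p : E[X]) (i : ℕ), w.ring.valuation (algebraMap E F (p.coeff i) * X ^ i) ≤
      w.ring.valuation (aeval X p))
    (hw' : ∀ (p : E[X]) (i : ℕ), w'.ring.valuation (algebraMap E F (p.coeff i) * X ^ i) ≤
      w'.ring.valuation (aeval X p)) {y : F} (hy : y ∈ IntermediateField.adjoin E {X}) :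
    y ∈ w.ring ↔ y ∈ w'.ring := by
  have hX0 : X ≠ 0 := by
    rintro rfl
    exact hX isAlgebraic_zero
  obtain ⟨i, hi, j, hj, hij⟩ : ∃ i ∈ minIndices w f X, ∃ j ∈ minIndices w f X, i < j := by
    obtain ⟨i, hi, j, hj, hne⟩ := Finset.one_lt_card.1 hcard
    rcases lt_or_gt_of_ne hne with h | h
    · exact ⟨i, hi, j, hj, h⟩
    · exact ⟨j, hj, i, hi, h⟩
  obtain ⟨g, h, rfl⟩ := (IntermediateField.mem_adjoin_simple_iff E y).1 hy
  by_cases hh : h = 0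
  · simp [hh]
  have hh0 : aeval X h ≠ 0 := fun h0 => hh ((transcendental_iff.1 hX) h h0)
  rw [← w.ring.valuation_le_one_iff, ← w'.ring.valuation_le_one_iff, map_div₀, map_div₀,
    div_le_one₀ ((Valuation.pos_iff _).2 hh0), div_le_one₀ ((Valuation.pos_iff _).2 hh0),
    val_aeval_le_iff hX0 hw g hh, val_aeval_le_iff hX0 hw' g hh]
  simp only [val_monomial_le_one_iff hf hX0 hij hi hj,
    val_monomial_le_one_iff (w := w') hf hX0 hij (hS ▸ hi) (hS ▸ hj)]

theorem val_lt_one_iff_inv {A : ValuationSubring F} {y : F} :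
    A.valuation y < 1 ↔ y = 0 ∨ y⁻¹ ∉ A := by
  rw [← A.mem_nonunits_iff, A.mem_nonunits_iff_or]

/-- An inert extension is determined by its restriction to `K`. -/
theorem ring_eq_of_inert {K : IntermediateField E F}
    (hN : ∀ x : F, ∃ a ∈ K, ∃ b ∈ K, x = a + b * Y) (hYK : Y ^ 2 ∈ K) (hY0 : Y ≠ 0)
    (hK : ∀ y ∈ K, y ∈ w.ring ↔ y ∈ w'.ring) {g : F} (hg : g ∈ K)
    (hgY : w.ring.valuation g = w.ring.valuation Y)
    (hinert : residue w.ring (Y / g) ∉ resField w K) : w.ring = w'.ring := by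
  have hYv : w.ring.valuation Y ≠ 0 := (Valuation.ne_zero_iff _).2 hY0
  have hg0 : g ≠ 0 := by
    rw [← Valuation.ne_zero_iff w.ring.valuation, hgY]
    exact hYv
  have hK' : ∀ y ∈ K, w.ring.valuation y < 1 ↔ w'.ring.valuation y < 1 := by
    intro y hy
    rw [val_lt_one_iff_inv, val_lt_one_iff_inv, hK _ (inv_mem hy)]
  set z := Y / g with hz
  have hzK : z ^ 2 ∈ K := by
    rw [hz, div_pow]
    exact div_mem hYK (pow_mem hg 2)
  have hz1 : w.ring.valuation z = 1 := by rw [hz, map_div₀, hgY, div_self hYv]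
  have hz2 : w.ring.valuation (z ^ 2) = 1 := by rw [map_pow, hz1, one_pow]
  have hz2' : w'.ring.valuation (z ^ 2) = 1 := by
    refine le_antisymm ((w'.ring.valuation_le_one_iff _).2
      ((hK _ hzK).1 (mem_of_val_eq_one _ hz2))) (not_lt.1 fun h => ?_)
    exact hz2.not_lt ((hK' _ hzK).2 h)
  have hz1' : w'.ring.valuation z = 1 := by
    rw [map_pow] at hz2'
    exact (pow_eq_one_iff_of_nonneg zero_le two_ne_zero).1 hz2'
  -- Inertia passes to w'. If r in K has the residue of z under w', then r^2 - z^2 lies in K and has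
  -- value below 1 for w', hence also for w; so z has the residue of r or -r under w, contradicting
  -- inertia there.
  have hinert' : residue w'.ring z ∉ resField w' K := by
    rintro ⟨r, hr, hrA', hrz⟩
    rw [residue_eq_iff _ hrA' (mem_of_val_eq_one _ hz1')] at hrz
    have hrA := (hK r hr).2 hrA'
    have hzA := mem_of_val_eq_one _ hz1
    have h1 : w'.ring.valuation (r ^ 2 - z ^ 2) < 1 := by
      rw [sq_sub_sq, mul_comm, map_mul]
      refine mul_lt_one_of_lt_of_le hrz ?_
      rw [w'.ring.valuation_le_one_iff]
      exact add_mem hrA' (mem_of_val_eq_one _ hz1')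
    have h2 := (hK' _ (sub_mem (pow_mem hr 2) hzK)).2 h1
    rw [sq_sub_sq, ← residue_eq_zero_iff _ (mul_mem (add_mem hrA hzA) (sub_mem hrA hzA)),
      residue_mul _ (add_mem hrA hzA) (sub_mem hrA hzA), residue_add _ hrA hzA,
      residue_sub _ hrA hzA, mul_eq_zero] at h2
    apply hinert
    rcases h2 with h2 | h2
    · rw [eq_neg_of_add_eq_zero_right h2]
      exact neg_mem (residue_mem_resField w hr)
    · rw [← sub_eq_zero.1 h2]
      exact residue_mem_resField w hr
  refine ValuationSubring.ext _ _ fun x => ?_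
  obtain ⟨a, ha, b, hb, rfl⟩ := hN x
  have e : a + b * Y = a + b * g * z := by
    rw [hz]
    field_simp
  rw [e, mem_ring_iff_of_inert w hinert ha (mul_mem hb hg),
    mem_ring_iff_of_inert w' hinert' ha (mul_mem hb hg), hK a ha, hK _ (mul_mem hb hg)]

theorem ValExt.ext_ring (h : w.ring = w'.ring) : w = w' := by
  cases w
  cases w'
  cases h
  rfl

/-- The ultrametric inequality bounds |f(X)| by the largest term; the monomial property gives the
reverse. -/
theorem isOvert_of_monomial
    (hw : ∀ (p : E[X]) (i : ℕ), w.ring.valuation (algebraMap E F (p.coeff i) * X ^ i) ≤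
      w.ring.valuation (aeval X p)) : IsOvert w f X := by
  refine le_antisymm ?_ (Finset.sup'_le _ _ fun i _ => hw f i)
  rw [aeval_eq_sum_range]
  refine Valuation.map_sum_le _ fun i hi => ?_
  rw [Algebra.smul_def]
  exact val_term_le_termValue hi

/-- For polynomials of degree at most one, all residue fields are ruled. -/
theorem isRuled_of_natDegree_le_one (hdeg : f.natDegree ≤ 1) (hY : Y ^ 2 = aeval X f)
    (hF : IntermediateField.adjoin E {X, Y} = ⊤) (hw : w ∈ resTrans v F) :
    IsRuled (Res v) (Res w.ring) := by
  obtain ⟨a, b, rfl⟩ := exists_eq_X_add_C_of_natDegree_le_one hdeg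
  by_cases ha : a = 0
  · refine isRuled_of_isAlgebraic_adjoin hw (IsAlgebraic.of_pow (n := 2) two_pos ?_) hF
    rw [hY, ha]
    simpa using isAlgebraic_algebraMap b
  · refine isRuled_of_adjoin_eq_top hw (X := Y) ?_
    rw [eq_top_iff, ← hF, IntermediateField.adjoin_le_iff]
    have hYmem := IntermediateField.mem_adjoin_simple_self E Y
    rintro y (rfl | rfl)
    · have ha' : algebraMap E F a ≠ 0 := by simpa using ha
      have e : y = (Y ^ 2 - algebraMap E F b) / algebraMap E F a := by
        rw [hY]
        simp
        field_simp
      rw [SetLike.mem_coe, e]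
      exact div_mem (sub_mem (pow_mem hYmem 2) (IntermediateField.algebraMap_mem _ _))
        (IntermediateField.algebraMap_mem _ _)
    · exact hYmem

theorem val_two_eq_one (h : (2 : Res v) ≠ 0) (w : ValExt v F) : w.ring.valuation 2 = 1 := by
  rw [← residue_ne_zero_iff]
  have h1 := residue_natCast w.ring 2
  push_cast at h1
  rw [h1]
  have h2 := (_root_.map_ne_zero (algebraMap (Res v) (Res w.ring))).2 h
  rwa [map_ofNat] at h2

theorem natCast_ne_zero_of_ringChar {k : Type*} [Field k] {n m : ℕ}
    (hchar : ringChar k = 0 ∨ n < ringChar k) (hm : 0 < m) (hmn : m ≤ n) : (m : k) ≠ 0 := by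
  intro h
  have h1 := (ringChar.spec k m).1 h
  rcases hchar with h0 | hlt
  · rw [h0, zero_dvd_iff] at h1
    omega
  · exact absurd (Nat.le_of_dvd hm h1) (by omega)

end Uniqueness

end HyperellipticResidue

theorem mainTheorem3 {E F : Type*} [Field E] [Field F] [Algebra E F]
    (v : ValuationSubring E) (f : Polynomial E) (hf : Squarefree f)
    (hchar : ringChar (HyperellipticResidue.Res v) = 0 ∨
      f.natDegree < ringChar (HyperellipticResidue.Res v))
    (X Y : F) (hX : Transcendental E X) (hY : Y ^ 2 = Polynomial.aeval X f)
    (hF : IntermediateField.adjoin E {X, Y} = ⊤)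
    (Ω : Set (HyperellipticResidue.ValExt v F)) (hΩ : Ω ⊆ HyperellipticResidue.resTrans v F)
    (hsep : ∀ w ∈ Ω, ∀ S : Finset ℕ, S = HyperellipticResidue.minIndices w f X → 2 ≤ S.card →
      ∀ c : E, w.ring.valuation
          (algebraMap E F c * X ^ HyperellipticResidue.eS v f X S) = 1 →
        (HyperellipticResidue.residuePoly v f S
          (HyperellipticResidue.eS v f X S) c).Separable) :
    HyperellipticResidue.covert f X Ω ∩ HyperellipticResidue.resTransNonRuled v F = ∅ ∧
      (Ω ∩ HyperellipticResidue.resTransNonRuled v F).Finite := by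
  have hf0 : f ≠ 0 := hf.ne_zero
  have hX0 : X ≠ 0 := by
    rintro rfl
    exact hX isAlgebraic_zero
  -- For n ≤ 1 residue characteristic 2 is not excluded, but F is generated by one element over E or
  -- over a finite extension of E, so every residue field is ruled.
  by_cases hdeg : f.natDegree ≤ 1
  · have hempty : ∀ w, w ∉ HyperellipticResidue.resTransNonRuled v F := fun w hw =>
      hw.2 (HyperellipticResidue.isRuled_of_natDegree_le_one hdeg hY hF hw.1)
    have hempty' : HyperellipticResidue.resTransNonRuled v F = ∅ :=
      Set.eq_empty_iff_forall_notMem.2 hempty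
    rw [hempty', Set.inter_empty, Set.inter_empty]
    exact ⟨rfl, Set.finite_empty⟩
  have h2 : (2 : HyperellipticResidue.Res v) ≠ 0 := by
    have := HyperellipticResidue.natCast_ne_zero_of_ringChar hchar two_pos (by omega)
    exact_mod_cast this
  have key : ∀ w ∈ Ω ∩ HyperellipticResidue.resTransNonRuled v F, _ := fun w hw =>
    HyperellipticResidue.inert_and_monomial_of_not_isRuled hf0 hX hY hF
      (HyperellipticResidue.val_two_eq_one h2 w) hw.2 fun hcard => by
        have hS : HyperellipticResidue.minIndices w f X ⊆ Finset.range (f.natDegree + 1) :=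
          fun i hi => (HyperellipticResidue.mem_minIndices.1 hi).1
        obtain ⟨hdvd, c, hc⟩ := HyperellipticResidue.eS_spec hf0 hX0 hw.2.1 hcard
        obtain ⟨hpos, hle⟩ := HyperellipticResidue.gapGcd_pos_and_le hcard hS
        -- e_S divides d, and 0 < d ≤ n, so the assumption on the characteristic makes e_S nonzero
        -- in Ev.
        exact ⟨c, _, hc, hsep w hw.1 _ rfl hcard c hc,
          fun i hi => hdvd.trans (HyperellipticResidue.dvd_gap hi),
          HyperellipticResidue.natCast_ne_zero_of_ringChar hchar (Nat.pos_of_dvd_of_pos hdvd hpos)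
            ((Nat.le_of_dvd hpos hdvd).trans hle)⟩
  constructor
  · rw [Set.eq_empty_iff_forall_notMem]
    rintro w ⟨⟨hwΩ, hcov⟩, hw⟩
    exact hcov (HyperellipticResidue.isOvert_of_monomial (key w ⟨hwΩ, hw⟩).2.1)
  -- Finiteness comes from injectivity of w ↦ S into the finite set of subsets of {0, ..., n}.
  · refine Set.Finite.of_injOn (f := fun w => HyperellipticResidue.minIndices w f X)
      (t := ((Finset.range (f.natDegree + 1)).powerset : Set (Finset ℕ))) ?_ ?_
      (Finset.finite_toSet _)
    · intro w _
      rw [Finset.mem_coe, Finset.mem_powerset]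
      exact fun i hi => (HyperellipticResidue.mem_minIndices.1 hi).1
    · intro w hw w' hw' hS
      obtain ⟨⟨g, hg, hgY, hinert⟩, hmono, hcard⟩ := key w hw
      obtain ⟨-, hmono', -⟩ := key w' hw'
      have hYK : Y ^ 2 ∈ IntermediateField.adjoin E {X} :=
        hY ▸ HyperellipticResidue.aeval_mem_adjoin_simple X f
      have hY0 : Y ≠ 0 := by
        rintro rfl
        exact hf0 (transcendental_iff.1 hX f (by rw [← hY]; simp))
      exact HyperellipticResidue.ValExt.ext_ring (HyperellipticResidue.ring_eq_of_inert
        (HyperellipticResidue.exists_eq_add_mul_of_adjoin hF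
          (IntermediateField.mem_adjoin_simple_self E X) hYK) hYK hY0
        (fun y hy => HyperellipticResidue.mem_ring_iff_of_minIndices_eq hf0 hX hS hcard hmono
          hmono' hy) hg hgY hinert)
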